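/- **Data.** Let $N,m\ge 0$ be integers, $b\in\mathbb C\setminus\{0\}$, $\Lambda\in\mathbb R$, $k_1,\dots,k_N\in\mathbb Z$. Let $U\subset\{z\in\mathbb C^N: z_i\ne z_j \text{ for } i\neq j\}$ be open, with continuous branches of $\log(z_i-z_j)$, $i<j$, fixed on $U$, and put $$\phi_0(z)=\exp\Big(-\frac{\Lambda}{2b^2}\sum_{i}k_iz_i\Big)\prod_{i<j}(z_i-z_j)^{-\frac{k_ik_j}{2b^2}},\qquad A(z,w)=\exp\Big(\frac{\Lambda}{b^2}\sum_{p=1}^m w_p\Big)\prod_{p<q}(w_p-w_q)^{-\frac2{b^2}}\prod_{p,j}(w_p-z_j)^{\frac{k_j}{b^2}} .$$ **Cycles.** Let $\Gamma=\Gamma(z)$, $z\in U$, be a twisted cycle of rapid decay for $A$, that is, a finite or infinite sum $\Gamma=\sum_n c_n\sigma_n$, $c_n\in\mathbb C$, of singular cubes $\sigma_n(z,\cdot):[0,1]^m\to\{w\in\mathbb C^m: w_p\ne w_q \ (p\ne q),\ w_p\ne z_j\}$, each with branches of $\log(w_p-z_j)$ and of $\log(w_p-w_q)$ ($p<q$)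 along it (hence a branch of $A$), the $w_p$ and these logarithms being $C^2$ in the real sense, jointly in $z\in U$ and the cube coordinates, such that * (cycle) the boundary of $\Gamma$ vanishes modulo degenerate cubes: for every non-degenerate singular $(m-1)$-cube that occurs (for all $z \in U$) as a face of some $\sigma_n$, the sum over all its occurrences of (incidence sign)$\,\cdot c_n\cdot$(branch of $A$ along it) is $0$; * (decay) for every $K\in\mathbb N$, locally uniformly in $z\in U$, the series $\sum_n\sup_{[0,1]^m}|c_nA|\,S_n^K$ is dominated by a convergent series of constants, where $S_n$ is $1$ plus the sum of the norms of the first and of the second derivatives, in $z$ and the cube coordinates, of all $w_p$, $\log(w_p-z_j)$ and $\log(w_p-w_q)$ ($p<q$) along $\sigma_n$. **Blocks.** For $\mathbf m=(m_1,\dots,m_N)$, $m_i\ge0$, $\sum_i m_i=m$, let $$\phi^{(\mathbf m)}(z)=\int_\Gamma A(z,w)\sum_{a}\ \prod_{p=1}^m\frac1{w_p-z_{a(p)}}\,d^mw ,$$ the sum being over all maps $a:\{1,\dots,m\}\to\{1,\dots,N\}$ that take each value $j$ exactly $m_j$ times, and let $\widehat\psi=(\phi^{(\mathbf m)})_{\mathbf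 m}$. **Representations.** Let $V_k$ be the $sl(2)$-module with basis $Y^lv_k$, $l=0,1,2,\dots$, with $Xv_k=0$, $Hv_k=kv_k$, where $[H,X]=2X$, $[H,Y]=-2Y$, $[X,Y]=H$. On $V_{k_1}\otimes\cdots\otimes V_{k_N}$, with an index $i$ for the action on the $i$-th factor, put $\Omega_{ij}=\frac12H_iH_j+X_iY_j+Y_iX_j$, $v=v_{k_1}\otimes\cdots\otimes v_{k_N}$, and $\widehat\Omega_{ij}=\Omega_{ij}-\frac{k_ik_j}2$. On the height $m$ subspace, with basis $Y^{\mathbf m}v=Y_1^{m_1}\cdots Y_N^{m_N}v$, $\sum_i m_i=m$, write $\Omega_{ij},\widehat\Omega_{ij}$ also for the matrices whose row $\mathbf m$ consists of the coefficients of the image of $Y^{\mathbf m}v$. Finally let $$F(z,w)=\exp\Big(\frac{\Lambda w}{b^2}\Big)\prod_j(w-z_j)^{\frac{k_j}{b^2}}\sum_i\frac{Y_i}{w-z_i},\qquad \rho(w)=\prod_{p<q}(w_p-w_q)^{-\frac2{b^2}},$$ $$\Psi(z)=\phi_0(z)\int_\Gamma\rho(w)F(z,w_1)F(z,w_2)\cdots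 F(z,w_m)\,v\,d^mw .$$ **Theorem.** All these integrals converge absolutely for $z\in U$, all partial derivatives below exist on $U$, and for all $i=1,\dots,N$ and $z\in U$: 1. $\displaystyle -b^2\partial_i\widehat\psi=A_i\widehat\psi+\sum_{j\ne i}\frac{\widehat\Omega_{ij}^T}{z_i-z_j}\widehat\psi$, where $A_i$ is diagonal: $A_i\phi^{(\mathbf m)}=-\Lambda m_i\,\phi^{(\mathbf m)}$. 2. The full conformal block $\psi=\phi_0\widehat\psi$ satisfies $\displaystyle -b^2\partial_i\psi=\frac{\Lambda}{2}H_i\psi+\sum_{j\ne i}\frac{\Omega_{ij}^T}{z_i-z_j}\psi$, where $H_i$ is diagonal: $H_i\phi^{(\mathbf m)}=(k_i-2m_i)\phi^{(\mathbf m)}$. 3. $\Psi$ satisfies the height $m$ irregular KZ equation $\displaystyle -b^2\partial_i\Psi=\Big(\frac\Lambda2H_i+\sum_{j\ne i}\frac{\Omega_{ij}}{z_i-z_j}\Big)\Psi$. 4. $\Psi=\sum_{\mathbf m}\phi_0\,\phi^{(\mathbf m)}\,Y^{\mathbf m}v$. The equations in 2 and 3 are equivalent: a vector $(f_{\mathbf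 m})_{\mathbf m}$ of functions satisfies the equation in 2 if and only if $\sum_{\mathbf m}f_{\mathbf m}Y^{\mathbf m}v$ satisfies the equation in 3. Moreover $H_iY^{\mathbf m}v=(k_i-2m_i)Y^{\mathbf m}v$. -/

import Mathlib

open scoped BigOperators TensorProduct Topology

namespace IrregularKZ

noncomputable section

/-! ### The `sl(2)` side: tensor products of highest weight modules -/

/-- The highest weight module `V_k = {Y^l v_k | l = 0, 1, 2, ...}`; the basis vector
`Finsupp.single l 1` stands for `Y^l v_k`. The underlying space does not depend on `k`; the action
of `sl(2)` does. -/
abbrev Verma : Type := ℕ →₀ ℂ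

/-- `Y (Y^l v_k) = Y^(l+1) v_k`. -/
def vermaY : Verma →ₗ[ℂ] Verma :=
  Finsupp.linearCombination ℂ (fun l : ℕ => Finsupp.single (l + 1) (1 : ℂ))

/-- `H (Y^l v_k) = (k - 2l) Y^l v_k`. -/
def vermaH (k : ℂ) : Verma →ₗ[ℂ] Verma :=
  Finsupp.linearCombination ℂ (fun l : ℕ => Finsupp.single l (k - 2 * (l : ℂ)))

/-- `X (Y^l v_k) = l (k - l + 1) Y^(l-1) v_k`, in particular `X v_k = 0`. -/
def vermaX (k : ℂ) : Verma →ₗ[ℂ] Verma :=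
  Finsupp.linearCombination ℂ
    (fun l : ℕ => Finsupp.single (l - 1) ((l : ℂ) * (k - (l : ℂ) + 1)))

/-- The tensor product `V_{k_1} ⊗ ... ⊗ V_{k_N}`. -/
abbrev TensorSpace (N : ℕ) : Type := ⨂[ℂ] _i : Fin N, Verma

/-- The operator acting as `f` on the `i`-th tensor factor and as the identity on the others. -/
def site {N : ℕ} (i : Fin N) (f : Verma →ₗ[ℂ] Verma) : Module.End ℂ (TensorSpace N) :=
  PiTensorProduct.map (Function.update (fun _ : Fin N => (LinearMap.id : Verma →ₗ[ℂ] Verma)) i f)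

def opH {N : ℕ} (k : Fin N → ℤ) (i : Fin N) : Module.End ℂ (TensorSpace N) :=
  site i (vermaH (k i : ℂ))

def opX {N : ℕ} (k : Fin N → ℤ) (i : Fin N) : Module.End ℂ (TensorSpace N) :=
  site i (vermaX (k i : ℂ))

def opY {N : ℕ} (i : Fin N) : Module.End ℂ (TensorSpace N) :=
  site i vermaY

/-- `Ω_ij = H_i H_j / 2 + X_i Y_j + Y_i X_j`. -/
def Omega {N : ℕ} (k : Fin N → ℤ) (i j : Fin N) : Module.End ℂ (TensorSpace N) :=
  (1 / 2 : ℂ) • (opH k i * opH k j) + opX k i * opY j + opY i * opX k j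

/-- The highest weight vector `v = v_{k_1} ⊗ ... ⊗ v_{k_N}`. -/
def hwVector (N : ℕ) : TensorSpace N :=
  PiTensorProduct.tprod ℂ (fun _ : Fin N => (Finsupp.single 0 1 : Verma))

/-- `Y_1^{μ_1} Y_2^{μ_2} ... Y_N^{μ_N} v`. -/
def descendant {N : ℕ} (μ : Fin N → ℕ) : TensorSpace N :=
  (List.ofFn (fun i : Fin N => opY i ^ μ i)).prod (hwVector N)

/-- The basis of `V_{k_1} ⊗ ... ⊗ V_{k_N}` made of the vectors
`Y^{μ_1} v_{k_1} ⊗ ... ⊗ Y^{μ_N} v_{k_N}`. -/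
def tensorBasis (N : ℕ) : Module.Basis (Fin N → ℕ) ℂ (TensorSpace N) :=
  Basis.piTensorProduct (fun _ : Fin N => (Finsupp.basisSingleOne : Module.Basis ℕ ℂ Verma))

/-- The multi-indices `μ = (μ_1, ..., μ_N)` with `μ_1 + ... + μ_N = m`. -/
abbrev HeightIndex (N m : ℕ) : Type :=
  {μ : Fin N → ℕ // μ ∈ Finset.piAntidiag (Finset.univ : Finset (Fin N)) m}

/-- The matrix of `Ω_ij` on the height `m` subspace: its row `μ` lists the coefficients of
`Ω_ij Y^μ v` in the basis `Y^ν v`. -/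
def OmegaMatrix {N : ℕ} (m : ℕ) (k : Fin N → ℤ) (i j : Fin N) :
    Matrix (HeightIndex N m) (HeightIndex N m) ℂ :=
  Matrix.of fun μ ν => (tensorBasis N).repr (Omega k i j (tensorBasis N μ.1)) ν.1

/-- `Ω̂_ij`, determined by `Ω_ij = k_i k_j / 2 + Ω̂_ij`. -/
def OmegaHat {N : ℕ} (m : ℕ) (k : Fin N → ℤ) (i j : Fin N) :
    Matrix (HeightIndex N m) (HeightIndex N m) ℂ :=
  OmegaMatrix m k i j -
    (((k i : ℂ) * (k j : ℂ)) / 2) • (1 : Matrix (HeightIndex N m) (HeightIndex N m) ℂ)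

/-- The diagonal matrix with entries `-Λ μ_i`. -/
def AMatrix {N : ℕ} (m : ℕ) (lam : ℝ) (i : Fin N) :
    Matrix (HeightIndex N m) (HeightIndex N m) ℂ :=
  Matrix.diagonal fun μ => -(lam : ℂ) * (μ.1 i : ℂ)

/-- The diagonal matrix with entries `k_i - 2 μ_i`. -/
def HMatrix {N : ℕ} (m : ℕ) (k : Fin N → ℤ) (i : Fin N) :
    Matrix (HeightIndex N m) (HeightIndex N m) ℂ :=
  Matrix.diagonal fun μ => (k i : ℂ) - 2 * (μ.1 i : ℂ)

/-! ### The differential equations -/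

/-- `-b² ∂_i f = A_i f + ∑_{j ≠ i} Ω̂ᵀ_ij f / (z_i - z_j)` at the point `z`. -/
def SolvesHatKZ {N m : ℕ} (b : ℂ) (lam : ℝ) (k : Fin N → ℤ) (i : Fin N)
    (f : (Fin N → ℂ) → HeightIndex N m → ℂ) (z : Fin N → ℂ) : Prop :=
  ∃ D : HeightIndex N m → ℂ,
    HasDerivAt (fun ζ : ℂ => f (Function.update z i ζ)) D (z i) ∧
    (-b ^ 2) • D = (AMatrix m lam i).mulVec (f z) +
      ∑ j ∈ Finset.univ.erase i, (z i - z j)⁻¹ • (OmegaHat m k i j).transpose.mulVec (f z)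

/-- `-b² ∂_i f = (Λ/2) H_i f + ∑_{j ≠ i} Ωᵀ_ij f / (z_i - z_j)` at the point `z`. -/
def SolvesCoeffKZ {N m : ℕ} (b : ℂ) (lam : ℝ) (k : Fin N → ℤ) (i : Fin N)
    (f : (Fin N → ℂ) → HeightIndex N m → ℂ) (z : Fin N → ℂ) : Prop :=
  ∃ D : HeightIndex N m → ℂ,
    HasDerivAt (fun ζ : ℂ => f (Function.update z i ζ)) D (z i) ∧
    (-b ^ 2) • D = ((lam : ℂ) / 2) • (HMatrix m k i).mulVec (f z) +
      ∑ j ∈ Finset.univ.erase i, (z i - z j)⁻¹ • (OmegaMatrix m k i j).transpose.mulVec (f z)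

/-- `D` is the partial derivative `∂_i Ψ` at `z`. The tensor product carries no topology; for
functions with values in a fixed finite-dimensional subspace, differentiability against all linear
functionals is ordinary differentiability. -/
def HasPartialAt {N : ℕ} (i : Fin N) (Psi : (Fin N → ℂ) → TensorSpace N) (D : TensorSpace N)
    (z : Fin N → ℂ) : Prop :=
  ∀ l : Module.Dual ℂ (TensorSpace N),
    HasDerivAt (fun ζ : ℂ => l (Psi (Function.update z i ζ))) (l D) (z i)

/-- `-b² ∂_i Ψ = ((Λ/2) H_i + ∑_{j ≠ i} Ω_ij / (z_i - z_j)) Ψ` at the point `z`. -/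
def SolvesKZ {N : ℕ} (b : ℂ) (lam : ℝ) (k : Fin N → ℤ) (i : Fin N)
    (Psi : (Fin N → ℂ) → TensorSpace N) (z : Fin N → ℂ) : Prop :=
  ∃ D : TensorSpace N, HasPartialAt i Psi D z ∧
    (-b ^ 2) • D = (((lam : ℂ) / 2) • opH k i +
      ∑ j ∈ Finset.univ.erase i, (z i - z j)⁻¹ • Omega k i j) (Psi z)

/-! ### The integrands

Every non-integer power `x^e` of a difference `x` of coordinates is `exp (e * log x)`, where the
value of `log x` belongs to the chosen branch and is passed as an argument: `lz i j` is a value of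
`log (z_i - z_j)` for `i < j`, `lw p q` is a value of `log (w_p - w_q)` for `p < q`, and `lwz p j`
is a value of `log (w_p - z_j)`. -/

/-- `φ_0(z) = exp(-Λ/(2b²) ∑ k_i z_i) ∏_{i<j} (z_i - z_j)^{-k_i k_j/(2b²)}`. -/
def phiZero {N : ℕ} (b : ℂ) (lam : ℝ) (k : Fin N → ℤ) (z : Fin N → ℂ)
    (lz : Fin N → Fin N → ℂ) : ℂ :=
  Complex.exp (-((lam : ℂ) / (2 * b ^ 2)) * ∑ i, (k i : ℂ) * z i) *
    ∏ i, ∏ j ∈ Finset.Ioi i, Complex.exp (-((k i : ℂ) * (k j : ℂ) / (2 * b ^ 2)) * lz i j)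

/-- `ρ(w) = ∏_{p<q} (w_p - w_q)^{-2/b²}`. -/
def rho {m : ℕ} (b : ℂ) (lw : Fin m → Fin m → ℂ) : ℂ :=
  ∏ p, ∏ q ∈ Finset.Ioi p, Complex.exp (-(2 / b ^ 2) * lw p q)

/-- `φ_1(z,w) = exp(Λ w / b²) ∏_j (w - z_j)^{k_j/b²}` for a single variable `w`. -/
def phiOne {N : ℕ} (b : ℂ) (lam : ℝ) (k : Fin N → ℤ) (w : ℂ) (lwz : Fin N → ℂ) : ℂ :=
  Complex.exp ((lam : ℂ) * w / b ^ 2) * ∏ j, Complex.exp ((k j : ℂ) / b ^ 2 * lwz j)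

/-- `A(z,w) = exp(Λ/b² ∑ w_p) ∏_{p<q} (w_p - w_q)^{-2/b²} ∏_{p,j} (w_p - z_j)^{k_j/b²}`. -/
def masterA {N m : ℕ} (b : ℂ) (lam : ℝ) (k : Fin N → ℤ) (w : Fin m → ℂ)
    (lwz : Fin m → Fin N → ℂ) (lw : Fin m → Fin m → ℂ) : ℂ :=
  Complex.exp ((lam : ℂ) / b ^ 2 * ∑ p, w p) *
    (∏ p, ∏ q ∈ Finset.Ioi p, Complex.exp (-(2 / b ^ 2) * lw p q)) *
    ∏ p, ∏ j, Complex.exp ((k j : ℂ) / b ^ 2 * lwz p j)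

/-- The operator `F(z,w) = φ_1(z,w) ∑_i Y_i / (w - z_i)`. -/
def opF {N : ℕ} (b : ℂ) (lam : ℝ) (k : Fin N → ℤ) (z : Fin N → ℂ) (w : ℂ)
    (lwz : Fin N → ℂ) : Module.End ℂ (TensorSpace N) :=
  phiOne b lam k w lwz • ∑ i, (w - z i)⁻¹ • opY i

/-- The sum of `∏_p 1/(w_p - z_{a(p)})` over all maps `a` from the screening variables to the
points which take the value `j` exactly `μ_j` times. -/
def poleSum {N m : ℕ} (μ : Fin N → ℕ) (z : Fin N → ℂ) (w : Fin m → ℂ) : ℂ :=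
  ∑ a ∈ (Finset.univ : Finset (Fin m → Fin N)).filter
      (fun a => ∀ j, (Finset.univ.filter (fun p => a p = j)).card = μ j),
    ∏ p, (w p - z (a p))⁻¹

/-! ### Integration cycles -/

/-- The closed unit cube `[0,1]^m`. -/
def cube (m : ℕ) : Set (Fin m → ℝ) := Set.Icc 0 1

/-- A singular `m`-cube in the space of the screening variables, depending on `z`, together with
branches along it of all logarithms that occur in `A(z,w)`. -/
structure BranchedCube (N m : ℕ) where
  w : (Fin N → ℂ) → (Fin m → ℝ) → Fin m → ℂ
  logWZ : (Fin N → ℂ) → (Fin m → ℝ) → Fin m → Fin N → ℂ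
  logW : (Fin N → ℂ) → (Fin m → ℝ) → Fin m → Fin m → ℂ

namespace BranchedCube

variable {N m : ℕ}

/-- The cube lies in `{w | w_p ≠ z_j, w_p ≠ w_q}` for `z ∈ U` and is twice continuously
differentiable (over `ℝ`) in the cube coordinates and `z` jointly, and so are the branches of the
logarithms. -/
structure IsOn (σ : BranchedCube N m) (U : Set (Fin N → ℂ)) : Prop where
  smooth_w : ∀ z ∈ U, ∀ t ∈ cube m, ∀ p,
    ContDiffAt ℝ 2 (fun x : (Fin N → ℂ) × (Fin m → ℝ) => σ.w x.1 x.2 p) (z, t)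
  smooth_logWZ : ∀ z ∈ U, ∀ t ∈ cube m, ∀ p j,
    ContDiffAt ℝ 2 (fun x : (Fin N → ℂ) × (Fin m → ℝ) => σ.logWZ x.1 x.2 p j) (z, t)
  smooth_logW : ∀ z ∈ U, ∀ t ∈ cube m, ∀ p q, p < q →
    ContDiffAt ℝ 2 (fun x : (Fin N → ℂ) × (Fin m → ℝ) => σ.logW x.1 x.2 p q) (z, t)
  exp_logWZ : ∀ z ∈ U, ∀ t ∈ cube m, ∀ p j,
    Complex.exp (σ.logWZ z t p j) = σ.w z t p - z j
  exp_logW : ∀ z ∈ U, ∀ t ∈ cube m, ∀ p q, p < q →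
    Complex.exp (σ.logW z t p q) = σ.w z t p - σ.w z t q

/-- The branch of `A(z,w)` along the cube. -/
def A (σ : BranchedCube N m) (b : ℂ) (lam : ℝ) (k : Fin N → ℤ) (z : Fin N → ℂ)
    (t : Fin m → ℝ) : ℂ :=
  masterA b lam k (σ.w z t) (σ.logWZ z t) (σ.logW z t)

/-- The Jacobian determinant `det (∂ w_p / ∂ t_s)`, so that `dw_1 ∧ ... ∧ dw_m` pulls back to
`jacobian dt_1 ∧ ... ∧ dt_m`. -/
def jacobian (σ : BranchedCube N m) (z : Fin N → ℂ) (t : Fin m → ℝ) : ℂ :=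
  Matrix.det (Matrix.of fun p s : Fin m =>
    fderiv ℝ (fun t' : Fin m → ℝ => σ.w z t' p) t (Pi.single s 1))

/-- The size of the first two derivatives of a function. -/
def jetNorm (f : (Fin N → ℂ) × (Fin m → ℝ) → ℂ) (x : (Fin N → ℂ) × (Fin m → ℝ)) : ℝ :=
  ‖iteratedFDeriv ℝ 1 f x‖ + ‖iteratedFDeriv ℝ 2 f x‖

/-- `1` plus the sizes of the first two derivatives of all `w_p`, `log (w_p - z_j)` and
`log (w_p - w_q)`, `p < q`, along the cube. -/
def size (σ : BranchedCube N m) (z : Fin N → ℂ) (t : Fin m → ℝ) : ℝ :=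
  1 + (∑ p, jetNorm (fun x => σ.w x.1 x.2 p) (z, t)) +
    (∑ p, ∑ j, jetNorm (fun x => σ.logWZ x.1 x.2 p j) (z, t)) +
    ∑ p, ∑ q ∈ Finset.Ioi p, jetNorm (fun x => σ.logW x.1 x.2 p q) (z, t)

end BranchedCube

section Faces

variable {N m : ℕ} {ι : Type*}

/-- The inclusion of the face `t_s = 0` or `t_s = 1` of `[0,1]^(m+1)`. -/
def facePoint (s : Fin (m + 1)) (e : Bool) (u : Fin m → ℝ) : Fin (m + 1) → ℝ :=
  s.insertNth (α := fun _ => ℝ) (if e then 1 else 0) u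

/-- The face of the `x.1`-th cube indexed by `x.2`. -/
def face (σ : ι → BranchedCube N (m + 1)) (x : ι × Fin (m + 1) × Bool)
    (z : Fin N → ℂ) (u : Fin m → ℝ) : Fin (m + 1) → ℂ :=
  (σ x.1).w z (facePoint x.2.1 x.2.2 u)

/-- Two faces are the same singular `m`-cube (for all `z ∈ U`). -/
def SameFace (σ : ι → BranchedCube N (m + 1)) (U : Set (Fin N → ℂ))
    (x y : ι × Fin (m + 1) × Bool) : Prop :=
  ∀ z ∈ U, ∀ u ∈ cube m, face σ y z u = face σ x z u

/-- A face is degenerate if it does not depend on one of its coordinates. -/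
def DegenerateFace (σ : ι → BranchedCube N (m + 1)) (U : Set (Fin N → ℂ))
    (x : ι × Fin (m + 1) × Bool) : Prop :=
  ∃ r : Fin m, ∀ z ∈ U, ∀ u ∈ cube m, ∀ u' ∈ cube m,
    (∀ s, s ≠ r → u s = u' s) → face σ x z u = face σ x z u'

end Faces

/-- The twisted chain `∑ₙ c_n σ_n` has boundary zero modulo degenerate cubes: for every
non-degenerate singular cube which occurs as a face, the branches of `A` along it, summed with the
coefficients and the incidence signs over all its occurrences, cancel. -/
def BoundaryVanishes {N : ℕ} {ι : Type*} (b : ℂ) (lam : ℝ) (k : Fin N → ℤ)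
    (U : Set (Fin N → ℂ)) :
    (m : ℕ) → (c : ι → ℂ) → (σ : ι → BranchedCube N m) → Prop
  | 0, _, _ => True
  | m + 1, c, σ =>
    ∀ x : ι × Fin (m + 1) × Bool, ¬ DegenerateFace σ U x →
      ∀ z ∈ U, ∀ u ∈ cube m,
        HasSum (fun y : {y : ι × Fin (m + 1) × Bool // SameFace σ U x y} =>
          (-1 : ℂ) ^ ((y.1.2.1 : ℕ) + (if y.1.2.2 then 1 else 0)) * c y.1.1 *
            (σ y.1.1).A b lam k z (facePoint y.1.2.1 y.1.2.2 u)) 0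

/-- `Γ = ∑ₙ c_n σ_n` is a (finite or infinite) twisted cycle of rapid decay for `A(z,w)`,
depending differentiably on `z ∈ U`. -/
structure IsRapidDecayCycle {N m : ℕ} {ι : Type*} (b : ℂ) (lam : ℝ) (k : Fin N → ℤ)
    (U : Set (Fin N → ℂ)) (c : ι → ℂ) (σ : ι → BranchedCube N m) : Prop where
  isOn : ∀ n, (σ n).IsOn U
  boundary : BoundaryVanishes b lam k U m c σ
  decay : ∀ K : ℕ, ∀ z₀ ∈ U, ∃ W ∈ 𝓝 z₀, ∃ B : ι → ℝ, Summable B ∧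
    ∀ n, ∀ z ∈ W ∩ U, ∀ t ∈ cube m,
      ‖c n * (σ n).A b lam k z t‖ * (σ n).size z t ^ K ≤ B n

/-- `∫_Γ f dw_1 ... dw_m` for `Γ = ∑ₙ c_n σ_n`, where `f n` is the integrand along the `n`-th
cube. -/
def cycleIntegral {N m : ℕ} {ι : Type*} (c : ι → ℂ) (σ : ι → BranchedCube N m)
    (z : Fin N → ℂ) (f : ι → (Fin m → ℝ) → ℂ) : ℂ :=
  ∑' n, c n * ∫ t in cube m, f n t * (σ n).jacobian z t

/-- Absolute convergence of `∫_Γ f dw_1 ... dw_m`. -/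
def CycleIntegrable {N m : ℕ} {ι : Type*} (c : ι → ℂ) (σ : ι → BranchedCube N m)
    (z : Fin N → ℂ) (f : ι → (Fin m → ℝ) → ℂ) : Prop :=
  (∀ n, MeasureTheory.IntegrableOn (fun t => c n * (f n t * (σ n).jacobian z t)) (cube m)) ∧
    Summable fun n => ∫ t in cube m, ‖c n * (f n t * (σ n).jacobian z t)‖

/-! ### The conformal blocks -/

/-- The integrand of `φ^{(μ)}` along the `n`-th cube. -/
def phiIntegrand {N m : ℕ} {ι : Type*} (b : ℂ) (lam : ℝ) (k : Fin N → ℤ)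
    (σ : ι → BranchedCube N m) (μ : Fin N → ℕ) (z : Fin N → ℂ) (n : ι) (t : Fin m → ℝ) : ℂ :=
  (σ n).A b lam k z t * poleSum μ z ((σ n).w z t)

/-- The column vector of all `φ^{(μ)} = ∫_Γ A(z,w) ∑_a ∏_p 1/(w_p - z_{a(p)}) d^m w`. -/
def psiHat {N m : ℕ} {ι : Type*} (b : ℂ) (lam : ℝ) (k : Fin N → ℤ)
    (c : ι → ℂ) (σ : ι → BranchedCube N m) (z : Fin N → ℂ) (μ : HeightIndex N m) : ℂ :=
  cycleIntegral c σ z (phiIntegrand b lam k σ μ.1 z)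

/-- `ρ(w) F(z,w_1) F(z,w_2) ... F(z,w_m) v` along the `n`-th cube. -/
def vectorIntegrand {N m : ℕ} {ι : Type*} (b : ℂ) (lam : ℝ) (k : Fin N → ℤ)
    (σ : ι → BranchedCube N m) (z : Fin N → ℂ) (n : ι) (t : Fin m → ℝ) : TensorSpace N :=
  rho b ((σ n).logW z t) •
    (List.ofFn fun p : Fin m =>
      opF b lam k z ((σ n).w z t p) ((σ n).logWZ z t p)).prod (hwVector N)

/-- `Ψ = φ_0(z) ∫_Γ ρ(w) F(z,w_1) ... F(z,w_m) v d^m w`, the vector-valued integral being taken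
coefficientwise in the basis `tensorBasis N`. -/
def blockVector {N m : ℕ} {ι : Type*} (b : ℂ) (lam : ℝ) (k : Fin N → ℤ)
    (lz : (Fin N → ℂ) → Fin N → Fin N → ℂ)
    (c : ι → ℂ) (σ : ι → BranchedCube N m) (z : Fin N → ℂ) : TensorSpace N :=
  phiZero b lam k z (lz z) •
    ∑ᶠ ν : Fin N → ℕ,
      cycleIntegral c σ z
        (fun n t => (tensorBasis N).repr (vectorIntegrand b lam k σ z n t) ν) • tensorBasis N ν

end

end IrregularKZ

open IrregularKZ

namespace IrregularKZ

/-! ### The action of `sl(2)` on the basis vectors -/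

/-! Write `A = e^E` along a branched cube and, for a map `a` attaching each variable `w_p` to a
point `z_{a(p)}`, put `L_p = log (w_p - z_{a(p)})`. On a fibre `z = const` the product of the `dw_p
/ (w_p - z_{a(p)})` is `dL_1 ∧ ... ∧ dL_m`, so the integrand belonging to `a` is the restriction of
`ω = e^E dL_1 ∧ ... ∧ dL_m`, a form in `z` and the cube coordinates jointly. Cartan's formula `L_v =
d ι_v + ι_v d` in the direction `v` of `z_i` (`sum_fderiv_flux`) writes the `z_i`-derivative of the
density as a divergence plus the contribution of `dω = dE ∧ ω`. Because `dw_p = (w_p - z_{a(p)})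
dL_p + dz_{a(p)}`, the form `dE` is a combination of the `dL_p`, which wedge to zero, and of the
`dz_j`. By Cramer's rule (`cramer_bordered`) what remains is `dlogZ` times the density: `A` is
differentiated while `z_i` moves together with the variables attached to it, and no double poles
appear.

The divergences integrate to zero over the cycle (`IsRapidDecayCycle.hasSum_divergence`). On a face
the contracted form depends only on the branch of `A` and on the face as a singular cube, so the
faces can be summed class by class, and the cycle condition or degeneracy kills every class.

The rest is algebra (`sum_dlogZ_mul_pole`). Partial fractions turn each extra factor `1/(w_p - z_j)`
or `1/(w_p - w_q)` into differences of pole products in which variables have been moved between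
`z_i` and `z_j`. Counting such moves among the maps with prescribed multiplicities gives the entries
of the transpose of `Ω̂_ij`, the quadratic terms coming from pairs of variables.

Rapid decay with exponent `m + 1` justifies differentiating under the sum and the integral. The
cubes are only real differentiable, but the real derivative obtained is multiplication by a complex
number, hence a complex derivative. The factor `φ_0` supplies the scalars `k_i k_j / 2` and `Λ k_i /
2`. Finally, expanding the product of the `F(z, w_p)` shows that the blocks are the coefficients of
`Ψ`, and transposition passes from coefficients to operators. -/

theorem vermaY_single (l : ℕ) (c : ℂ) :
    vermaY (Finsupp.single l c) = Finsupp.single (l + 1) c := by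
  simp [vermaY]

theorem vermaH_single (k : ℂ) (l : ℕ) :
    vermaH k (Finsupp.single l 1) = (k - 2 * (l : ℂ)) • Finsupp.single l 1 := by
  simp [vermaH]

theorem vermaX_single (k : ℂ) (l : ℕ) :
    vermaX k (Finsupp.single l 1) = ((l : ℂ) * (k - (l : ℂ) + 1)) • Finsupp.single (l - 1) 1 := by
  simp [vermaX]

theorem tensorBasis_apply {N : ℕ} (ν : Fin N → ℕ) :
    tensorBasis N ν = PiTensorProduct.tprod ℂ (fun i => (Finsupp.single (ν i) 1 : Verma)) := by
  simp [tensorBasis, Basis.piTensorProduct_apply]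

theorem site_tprod {N : ℕ} (i : Fin N) (f : Verma →ₗ[ℂ] Verma) (x : Fin N → Verma) :
    site i f (PiTensorProduct.tprod ℂ x) =
      PiTensorProduct.tprod ℂ (Function.update x i (f (x i))) := by
  rw [site, PiTensorProduct.map_tprod]
  congr 1
  ext1 j
  by_cases h : j = i
  · subst h; simp
  · simp [h]

theorem site_tensorBasis {N : ℕ} (i : Fin N) (f : Verma →ₗ[ℂ] Verma) (ν : Fin N → ℕ) (l : ℕ)
    (e : ℂ) (hf : f (Finsupp.single (ν i) 1) = e • Finsupp.single l 1) :
    site i f (tensorBasis N ν) = e • tensorBasis N (Function.update ν i l) := by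
  rw [tensorBasis_apply, site_tprod, hf, MultilinearMap.map_update_smul, tensorBasis_apply]
  congr 2
  ext1 j
  by_cases h : j = i
  · subst h; simp
  · simp [h]

theorem opY_tensorBasis {N : ℕ} (i : Fin N) (ν : Fin N → ℕ) :
    opY i (tensorBasis N ν) = tensorBasis N (Function.update ν i (ν i + 1)) := by
  rw [opY]
  simpa using site_tensorBasis i vermaY ν (ν i + 1) 1 (by simp [vermaY_single])

theorem opH_tensorBasis {N : ℕ} (k : Fin N → ℤ) (i : Fin N) (ν : Fin N → ℕ) :
    opH k i (tensorBasis N ν) = ((k i : ℂ) - 2 * (ν i : ℂ)) • tensorBasis N ν := by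
  rw [opH]
  simpa using site_tensorBasis i (vermaH (k i)) ν (ν i) _ (vermaH_single _ _)

theorem opX_tensorBasis {N : ℕ} (k : Fin N → ℤ) (i : Fin N) (ν : Fin N → ℕ) :
    opX k i (tensorBasis N ν) =
      ((ν i : ℂ) * ((k i : ℂ) - (ν i : ℂ) + 1)) • tensorBasis N (Function.update ν i (ν i - 1)) :=
  site_tensorBasis i (vermaX (k i)) ν (ν i - 1) _ (vermaX_single _ _)

theorem opY_pow_tensorBasis {N : ℕ} (i : Fin N) (n : ℕ) (ν : Fin N → ℕ) :
    (opY i ^ n) (tensorBasis N ν) = tensorBasis N (Function.update ν i (ν i + n)) := by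
  induction n with
  | zero => simp
  | succ n ih =>
    rw [pow_succ', Module.End.mul_apply, ih, opY_tensorBasis]
    simp [add_assoc]

theorem hwVector_eq (N : ℕ) : hwVector N = tensorBasis N 0 := by
  simp [hwVector, tensorBasis_apply]

theorem descendant_eq {N : ℕ} (μ : Fin N → ℕ) : descendant μ = tensorBasis N μ := by
  -- In a list without repetitions each power of `Y_a` meets a vector whose `a`-th entry is still
  -- zero, so it writes `μ a` there.
  have key : ∀ l : List (Fin N), l.Nodup →
      (l.map fun i => opY i ^ μ i).prod (hwVector N) =
        tensorBasis N (fun i => if i ∈ l then μ i else 0) := by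
    intro l
    induction l with
    | nil => intro _; simp [hwVector_eq]; rfl
    | cons a l ih =>
      intro h
      rw [List.nodup_cons] at h
      rw [List.map_cons, List.prod_cons, Module.End.mul_apply, ih h.2, opY_pow_tensorBasis]
      congr 1
      ext j
      by_cases hj : j = a
      · subst hj; simp [h.1]
      · simp [hj]
  have := key (List.finRange N) (List.nodup_finRange N)
  rw [descendant, List.ofFn_eq_map, this]
  simp

/-- The multi-index with one unit moved from place `i` to place `j`. -/
def shift {N : ℕ} (i j : Fin N) (μ : Fin N → ℕ) : Fin N → ℕ :=
  Function.update (Function.update μ i (μ i - 1)) j (μ j + 1)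

theorem Omega_tensorBasis {N : ℕ} (k : Fin N → ℤ) {i j : Fin N} (hij : i ≠ j) (μ : Fin N → ℕ) :
    Omega k i j (tensorBasis N μ) =
      (((k i : ℂ) - 2 * (μ i : ℂ)) * ((k j : ℂ) - 2 * (μ j : ℂ)) / 2) • tensorBasis N μ +
      ((μ i : ℂ) * ((k i : ℂ) - (μ i : ℂ) + 1)) • tensorBasis N (shift i j μ) +
      ((μ j : ℂ) * ((k j : ℂ) - (μ j : ℂ) + 1)) • tensorBasis N (shift j i μ) := by
  simp only [Omega, LinearMap.add_apply, LinearMap.smul_apply, Module.End.mul_apply,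
    opY_tensorBasis, opX_tensorBasis, opH_tensorBasis, map_smul, smul_smul, shift,
    Function.update_of_ne hij]
  rw [Function.update_comm hij]
  congr 3
  ring

/-- With `μ i = 0` the truncated subtraction would remove nothing and the height would grow by one.
That case is harmless: the coefficient of the shifted vector carries the factor `μ i`. -/
theorem sum_shift {N : ℕ} {i j : Fin N} (hij : i ≠ j) (μ : Fin N → ℕ) (h : μ i ≠ 0) :
    ∑ l, shift i j μ l = ∑ l, μ l := by
  have hi : i ∈ Finset.univ.erase j := by simp [hij]
  rw [← Finset.add_sum_erase _ _ (Finset.mem_univ j), ← Finset.add_sum_erase _ _ hi,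
    ← Finset.add_sum_erase _ μ (Finset.mem_univ j), ← Finset.add_sum_erase _ μ hi]
  have : ∑ x ∈ (Finset.univ.erase j).erase i, shift i j μ x =
      ∑ x ∈ (Finset.univ.erase j).erase i, μ x := by
    refine Finset.sum_congr rfl fun x hx => ?_
    simp only [Finset.mem_erase] at hx
    simp [shift, hx.1, hx.2.1]
  rw [this]
  simp only [shift, Function.update_self, Function.update_of_ne hij]
  omega

theorem mem_height {N m : ℕ} (μ : Fin N → ℕ) :
    μ ∈ Finset.piAntidiag (Finset.univ : Finset (Fin N)) m ↔ ∑ l, μ l = m := by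
  simp [Finset.mem_piAntidiag]

theorem tensorBasis_repr {N : ℕ} (μ ν : Fin N → ℕ) :
    (tensorBasis N).repr (tensorBasis N μ) ν = if μ = ν then 1 else 0 := by
  rw [Module.Basis.repr_self, Finsupp.single_apply]

/-- Entries of `Ω_ij`. -/
theorem OmegaMatrix_apply {N m : ℕ} (k : Fin N → ℤ) {i j : Fin N} (hij : i ≠ j)
    (μ ν : HeightIndex N m) :
    OmegaMatrix m k i j μ ν =
      ((k i : ℂ) - 2 * (μ.1 i : ℂ)) * ((k j : ℂ) - 2 * (μ.1 j : ℂ)) / 2 *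
        (if μ.1 = ν.1 then 1 else 0) +
      (μ.1 i : ℂ) * ((k i : ℂ) - (μ.1 i : ℂ) + 1) * (if shift i j μ.1 = ν.1 then 1 else 0) +
      (μ.1 j : ℂ) * ((k j : ℂ) - (μ.1 j : ℂ) + 1) * (if shift j i μ.1 = ν.1 then 1 else 0) := by
  simp only [OmegaMatrix, Matrix.of_apply, Omega_tensorBasis k hij, map_add, map_smul,
    Finsupp.add_apply, Finsupp.smul_apply, tensorBasis_repr, smul_eq_mul]

theorem OmegaHat_apply {N m : ℕ} (k : Fin N → ℤ) {i j : Fin N} (hij : i ≠ j)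
    (μ ν : HeightIndex N m) :
    OmegaHat m k i j μ ν =
      (2 * (μ.1 i : ℂ) * (μ.1 j : ℂ) - (k i : ℂ) * (μ.1 j : ℂ) - (k j : ℂ) * (μ.1 i : ℂ)) *
        (if μ.1 = ν.1 then 1 else 0) +
      (μ.1 i : ℂ) * ((k i : ℂ) - (μ.1 i : ℂ) + 1) * (if shift i j μ.1 = ν.1 then 1 else 0) +
      (μ.1 j : ℂ) * ((k j : ℂ) - (μ.1 j : ℂ) + 1) * (if shift j i μ.1 = ν.1 then 1 else 0) := by
  rw [OmegaHat, Matrix.sub_apply, OmegaMatrix_apply k hij, Matrix.smul_apply, Matrix.one_apply]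
  have : (μ = ν) ↔ (μ.1 = ν.1) := Subtype.ext_iff
  simp only [this, smul_eq_mul]
  split_ifs <;> ring

/-- The height `m` subspace is invariant under `Ω_ij`. -/
theorem Omega_tensorBasis_eq_sum {N m : ℕ} (k : Fin N → ℤ) {i j : Fin N} (hij : i ≠ j)
    (μ : HeightIndex N m) :
    Omega k i j (tensorBasis N μ.1) =
      ∑ ν : HeightIndex N m, OmegaMatrix m k i j μ ν • tensorBasis N ν.1 := by
  -- The multi-index `κ` may leave height `m`, but only with coefficient zero.
  have pick : ∀ (κ : Fin N → ℕ) (e : ℂ), (e ≠ 0 → ∑ l, κ l = m) →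
      ∑ ν : HeightIndex N m, (e * (if κ = ν.1 then 1 else 0)) • tensorBasis N ν.1 =
        e • tensorBasis N κ := by
    intro κ e h
    by_cases he : e = 0
    · simp [he]
    · rw [Finset.sum_eq_single ⟨κ, (mem_height κ).2 (h he)⟩]
      · simp
      · intro ν _ hν
        have : κ ≠ ν.1 := fun h' => hν (Subtype.ext h'.symm)
        simp [this]
      · simp
  have hμ := (mem_height μ.1).1 μ.2
  simp only [OmegaMatrix_apply k hij, add_smul, Finset.sum_add_distrib]
  rw [pick _ _ fun _ => hμ, pick, pick, Omega_tensorBasis k hij]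
  · intro h
    rw [sum_shift hij.symm _ (by rintro h0; simp [h0] at h), hμ]
  · intro h
    rw [sum_shift hij _ (by rintro h0; simp [h0] at h), hμ]

/-- The operator equation, applied to a combination of the basis vectors of height `m`. -/
theorem kzOperator_sum {N m : ℕ} (lam : ℝ) (k : Fin N → ℤ) (i : Fin N) (z : Fin N → ℂ)
    (f : HeightIndex N m → ℂ) :
    (((lam : ℂ) / 2) • opH k i + ∑ j ∈ Finset.univ.erase i, (z i - z j)⁻¹ • Omega k i j)
        (∑ μ : HeightIndex N m, f μ • tensorBasis N μ.1) =
      ∑ μ : HeightIndex N m, (((lam : ℂ) / 2) • (HMatrix m k i).mulVec f +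
        ∑ j ∈ Finset.univ.erase i, (z i - z j)⁻¹ • (OmegaMatrix m k i j).transpose.mulVec f) μ •
          tensorBasis N μ.1 := by
  simp only [LinearMap.add_apply, LinearMap.smul_apply, LinearMap.sum_apply, Pi.add_apply,
    Pi.smul_apply, Finset.sum_apply, add_smul, Finset.sum_add_distrib, Finset.sum_smul]
  congr 1
  · rw [map_sum, Finset.smul_sum]
    refine Finset.sum_congr rfl fun μ _ => ?_
    rw [map_smul, opH_tensorBasis, HMatrix, Matrix.mulVec_diagonal, smul_smul, smul_smul,
      smul_eq_mul]
    congr 1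
    ring
  · rw [Finset.sum_comm]
    refine Finset.sum_congr rfl fun j hj => ?_
    have hij : i ≠ j := (Finset.ne_of_mem_erase hj).symm
    rw [map_sum]
    simp only [map_smul, Omega_tensorBasis_eq_sum k hij, Finset.smul_sum, smul_smul]
    -- A row of `OmegaMatrix` holds the image of a basis vector, so collecting the coefficient of a
    -- fixed `ν` sums over rows and produces the transpose.
    rw [Finset.sum_comm]
    refine Finset.sum_congr rfl fun ν _ => ?_
    rw [← Finset.sum_smul]
    congr 1
    simp only [Matrix.mulVec, dotProduct, Matrix.transpose_apply, smul_eq_mul, Finset.mul_sum]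
    refine Finset.sum_congr rfl fun μ _ => ?_
    ring

theorem coord_sum_tensorBasis {N m : ℕ} (f : HeightIndex N m → ℂ) (ν : HeightIndex N m) :
    (tensorBasis N).coord ν.1 (∑ μ : HeightIndex N m, f μ • tensorBasis N μ.1) = f ν := by
  simp only [map_sum, map_smul, smul_eq_mul, Module.Basis.coord_apply, tensorBasis_repr]
  rw [Finset.sum_eq_single ν]
  · simp
  · intro μ _ hμ
    have : μ.1 ≠ ν.1 := fun h' => hμ (Subtype.ext h')
    simp [this]
  · simp

/-- The height `m` subspace is invariant under the operators, so the equations match coordinate by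
coordinate. Conversely, the coordinate functionals are among those against which `HasPartialAt`
tests, and they return the derivatives of the coefficients. -/
theorem solvesCoeffKZ_iff {N m : ℕ} (b : ℂ) (lam : ℝ) (k : Fin N → ℤ)
    (f : (Fin N → ℂ) → HeightIndex N m → ℂ) (z : Fin N → ℂ) (i : Fin N) :
    SolvesCoeffKZ b lam k i f z ↔
      SolvesKZ b lam k i (fun y => ∑ μ : HeightIndex N m, f y μ • descendant μ.1) z := by
  simp only [descendant_eq]
  constructor
  · rintro ⟨D, hD, hE⟩
    refine ⟨∑ μ : HeightIndex N m, D μ • tensorBasis N μ.1, fun l => ?_, ?_⟩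
    · simp only [map_sum, map_smul, smul_eq_mul]
      exact HasDerivAt.fun_sum fun μ _ => (hasDerivAt_pi.1 hD μ).mul_const _
    · rw [kzOperator_sum, ← hE, Finset.smul_sum]
      simp only [Pi.smul_apply, smul_smul, smul_eq_mul]
  · rintro ⟨D, hD, hE⟩
    refine ⟨fun μ => (tensorBasis N).coord μ.1 D, ?_, ?_⟩
    · refine hasDerivAt_pi.2 fun μ => ?_
      have := hD ((tensorBasis N).coord μ.1)
      exact this.congr_of_eventuallyEq
        (Filter.Eventually.of_forall fun ζ => (coord_sum_tensorBasis (f _) μ).symm)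
    · rw [kzOperator_sum] at hE
      ext μ
      have := congrArg ((tensorBasis N).coord μ.1) hE
      rwa [coord_sum_tensorBasis, map_smul] at this

/-! ### Expansion of the operator-valued integrand -/

/-- The number of times a map takes each of its values. -/
def count {N m : ℕ} (a : Fin m → Fin N) (j : Fin N) : ℕ :=
  (Finset.univ.filter (fun p => a p = j)).card

/-- `∏_p 1/(w_p - z_{a(p)})`. -/
noncomputable def pole {N m : ℕ} (z : Fin N → ℂ) (w : Fin m → ℂ) (a : Fin m → Fin N) : ℂ :=
  ∏ p, (w p - z (a p))⁻¹

theorem count_eq_sum {N m : ℕ} (a : Fin m → Fin N) (j : Fin N) :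
    count a j = ∑ p, if a p = j then 1 else 0 := by
  rw [count, Finset.card_filter]

theorem sum_count {N m : ℕ} (a : Fin m → Fin N) : ∑ j, count a j = m := by
  simp only [count_eq_sum]
  rw [Finset.sum_comm]
  simp

theorem count_cons {N m : ℕ} (i : Fin N) (a : Fin m → Fin N) :
    count (Fin.cons i a : Fin (m + 1) → Fin N) =
      Function.update (count a) i (count a i + 1) := by
  ext j
  rw [count_eq_sum, Fin.sum_univ_succ]
  by_cases h : j = i
  · subst h
    simp [count_eq_sum, add_comm]
  · simp [count_eq_sum, h, Ne.symm h]

theorem poleSum_eq {N m : ℕ} (μ : Fin N → ℕ) (z : Fin N → ℂ) (w : Fin m → ℂ) :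
    poleSum μ z w = ∑ a : Fin m → Fin N, if count a = μ then pole z w a else 0 := by
  rw [poleSum, Finset.sum_filter]
  refine Finset.sum_congr rfl fun a _ => ?_
  simp only [funext_iff, count, pole]

/-- Multiplying out means choosing a site `a p` for every factor. Each `Y` only raises one entry of
a multi-index, so the resulting vector remembers nothing of `a` but its multiplicities. -/
theorem prod_ofFn_opF {N : ℕ} (z : Fin N → ℂ) : ∀ {m : ℕ} (w φ : Fin m → ℂ),
    (List.ofFn fun p : Fin m =>
        (φ p • ∑ i, (w p - z i)⁻¹ • opY i : Module.End ℂ (TensorSpace N))).prod (hwVector N) =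
      (∏ p, φ p) • ∑ a : Fin m → Fin N, pole z w a • tensorBasis N (count a)
  | 0, w, φ => by
    have : count (default : Fin 0 → Fin N) = 0 := by ext j; simp [count]
    simp [pole, hwVector_eq, this]
  | m + 1, w, φ => by
    rw [List.ofFn_succ, List.prod_cons, Module.End.mul_apply, prod_ofFn_opF z,
      ← (Fin.consEquiv fun _ => Fin N).sum_comp, Fintype.sum_prod_type, Fin.prod_univ_succ]
    simp only [LinearMap.smul_apply, map_smul, LinearMap.sum_apply, map_sum, opY_tensorBasis,
      mul_smul]
    rw [smul_comm (φ 0)]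
    congr 1
    simp only [Finset.smul_sum]
    rw [Finset.sum_comm]
    refine Finset.sum_congr rfl fun i _ => Finset.sum_congr rfl fun a _ => ?_
    simp only [Fin.consEquiv_apply, pole, Fin.prod_univ_succ, Fin.cons_zero,
      Fin.cons_succ, smul_smul]
    congr 1
    · ring
    · exact congrArg _ (count_cons i a).symm

theorem masterA_eq {N m : ℕ} (b : ℂ) (lam : ℝ) (k : Fin N → ℤ) (w : Fin m → ℂ)
    (lwz : Fin m → Fin N → ℂ) (lw : Fin m → Fin m → ℂ) :
    masterA b lam k w lwz lw = rho b lw * ∏ p, phiOne b lam k (w p) (lwz p) := by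
  have h : ∏ p, Complex.exp ((lam : ℂ) * w p / b ^ 2) =
      Complex.exp ((lam : ℂ) / b ^ 2 * ∑ p, w p) := by
    rw [← Complex.exp_sum, Finset.mul_sum]
    congr 1
    exact Finset.sum_congr rfl fun p _ => by ring
  simp only [masterA, rho, phiOne, Finset.prod_mul_distrib, h]
  ring

theorem vectorIntegrand_eq {N m : ℕ} {ι : Type*} (b : ℂ) (lam : ℝ) (k : Fin N → ℤ)
    (σ : ι → BranchedCube N m) (z : Fin N → ℂ) (n : ι) (t : Fin m → ℝ) :
    vectorIntegrand b lam k σ z n t = (σ n).A b lam k z t •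
      ∑ a : Fin m → Fin N, pole z ((σ n).w z t) a • tensorBasis N (count a) := by
  rw [vectorIntegrand, BranchedCube.A, masterA_eq, mul_smul, ← prod_ofFn_opF]
  simp only [opF]

theorem repr_vectorIntegrand {N m : ℕ} {ι : Type*} (b : ℂ) (lam : ℝ) (k : Fin N → ℤ)
    (σ : ι → BranchedCube N m) (z : Fin N → ℂ) (n : ι) (t : Fin m → ℝ) (ν : Fin N → ℕ) :
    (tensorBasis N).repr (vectorIntegrand b lam k σ z n t) ν = phiIntegrand b lam k σ ν z n t := by
  rw [vectorIntegrand_eq, phiIntegrand, poleSum_eq]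
  simp only [map_smul, map_sum, Finsupp.smul_apply, Finsupp.finsetSum_apply, tensorBasis_repr,
    smul_eq_mul, mul_ite, mul_one, mul_zero]

theorem phiIntegrand_eq_zero {N m : ℕ} {ι : Type*} (b : ℂ) (lam : ℝ) (k : Fin N → ℤ)
    (σ : ι → BranchedCube N m) (z : Fin N → ℂ) (n : ι) (t : Fin m → ℝ) (ν : Fin N → ℕ)
    (h : ν ∉ Finset.piAntidiag (Finset.univ : Finset (Fin N)) m) :
    phiIntegrand b lam k σ ν z n t = 0 := by
  rw [phiIntegrand, poleSum_eq, Finset.sum_eq_zero, mul_zero]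
  intro a _
  rw [if_neg]
  rintro rfl
  exact h ((mem_height _).2 (sum_count a))

theorem blockVector_eq {N m : ℕ} {ι : Type*} (b : ℂ) (lam : ℝ) (k : Fin N → ℤ)
    (lz : (Fin N → ℂ) → Fin N → Fin N → ℂ)
    (c : ι → ℂ) (σ : ι → BranchedCube N m) (z : Fin N → ℂ) :
    blockVector b lam k lz c σ z =
      ∑ μ : HeightIndex N m,
        (phiZero b lam k z (lz z) * psiHat b lam k c σ z μ) • descendant μ.1 := by
  simp only [blockVector, repr_vectorIntegrand, descendant_eq, mul_smul, ← Finset.smul_sum]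
  congr 1
  -- Outside height `m` no map has the required multiplicities, so the integrand vanishes
  -- identically and the formal sum is finite.
  rw [finsum_eq_sum_of_support_subset (s := Finset.piAntidiag Finset.univ m),
    ← Finset.sum_coe_sort]
  · rfl
  · intro ν hν
    by_contra h
    refine hν ?_
    simp only [cycleIntegral, phiIntegrand_eq_zero b lam k σ z _ _ ν h]
    simp

/-! ### Sums over the distributions of the screening variables -/

section Reindex

variable {N m : ℕ}

theorem count_cast (a : Fin m → Fin N) (j : Fin N) :
    (count a j : ℂ) = ∑ p, if a p = j then 1 else 0 := by
  rw [count_eq_sum]; push_cast; rfl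

/-- Moving the `p`-th variable between `i` and `j` is a bijection. The first argument of `F` is
always the map with `p` at `j`, the second the one with `p` at `i`, so that a pole product and a
multiplicity can be evaluated at different members of the pair. -/
theorem sum_reindex (p : Fin m) (i j : Fin N) (F : (Fin m → Fin N) → (Fin m → Fin N) → ℂ) :
    (∑ a : Fin m → Fin N, if a p = i then F (Function.update a p j) a else 0) =
      ∑ a : Fin m → Fin N, if a p = j then F a (Function.update a p i) else 0 := by
  rw [← Finset.sum_filter, ← Finset.sum_filter]
  refine Finset.sum_bij' (fun a _ => Function.update a p j) (fun a _ => Function.update a p i)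
    ?_ ?_ ?_ ?_ ?_
  · intro a _; simp
  · intro a _; simp
  · intro a ha
    simp only [Finset.mem_filter, Finset.mem_univ, true_and] at ha
    simp [← ha]
  · intro a ha
    simp only [Finset.mem_filter, Finset.mem_univ, true_and] at ha
    simp [← ha]
  · intro a ha
    simp only [Finset.mem_filter, Finset.mem_univ, true_and] at ha
    simp [← ha]

theorem count_update {a : Fin m → Fin N} {p : Fin m} {i j : Fin N} (hij : i ≠ j) (h : a p = i) :
    count (Function.update a p j) = shift i j (count a) := by
  ext l
  simp only [count_eq_sum, ← Finset.add_sum_erase _ _ (Finset.mem_univ p), Function.update_self]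
  have : ∀ l, ∑ x ∈ Finset.univ.erase p, (if Function.update a p j x = l then 1 else 0) =
      ∑ x ∈ Finset.univ.erase p, if a x = l then 1 else 0 := fun l =>
    Finset.sum_congr rfl fun x hx => by rw [Function.update_of_ne (Finset.ne_of_mem_erase hx)]
  rw [this, shift]
  by_cases hj : l = j
  · subst hj
    simp only [Function.update_self, count_eq_sum,
      ← Finset.add_sum_erase _ _ (Finset.mem_univ p), h, if_neg hij]
    simp [add_comm]
  · rw [Function.update_of_ne hj, if_neg (Ne.symm hj)]
    by_cases hi : l = i
    · subst hi
      simp only [Function.update_self, count_eq_sum,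
        ← Finset.add_sum_erase _ _ (Finset.mem_univ p), h]
      simp
    · rw [Function.update_of_ne hi, count_eq_sum,
        ← Finset.add_sum_erase _ _ (Finset.mem_univ p), h, if_neg (Ne.symm hi)]

theorem pole_split (z : Fin N → ℂ) (w : Fin m → ℂ) (a : Fin m → Fin N) (p : Fin m) :
    pole z w a = (w p - z (a p))⁻¹ * ∏ q ∈ Finset.univ.erase p, (w q - z (a q))⁻¹ := by
  rw [pole, Finset.mul_prod_erase _ (fun q => (w q - z (a q))⁻¹) (Finset.mem_univ p)]

theorem pole_update (z : Fin N → ℂ) (w : Fin m → ℂ) (a : Fin m → Fin N) (p : Fin m) (j : Fin N) :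
    pole z w (Function.update a p j) =
      (w p - z j)⁻¹ * ∏ q ∈ Finset.univ.erase p, (w q - z (a q))⁻¹ := by
  rw [pole_split z w _ p, Function.update_self]
  congr 1
  exact Finset.prod_congr rfl fun x hx => by
    rw [Function.update_of_ne (Finset.ne_of_mem_erase hx)]

variable {z : Fin N → ℂ} {w : Fin m → ℂ}

/-- Partial fractions in one screening variable. -/
theorem pole_mul_inv (hw : ∀ p j, w p ≠ z j) {a : Fin m → Fin N} {p : Fin m} {i j : Fin N}
    (h : a p = i) :
    (z i - z j) * ((w p - z j)⁻¹ * pole z w a) =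
      pole z w a - pole z w (Function.update a p j) := by
  rw [pole_update, pole_split z w a p, h]
  have h1 := sub_ne_zero.2 (hw p i)
  have h2 := sub_ne_zero.2 (hw p j)
  field_simp
  ring

/-- Subtracting the swapped product cancels the factor `w p - w q`. Both sides equal `-(z i - z
j)^2` divided by the four differences of `w p`, `w q` with `z i`, `z j`, times the untouched
factors. -/
theorem pole_mul_inv_sub (hw : ∀ p j, w p ≠ z j) {a : Fin m → Fin N} {p q : Fin m}
    (hpq : w p ≠ w q) {i j : Fin N} (hp : a p = i) (hq : a q = j) :
    (z i - z j) * ((w p - w q)⁻¹ *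
        (pole z w a - pole z w (Function.update (Function.update a p j) q i))) =
      pole z w a + pole z w (Function.update (Function.update a p j) q i) -
        pole z w (Function.update a q i) - pole z w (Function.update a p j) := by
  have hne : q ≠ p := fun h => hpq (by rw [h])
  have hq' : q ∈ Finset.univ.erase p := by simp [hne]
  have hp' : p ∈ Finset.univ.erase q := by simp [hne.symm]
  have e1 : pole z w a = (w p - z i)⁻¹ * ((w q - z j)⁻¹ *
      ∏ x ∈ (Finset.univ.erase p).erase q, (w x - z (a x))⁻¹) := by
    rw [pole_split z w a p, ← Finset.mul_prod_erase _ (fun x => (w x - z (a x))⁻¹) hq', hp, hq]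
  have e2 : pole z w (Function.update a p j) = (w p - z j)⁻¹ * ((w q - z j)⁻¹ *
      ∏ x ∈ (Finset.univ.erase p).erase q, (w x - z (a x))⁻¹) := by
    rw [pole_update, ← Finset.mul_prod_erase _ (fun x => (w x - z (a x))⁻¹) hq', hq]
  have e3 : pole z w (Function.update a q i) = (w q - z i)⁻¹ * ((w p - z i)⁻¹ *
      ∏ x ∈ (Finset.univ.erase p).erase q, (w x - z (a x))⁻¹) := by
    rw [pole_update, ← Finset.mul_prod_erase _ (fun x => (w x - z (a x))⁻¹) hp', hp,
      Finset.erase_right_comm]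
  have e4 : pole z w (Function.update (Function.update a p j) q i) =
      (w q - z i)⁻¹ * ((w p - z j)⁻¹ *
        ∏ x ∈ (Finset.univ.erase p).erase q, (w x - z (a x))⁻¹) := by
    rw [pole_update, ← Finset.mul_prod_erase _ _ hp', Function.update_self,
      Finset.erase_right_comm]
    congr 2
    refine Finset.prod_congr rfl fun x hx => ?_
    simp only [Finset.mem_erase] at hx
    rw [Function.update_of_ne hx.2.1]
  rw [e1, e2, e3, e4]
  have h1 := sub_ne_zero.2 (hw p i)
  have h2 := sub_ne_zero.2 (hw p j)
  have h3 := sub_ne_zero.2 (hw q i)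
  have h4 := sub_ne_zero.2 (hw q j)
  have h5 := sub_ne_zero.2 hpq
  generalize ∏ x ∈ (Finset.univ.erase p).erase q, (w x - z (a x))⁻¹ = R
  field_simp
  ring

/-- The contribution of one screening variable at each distribution. -/
theorem sum_single_pole (hw : ∀ p j, w p ≠ z j) {i j : Fin N} (hij : i ≠ j)
    (g : (Fin N → ℕ) → ℂ) :
    (z i - z j) * ∑ a : Fin m → Fin N,
        (∑ p, if a p = i then (w p - z j)⁻¹ else 0) * pole z w a * g (count a) =
      ∑ a : Fin m → Fin N, pole z w a *
        (count a i * g (count a) - count a j * g (shift j i (count a))) := by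
  have h1 : ∀ a : Fin m → Fin N, (z i - z j) *
      ((∑ p, if a p = i then (w p - z j)⁻¹ else 0) * pole z w a * g (count a)) =
      pole z w a * (count a i * g (count a)) -
        ∑ p, if a p = i then pole z w (Function.update a p j) * g (count a) else 0 := by
    intro a
    rw [count_cast, Finset.sum_mul, Finset.sum_mul, Finset.sum_mul, Finset.mul_sum, Finset.mul_sum,
      ← Finset.sum_sub_distrib]
    refine Finset.sum_congr rfl fun p _ => ?_
    split_ifs with h
    · rw [← mul_assoc, pole_mul_inv hw h]; ring
    · simp
  rw [Finset.mul_sum, Finset.sum_congr rfl fun a _ => h1 a]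
  simp only [mul_sub, Finset.sum_sub_distrib]
  congr 1
  -- In the subtracted terms the pole sits at the moved map. Reindexing puts it at `a` and shifts
  -- the multiplicity instead.
  rw [Finset.sum_comm, Finset.sum_congr rfl fun p _ =>
    sum_reindex p i j (fun a a' => pole z w a * g (count a')), Finset.sum_comm]
  refine Finset.sum_congr rfl fun a _ => ?_
  rw [count_cast, Finset.sum_mul, Finset.mul_sum]
  refine Finset.sum_congr rfl fun p _ => ?_
  split_ifs with h
  · rw [count_update hij.symm h]; ring
  · simp

theorem shift_shift {i j : Fin N} (hij : i ≠ j) (μ : Fin N → ℕ) (h : μ i ≠ 0) :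
    shift j i (shift i j μ) = μ := by
  ext l
  by_cases hi : l = i
  · subst hi
    simp [shift, hij]
    omega
  · by_cases hj : l = j
    · subst hj
      simp [shift, hi]
    · simp [shift, hi, hj]

theorem sum_reindex_pair {p q : Fin m} (hpq : p ≠ q) (i j : Fin N)
    (F : (Fin m → Fin N) → (Fin m → Fin N) → ℂ) :
    (∑ a : Fin m → Fin N, if a p = i ∧ a q = j then
        F (Function.update (Function.update a p j) q i) a else 0) =
      ∑ a : Fin m → Fin N, if a p = j ∧ a q = i then
        F a (Function.update (Function.update a p i) q j) else 0 := by
  have back : ∀ (i j : Fin N) (a : Fin m → Fin N), a p = i ∧ a q = j →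
      Function.update (Function.update (Function.update (Function.update a p j) q i) p i) q j =
        a := by
    rintro i j a ⟨rfl, rfl⟩
    rw [Function.update_comm hpq.symm, Function.update_idem, Function.update_idem]
    simp
  rw [← Finset.sum_filter, ← Finset.sum_filter]
  refine Finset.sum_bij' (fun a _ => Function.update (Function.update a p j) q i)
    (fun a _ => Function.update (Function.update a p i) q j) ?_ ?_ ?_ ?_ ?_
  · intro a _; simp [hpq]
  · intro a _; simp [hpq]
  · intro a ha
    simp only [Finset.mem_filter, Finset.mem_univ, true_and] at ha
    exact back i j a ha
  · intro a ha
    simp only [Finset.mem_filter, Finset.mem_univ, true_and] at ha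
    exact back j i a ha
  · intro a ha
    simp only [Finset.mem_filter, Finset.mem_univ, true_and] at ha
    rw [back i j a ha]

theorem count_swap {a : Fin m → Fin N} {p q : Fin m} {i j : Fin N} (hij : i ≠ j)
    (hp : a p = i) (hq : a q = j) :
    count (Function.update (Function.update a p j) q i) = count a := by
  have hpq : q ≠ p := fun h => hij (by rw [← hp, ← hq, h])
  rw [count_update hij.symm (by rwa [Function.update_of_ne hpq]), count_update hij hp,
    shift_shift hij]
  have : p ∈ Finset.univ.filter (fun p => a p = i) := by simp [hp]
  exact Finset.card_ne_zero_of_mem this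

theorem sum_pairs_ne (a : Fin m → Fin N) (i : Fin N) :
    ∑ p, ∑ q, (if p ≠ q ∧ a p = i ∧ a q = i then (1 : ℂ) else 0) =
      count a i * (count a i - 1) := by
  have h : ∀ p q, (if p ≠ q ∧ a p = i ∧ a q = i then (1 : ℂ) else 0) =
      (if a p = i then 1 else 0) * (if a q = i then 1 else 0) -
        (if q = p then (if a p = i then 1 else 0) else 0) := by
    intro p q
    by_cases h : p = q
    · subst h
      by_cases hp : a p = i <;> simp [hp]
    · by_cases hp : a p = i <;> by_cases hq : a q = i <;> simp [h, Ne.symm h, hp, hq]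
  simp only [h, Finset.sum_sub_distrib, ← Finset.mul_sum, ← Finset.sum_mul, ← count_cast]
  simp only [Finset.sum_ite_eq', Finset.mem_univ, if_true, ← count_cast]
  ring

/-- After the move both `p` and `q` sit at `i`. A map with `n` variables at `i` arises from `n (n -
1)` ordered pairs of distinct indices, which is the source of the quadratic part of the action of
`X`. -/
theorem sum_pair_update {i j : Fin N} (hij : i ≠ j) (f : (Fin m → Fin N) → ℂ)
    (g : (Fin N → ℕ) → ℂ) :
    ∑ p, ∑ q, ∑ a : Fin m → Fin N,
        (if a p = i ∧ a q = j then f (Function.update a q i) * g (count a) else 0) =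
      ∑ a : Fin m → Fin N, f a * (count a i * (count a i - 1) * g (shift i j (count a))) := by
  have h : ∀ p q, ∑ a : Fin m → Fin N,
      (if a p = i ∧ a q = j then f (Function.update a q i) * g (count a) else 0) =
      ∑ a : Fin m → Fin N, (if p ≠ q ∧ a p = i ∧ a q = i then (1 : ℂ) else 0) *
        (f a * g (shift i j (count a))) := by
    intro p q
    by_cases hpq : p = q
    · subst hpq
      refine Finset.sum_congr rfl fun a _ => ?_
      rw [if_neg, if_neg (by simp), zero_mul]
      rintro ⟨h1, h2⟩
      exact hij (h1.symm.trans h2)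
    · have := sum_reindex q j i (fun a a' => if a' p = i then f a * g (count a') else 0)
      refine Eq.trans (Finset.sum_congr rfl fun a _ => ?_)
        (this.trans (Finset.sum_congr rfl fun a _ => ?_))
      · by_cases hp : a p = i <;> by_cases hq : a q = j <;> simp [hp, hq]
      by_cases hq : a q = i
      · rw [count_update hij hq]
        by_cases hp : a p = i <;> simp [hp, hq, hpq]
      · simp [hq]
  simp only [h]
  rw [Finset.sum_congr rfl fun p _ => Finset.sum_comm, Finset.sum_comm]
  refine Finset.sum_congr rfl fun a _ => ?_
  simp only [← Finset.sum_mul, sum_pairs_ne]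
  ring

/-- The contribution of pairs of screening variables. -/
theorem sum_pair_pole (hw : ∀ p j, w p ≠ z j) (hww : ∀ p q, p ≠ q → w p ≠ w q) {i j : Fin N}
    (hij : i ≠ j) (g : (Fin N → ℕ) → ℂ) :
    (z i - z j) * ∑ a : Fin m → Fin N,
        (2 * ∑ p, ∑ q, if a p = i ∧ a q = j then (w p - w q)⁻¹ else 0) *
          pole z w a * g (count a) =
      ∑ a : Fin m → Fin N, pole z w a *
        (2 * count a i * count a j * g (count a) -
          count a i * (count a i - 1) * g (shift i j (count a)) -
          count a j * (count a j - 1) * g (shift j i (count a))) := by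
  -- Symmetrization: exchanging `p` and `q` changes the sign of `1/(w_p - w_q)`, so summed over
  -- everything `T` is minus the swapped version `T'`. Thus `2 ∑ T = ∑ (T - T')`, the combination to
  -- which the two-variable partial fractions apply.
  set T : Fin m → Fin m → (Fin m → Fin N) → ℂ := fun p q a =>
    if a p = i ∧ a q = j then (z i - z j) * ((w p - w q)⁻¹ * pole z w a) * g (count a) else 0
  set T' : Fin m → Fin m → (Fin m → Fin N) → ℂ := fun p q a =>
    if a p = i ∧ a q = j then (z i - z j) * ((w p - w q)⁻¹ *
      pole z w (Function.update (Function.update a p j) q i)) * g (count a) else 0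
  have hne : ∀ {p q : Fin m} {a : Fin m → Fin N}, a p = i ∧ a q = j → p ≠ q := by
    rintro p q a ⟨h1, h2⟩ rfl
    exact hij (h1.symm.trans h2)
  have hsw : ∀ p q, ∑ a, T q p a = - ∑ a, T' p q a := by
    intro p q
    by_cases hpq : p = q
    · subst hpq
      have e : ∀ a : Fin m → Fin N, ¬ (a p = i ∧ a p = j) := fun a h => hne h rfl
      simp [T, T', e]
    · have := sum_reindex_pair (fun h => hpq h) i j
        (fun a a' => (z i - z j) * ((w p - w q)⁻¹ * pole z w a) * g (count a'))
      simp only [T']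
      rw [this, ← Finset.sum_neg_distrib]
      refine Finset.sum_congr rfl fun a _ => ?_
      simp only [T, and_comm (a := a q = i)]
      split_ifs with h
      · rw [count_swap hij.symm h.1 h.2, ← neg_sub (w p) (w q), inv_neg]
        ring
      · simp
  have hLT : (z i - z j) * ∑ a : Fin m → Fin N,
        (2 * ∑ p, ∑ q, if a p = i ∧ a q = j then (w p - w q)⁻¹ else 0) *
          pole z w a * g (count a) = 2 * ∑ p, ∑ q, ∑ a, T p q a := by
    have : ∀ p, ∑ q, ∑ a, T p q a = ∑ a, ∑ q, T p q a := fun p => Finset.sum_comm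
    simp only [this]
    rw [Finset.sum_comm, Finset.mul_sum, Finset.mul_sum]
    refine Finset.sum_congr rfl fun a _ => ?_
    simp only [Finset.sum_mul, Finset.mul_sum]
    refine Finset.sum_congr rfl fun p _ => Finset.sum_congr rfl fun q _ => ?_
    simp only [T]
    split_ifs <;> ring
  have hT' : ∑ p, ∑ q, ∑ a, T p q a = - ∑ p, ∑ q, ∑ a, T' p q a := by
    rw [Finset.sum_comm]
    simp only [hsw, Finset.sum_neg_distrib]
  have hd : ∀ p q a, T p q a - T' p q a =
      (if a p = i ∧ a q = j then pole z w a * g (count a) else 0) +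
      (if a p = i ∧ a q = j then
        pole z w (Function.update (Function.update a p j) q i) * g (count a) else 0) -
      (if a p = i ∧ a q = j then pole z w (Function.update a q i) * g (count a) else 0) -
      (if a p = i ∧ a q = j then pole z w (Function.update a p j) * g (count a) else 0) := by
    intro p q a
    simp only [T, T']
    split_ifs with h
    · have := pole_mul_inv_sub hw (hww p q (hne h)) h.1 h.2
      linear_combination g (count a) * this
    · simp
  have h1 : ∑ p, ∑ q, ∑ a : Fin m → Fin N,
      (if a p = i ∧ a q = j then pole z w a * g (count a) else 0) =
      ∑ a : Fin m → Fin N, pole z w a * (count a i * count a j * g (count a)) := by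
    rw [Finset.sum_congr rfl fun p _ => Finset.sum_comm, Finset.sum_comm]
    refine Finset.sum_congr rfl fun a _ => ?_
    rw [count_cast, count_cast, Finset.sum_mul_sum]
    simp only [Finset.sum_mul, Finset.mul_sum]
    refine Finset.sum_congr rfl fun p _ => Finset.sum_congr rfl fun q _ => ?_
    by_cases hp : a p = i <;> by_cases hq : a q = j <;> simp [hp, hq]
  have h2 : ∑ p, ∑ q, ∑ a : Fin m → Fin N, (if a p = i ∧ a q = j then
        pole z w (Function.update (Function.update a p j) q i) * g (count a) else 0) =
      ∑ a : Fin m → Fin N, pole z w a * (count a i * count a j * g (count a)) := by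
    rw [← h1, Finset.sum_comm]
    refine Finset.sum_congr rfl fun q _ => Finset.sum_congr rfl fun p _ => ?_
    by_cases hpq : p = q
    · subst hpq
      have e : ∀ a : Fin m → Fin N, ¬ (a p = i ∧ a p = j) := fun a h => hne h rfl
      simp [e]
    · rw [sum_reindex_pair hpq i j (fun a a' => pole z w a * g (count a'))]
      refine Finset.sum_congr rfl fun a _ => ?_
      simp only [and_comm (a := a q = i)]
      split_ifs with h
      · rw [count_swap hij.symm h.1 h.2]
      · rfl
  have h3 := sum_pair_update hij (pole z w) g
  have h4 : ∑ p, ∑ q, ∑ a : Fin m → Fin N, (if a p = i ∧ a q = j then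
        pole z w (Function.update a p j) * g (count a) else 0) = _ :=
    Eq.trans (by rw [Finset.sum_comm]; simp only [and_comm]) (sum_pair_update hij.symm (pole z w) g)
  have h5 : 2 * ∑ p, ∑ q, ∑ a, T p q a = ∑ p, ∑ q, ∑ a, (T p q a - T' p q a) := by
    simp only [Finset.sum_sub_distrib]
    linear_combination hT'
  rw [hLT, h5]
  simp only [hd, Finset.sum_sub_distrib, Finset.sum_add_distrib, h1, h2, h3, h4]
  simp only [← Finset.sum_sub_distrib, ← Finset.sum_add_distrib]
  exact Finset.sum_congr rfl fun a _ => by ring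

/-- Grouping the maps by their multiplicities returns from sums over maps to the integrands of the
blocks. -/
theorem sum_pole_mul_count (z : Fin N → ℂ) (w : Fin m → ℂ) (W : (Fin N → ℕ) → ℂ) :
    ∑ a : Fin m → Fin N, pole z w a * W (count a) =
      ∑ μ : HeightIndex N m, poleSum μ.1 z w * W μ.1 := by
  simp only [poleSum_eq, Finset.sum_mul]
  rw [Finset.sum_comm]
  refine Finset.sum_congr rfl fun a _ => ?_
  rw [Finset.sum_eq_single ⟨count a, (mem_height _).2 (sum_count a)⟩]
  · simp
  · intro μ _ hμ
    rw [if_neg, zero_mul]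
    exact fun h => hμ (Subtype.ext h.symm)
  · simp

/-- The logarithmic derivative of `A(z,w)` in `w_p`. -/
noncomputable def dlogW (b : ℂ) (lam : ℝ) (k : Fin N → ℤ) (z : Fin N → ℂ) (w : Fin m → ℂ)
    (p : Fin m) : ℂ :=
  (lam : ℂ) / b ^ 2 - 2 / b ^ 2 * ∑ q, (w p - w q)⁻¹ + ∑ j, (k j : ℂ) / b ^ 2 * (w p - z j)⁻¹

/-- The logarithmic derivative of `A(z,w)` along the translation of `z_i` together with all `w_p`
for which `a(p) = i`. -/
noncomputable def dlogZ (b : ℂ) (lam : ℝ) (k : Fin N → ℤ) (z : Fin N → ℂ) (w : Fin m → ℂ)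
    (i : Fin N) (a : Fin m → Fin N) : ℂ :=
  (∑ p, if a p = i then dlogW b lam k z w p else 0) -
    ∑ p, (k i : ℂ) / b ^ 2 * (w p - z i)⁻¹

/-- Two cancellations leave only `j ≠ i`: pairs of variables both attached to `z_i` cancel by
antisymmetry, and the poles at `z_i` of variables attached to `z_i` cancel against those from the
motion of `z_i`. The summand `q = p` in `dlogW` is `0⁻¹ = 0`. -/
theorem neg_sq_mul_dlogZ {b : ℂ} (hb : b ≠ 0) (lam : ℝ) (k : Fin N → ℤ) (z : Fin N → ℂ)
    (w : Fin m → ℂ) (i : Fin N) (a : Fin m → Fin N) :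
    -b ^ 2 * dlogZ b lam k z w i a = -(lam : ℂ) * count a i +
      ∑ j ∈ Finset.univ.erase i,
        ((2 * ∑ p, ∑ q, if a p = i ∧ a q = j then (w p - w q)⁻¹ else 0) -
          k j * (∑ p, if a p = i then (w p - z j)⁻¹ else 0) +
          k i * ∑ p, if a p = j then (w p - z i)⁻¹ else 0) := by
  have hb2 : b ^ 2 ≠ 0 := pow_ne_zero 2 hb
  have hself : ∑ p, ∑ q, (if a p = i ∧ a q = i then (w p - w q)⁻¹ else 0) = 0 := by
    have : ∑ p, ∑ q, (if a p = i ∧ a q = i then (w p - w q)⁻¹ else 0) =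
        - ∑ p, ∑ q, (if a p = i ∧ a q = i then (w p - w q)⁻¹ else 0) := by
      conv_lhs => rw [Finset.sum_comm]
      simp only [← Finset.sum_neg_distrib]
      refine Finset.sum_congr rfl fun p _ => Finset.sum_congr rfl fun q _ => ?_
      rw [← neg_sub (w p) (w q), inv_neg]
      by_cases hp : a p = i <;> by_cases hq : a q = i <;> simp [hp, hq]
    exact self_eq_neg.1 this
  have h1 : ∑ j ∈ Finset.univ.erase i, ∑ p, ∑ q,
      (if a p = i ∧ a q = j then (w p - w q)⁻¹ else 0) =
      ∑ p, if a p = i then ∑ q, (w p - w q)⁻¹ else 0 := by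
    -- The vanishing term `j = i` is inserted, so that summing over all `j` removes the condition on
    -- `a q`.
    refine (zero_add _).symm.trans ?_
    nth_rewrite 1 [← hself]
    rw [Finset.add_sum_erase _ (fun j => ∑ p, ∑ q,
        (if a p = i ∧ a q = j then (w p - w q)⁻¹ else 0)) (Finset.mem_univ i), Finset.sum_comm]
    refine Finset.sum_congr rfl fun p _ => ?_
    rw [Finset.sum_comm]
    by_cases hp : a p = i <;> simp [hp]
  have h2 : ∑ j ∈ Finset.univ.erase i, ∑ p, (if a p = j then (w p - z i)⁻¹ else 0) =
      ∑ p, (w p - z i)⁻¹ - ∑ p, if a p = i then (w p - z i)⁻¹ else 0 := by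
    rw [eq_sub_iff_add_eq, add_comm, Finset.add_sum_erase _
      (fun j => ∑ p, (if a p = j then (w p - z i)⁻¹ else 0)) (Finset.mem_univ i), Finset.sum_comm]
    simp
  have h3 : ∑ j ∈ Finset.univ.erase i, k j * (∑ p, if a p = i then (w p - z j)⁻¹ else 0) =
      (∑ p, if a p = i then ∑ j, k j * (w p - z j)⁻¹ else 0) -
        k i * ∑ p, if a p = i then (w p - z i)⁻¹ else 0 := by
    rw [eq_sub_iff_add_eq, add_comm, Finset.add_sum_erase _
      (fun j => (k j : ℂ) * ∑ p, (if a p = i then (w p - z j)⁻¹ else 0)) (Finset.mem_univ i)]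
    simp only [Finset.mul_sum]
    rw [Finset.sum_comm]
    refine Finset.sum_congr rfl fun p _ => ?_
    split_ifs <;> simp
  rw [Finset.sum_add_distrib, Finset.sum_sub_distrib, ← Finset.mul_sum, ← Finset.mul_sum, h1, h2,
    h3, dlogZ, count_cast, mul_sub]
  have h4 : -b ^ 2 * ∑ p, (k i : ℂ) / b ^ 2 * (w p - z i)⁻¹ = -k i * ∑ p, (w p - z i)⁻¹ := by
    rw [← Finset.mul_sum]
    field_simp
  have h5 : ∀ p, -b ^ 2 * (if a p = i then dlogW b lam k z w p else 0) =
      -(lam : ℂ) * (if a p = i then 1 else 0) +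
        2 * (if a p = i then ∑ q, (w p - w q)⁻¹ else 0) -
        (if a p = i then ∑ j, k j * (w p - z j)⁻¹ else 0) := by
    intro p
    split_ifs
    · have : ∑ j, (k j : ℂ) / b ^ 2 * (w p - z j)⁻¹ =
          (b ^ 2)⁻¹ * ∑ j, (k j : ℂ) * (w p - z j)⁻¹ := by
        rw [Finset.mul_sum]
        exact Finset.sum_congr rfl fun j _ => by ring
      rw [dlogW, this]
      field_simp
      ring
    · simp
  rw [Finset.mul_sum, Finset.sum_congr rfl fun p _ => h5 p, h4, Finset.sum_sub_distrib,
    Finset.sum_add_distrib, ← Finset.mul_sum, ← Finset.mul_sum]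
  ring

/-- The equation for the integrands, modulo total derivatives. -/
theorem sum_dlogZ_mul_pole {b : ℂ} (hb : b ≠ 0) (lam : ℝ) (k : Fin N → ℤ)
    (hz : ∀ i j, i ≠ j → z i ≠ z j) (hw : ∀ p j, w p ≠ z j) (hww : ∀ p q, p ≠ q → w p ≠ w q)
    (i : Fin N) (ν : HeightIndex N m) :
    -b ^ 2 * ∑ a : Fin m → Fin N,
        (if count a = ν.1 then dlogZ b lam k z w i a * pole z w a else 0) =
      ((AMatrix m lam i).mulVec (fun μ => poleSum μ.1 z w) +
        ∑ j ∈ Finset.univ.erase i, (z i - z j)⁻¹ •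
          (OmegaHat m k i j).transpose.mulVec (fun μ => poleSum μ.1 z w)) ν := by
  -- As a weight, the indicator of `ν` makes the shifted multiplicities read off column `ν` of
  -- `Ω̂_ij`.
  set g : (Fin N → ℕ) → ℂ := fun κ => if κ = ν.1 then 1 else 0 with hg
  have e : ∀ a : Fin m → Fin N, -b ^ 2 *
      (if count a = ν.1 then dlogZ b lam k z w i a * pole z w a else 0) =
      pole z w a * (-(lam : ℂ) * count a i * g (count a)) +
      ∑ j ∈ Finset.univ.erase i,
        ((2 * ∑ p, ∑ q, if a p = i ∧ a q = j then (w p - w q)⁻¹ else 0) * pole z w a *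
            g (count a) -
          k j * ((∑ p, if a p = i then (w p - z j)⁻¹ else 0) * pole z w a * g (count a)) +
          k i * ((∑ p, if a p = j then (w p - z i)⁻¹ else 0) * pole z w a * g (count a))) := by
    intro a
    have : ∀ j ∈ Finset.univ.erase i,
        ((2 * ∑ p, ∑ q, if a p = i ∧ a q = j then (w p - w q)⁻¹ else 0) * pole z w a *
            g (count a) -
          k j * ((∑ p, if a p = i then (w p - z j)⁻¹ else 0) * pole z w a * g (count a)) +
          k i * ((∑ p, if a p = j then (w p - z i)⁻¹ else 0) * pole z w a * g (count a))) =
        ((2 * ∑ p, ∑ q, if a p = i ∧ a q = j then (w p - w q)⁻¹ else 0) -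
          k j * (∑ p, if a p = i then (w p - z j)⁻¹ else 0) +
          k i * ∑ p, if a p = j then (w p - z i)⁻¹ else 0) * (pole z w a * g (count a)) :=
      fun j _ => by ring
    rw [Finset.sum_congr rfl this, ← Finset.sum_mul]
    have h := neg_sq_mul_dlogZ hb lam k z w i a
    have h' : (if count a = ν.1 then dlogZ b lam k z w i a * pole z w a else 0) =
        dlogZ b lam k z w i a * (pole z w a * g (count a)) := by
      simp only [hg]; split_ifs <;> simp
    rw [h']
    linear_combination (pole z w a * g (count a)) * h
  rw [Finset.mul_sum, Finset.sum_congr rfl fun a _ => e a, Finset.sum_add_distrib, Finset.sum_comm,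
    Pi.add_apply, Finset.sum_apply]
  congr 1
  · rw [sum_pole_mul_count z w (fun κ => -(lam : ℂ) * κ i * g κ), AMatrix, Matrix.mulVec_diagonal,
      Finset.sum_eq_single ν]
    · simp [hg]; ring
    · intro μ _ hμ
      have : μ.1 ≠ ν.1 := fun h => hμ (Subtype.ext h)
      simp [hg, this]
    · simp
  · refine Finset.sum_congr rfl fun j hj => ?_
    have hij : i ≠ j := (Finset.ne_of_mem_erase hj).symm
    have hzij : z i - z j ≠ 0 := sub_ne_zero.2 (hz i j hij)
    have s1 := sum_pair_pole hw hww hij g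
    have s2 := sum_single_pole hw hij g
    have s3 := sum_single_pole hw hij.symm g
    have s4 := sum_pole_mul_count z w (fun κ =>
      (2 * (κ i : ℂ) * (κ j : ℂ) - (k i : ℂ) * (κ j : ℂ) - (k j : ℂ) * (κ i : ℂ)) * g κ +
      (κ i : ℂ) * ((k i : ℂ) - (κ i : ℂ) + 1) * g (shift i j κ) +
      (κ j : ℂ) * ((k j : ℂ) - (κ j : ℂ) + 1) * g (shift j i κ))
    -- The entry `κ_i (k_i - κ_i + 1)` splits as `k_i κ_i - κ_i (κ_i - 1)`: the linear part comes
    -- from single variables, the quadratic part from pairs.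
    have s5 : ∑ a : Fin m → Fin N, pole z w a *
        ((2 * (count a i : ℂ) * (count a j : ℂ) - (k i : ℂ) * (count a j : ℂ) -
          (k j : ℂ) * (count a i : ℂ)) * g (count a) +
        (count a i : ℂ) * ((k i : ℂ) - (count a i : ℂ) + 1) * g (shift i j (count a)) +
        (count a j : ℂ) * ((k j : ℂ) - (count a j : ℂ) + 1) * g (shift j i (count a))) =
        (∑ a : Fin m → Fin N, pole z w a *
          (2 * count a i * count a j * g (count a) -
            count a i * (count a i - 1) * g (shift i j (count a)) -
            count a j * (count a j - 1) * g (shift j i (count a)))) -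
        k j * (∑ a : Fin m → Fin N, pole z w a *
          (count a i * g (count a) - count a j * g (shift j i (count a)))) -
        k i * (∑ a : Fin m → Fin N, pole z w a *
          (count a j * g (count a) - count a i * g (shift i j (count a)))) := by
      rw [Finset.mul_sum, Finset.mul_sum, ← Finset.sum_sub_distrib, ← Finset.sum_sub_distrib]
      exact Finset.sum_congr rfl fun a _ => by ring
    have s6 : (OmegaHat m k i j).transpose.mulVec (fun μ => poleSum μ.1 z w) ν =
        ∑ μ : HeightIndex N m, poleSum μ.1 z w *
      ((2 * (μ.1 i : ℂ) * (μ.1 j : ℂ) - (k i : ℂ) * (μ.1 j : ℂ) - (k j : ℂ) * (μ.1 i : ℂ)) *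
        g μ.1 +
      (μ.1 i : ℂ) * ((k i : ℂ) - (μ.1 i : ℂ) + 1) * g (shift i j μ.1) +
      (μ.1 j : ℂ) * ((k j : ℂ) - (μ.1 j : ℂ) + 1) * g (shift j i μ.1)) := by
      simp only [Matrix.mulVec, dotProduct, Matrix.transpose_apply, OmegaHat_apply k hij, hg]
      exact Finset.sum_congr rfl fun μ _ => mul_comm _ _
    rw [Pi.smul_apply, smul_eq_mul, s6, ← s4, s5, ← s1, ← s2, ← s3, Finset.sum_add_distrib,
      Finset.sum_sub_distrib, ← Finset.mul_sum, ← Finset.mul_sum, eq_inv_mul_iff_mul_eq₀ hzij]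
    ring

end Reindex

/-! ### Derivatives of determinants of first derivatives -/

section Determinants

variable {V : Type*} [NormedAddCommGroup V] [NormedSpace ℝ V] {m : ℕ}

theorem hasFDerivAt_det {M : V → Matrix (Fin m) (Fin m) ℂ} {M' : Fin m → Fin m → V →L[ℝ] ℂ}
    {x : V} (h : ∀ p s, HasFDerivAt (fun y => M y p s) (M' p s) x) :
    ∃ D : V →L[ℝ] ℂ, HasFDerivAt (fun y => (M y).det) D x ∧
      ∀ u, D u = ∑ s, ((M x).updateCol s fun p => M' p s u).det := by
  simp only [Matrix.det_apply']
  refine ⟨_, HasFDerivAt.fun_sum fun τ _ =>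
    (HasFDerivAt.finsetProd fun i _ => h (τ i) i).const_mul _, fun u => ?_⟩
  rw [Finset.sum_comm]
  simp only [sum_apply, smul_apply, smul_eq_mul,
    Finset.mul_sum]
  refine Finset.sum_congr rfl fun τ _ => Finset.sum_congr rfl fun s _ => ?_
  rw [← Finset.mul_prod_erase _ _ (Finset.mem_univ s), Matrix.updateCol_self, mul_comm (M' _ _ u)]
  congr 2
  refine Finset.prod_congr rfl fun i hi => ?_
  rw [Matrix.updateCol_ne (Finset.ne_of_mem_erase hi)]

theorem det_updateCol_swap (M : Matrix (Fin m) (Fin m) ℂ) {r s : Fin m} (hrs : r ≠ s)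
    (x y : Fin m → ℂ) :
    ((M.updateCol s x).updateCol r y).det = -((M.updateCol r x).updateCol s y).det := by
  have h := Matrix.det_permute' (Equiv.swap r s) ((M.updateCol r x).updateCol s y)
  rw [Equiv.Perm.sign_swap hrs] at h
  simp only [Units.val_neg, Units.val_one, Int.cast_neg, Int.cast_one, neg_mul, one_mul] at h
  rw [← h]
  congr 1
  ext p q
  by_cases h1 : q = r
  · subst h1
    simp
  · by_cases h2 : q = s
    · subst h2
      simp [hrs.symm, hrs]
    · simp [h1, h2, Equiv.swap_apply_of_ne_of_ne h1 h2]

/-- This is `d ∘ d = 0` in coordinates: off the diagonal, exchanging `s` and `r` changes the sign of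
the determinant while the second derivatives `H` are symmetric. On the diagonal the second update
overwrites the first. -/
theorem sum_det_updateCol_symm (M : Matrix (Fin m) (Fin m) ℂ) (c : Fin m → ℂ)
    (d : Fin m → Fin m → ℂ) (H : Fin m → Fin m → Fin m → ℂ) (hH : ∀ s r, H s r = H r s) :
    ∑ s, ∑ r, ((M.updateCol s c).updateCol r (if r = s then d s else H s r)).det =
      ∑ s, (M.updateCol s (d s)).det := by
  have h : ∀ s r, ((M.updateCol s c).updateCol r (if r = s then d s else H s r)).det =
      (if r = s then (M.updateCol s (d s)).det else 0) +
        (if r = s then 0 else ((M.updateCol s c).updateCol r (H s r)).det) := by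
    intro s r
    by_cases hrs : r = s
    · subst hrs
      simp
    · simp [hrs]
  have h0 : ∑ s, ∑ r, (if r = s then 0 else ((M.updateCol s c).updateCol r (H s r)).det) = 0 := by
    refine self_eq_neg.1 ?_
    conv_lhs => rw [Finset.sum_comm]
    simp only [← Finset.sum_neg_distrib]
    refine Finset.sum_congr rfl fun s _ => Finset.sum_congr rfl fun r _ => ?_
    by_cases hrs : r = s
    · simp [hrs]
    · rw [if_neg (Ne.symm hrs), if_neg hrs, det_updateCol_swap M (Ne.symm hrs), hH]
  simp only [h, Finset.sum_add_distrib, h0]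
  simp

/-- Cramer's rule for a linear functional which, up to a multiple of another one, is a combination
of the rows. -/
theorem cramer_bordered (M : Matrix (Fin m) (Fin m) ℂ) (c g e : Fin m → ℂ) (e₀ h : ℂ)
    (he : ∀ s, e s = ∑ p, g p * M p s) (he₀ : e₀ = ∑ p, g p * c p + h) :
    e₀ * M.det - ∑ s, e s * (M.updateCol s c).det = h * M.det := by
  have hc := Matrix.mulVec_cramer M c
  have h1 : ∑ s, e s * (M.updateCol s c).det = ∑ p, g p * (M.det * c p) := by
    simp only [he, Finset.sum_mul]
    rw [Finset.sum_comm]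
    refine Finset.sum_congr rfl fun p _ => ?_
    have := congrFun hc p
    simp only [Matrix.mulVec, dotProduct, Matrix.cramer_apply, Pi.smul_apply, smul_eq_mul] at this
    rw [← this, Finset.mul_sum]
    exact Finset.sum_congr rfl fun s _ => by ring
  rw [h1, he₀, add_mul, Finset.sum_mul, add_sub_right_comm, ← Finset.sum_sub_distrib,
    Finset.sum_eq_zero, zero_add]
  intro p _
  ring

/-- The matrix of the derivatives of the functions `L_p` in the directions `ε_s`. -/
noncomputable def frame (L : Fin m → V → ℂ) (ε : Fin m → V) (x : V) :
    Matrix (Fin m) (Fin m) ℂ :=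
  Matrix.of fun p s => fderiv ℝ (L p) x (ε s)

/-- The coefficient of `e^E dL_1 ∧ ... ∧ dL_m` in the directions `ε_s`. -/
noncomputable def density (e : V → ℂ) (L : Fin m → V → ℂ) (ε : Fin m → V) (x : V) : ℂ :=
  Complex.exp (e x) * (frame L ε x).det

/-- The coefficient of `e^E dL_1 ∧ ... ∧ dL_m`, the direction `ε_s` being replaced by `v`. -/
noncomputable def flux (e : V → ℂ) (L : Fin m → V → ℂ) (ε : Fin m → V) (v : V) (s : Fin m)
    (x : V) : ℂ :=
  Complex.exp (e x) * ((frame L ε x).updateCol s fun p => fderiv ℝ (L p) x v).det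

theorem hasFDerivAt_fderiv_apply {f : V → ℂ} {x : V} (hf : ContDiffAt ℝ 2 f x) (v : V) :
    HasFDerivAt (fun y => fderiv ℝ f y v) ((fderiv ℝ (fderiv ℝ f) x).flip v) x := by
  have h : HasFDerivAt (fderiv ℝ f) (fderiv ℝ (fderiv ℝ f) x) x :=
    ((hf.fderiv_right (m := 1) (by norm_num)).differentiableAt (by norm_num)).hasFDerivAt
  exact ((ContinuousLinearMap.apply ℝ ℂ v).hasFDerivAt.comp x h)

theorem hasFDerivAt_cexp_mul_det {e : V → ℂ} {x : V} (he : DifferentiableAt ℝ e x)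
    {M : V → Matrix (Fin m) (Fin m) ℂ} {M' : Fin m → Fin m → V →L[ℝ] ℂ}
    (h : ∀ p s, HasFDerivAt (fun y => M y p s) (M' p s) x) (u : V) :
    fderiv ℝ (fun y => Complex.exp (e y) * (M y).det) x u =
      Complex.exp (e x) * (fderiv ℝ e x u * (M x).det +
        ∑ s, ((M x).updateCol s fun p => M' p s u).det) := by
  obtain ⟨D, hD, hDu⟩ := hasFDerivAt_det h
  rw [(he.hasFDerivAt.cexp.fun_mul hD).fderiv]
  simp only [add_apply, smul_apply, smul_eq_mul, hDu]
  ring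

variable {e : V → ℂ} {L : Fin m → V → ℂ} {ε : Fin m → V} {x : V}

theorem fderiv_density (he : DifferentiableAt ℝ e x) (hL : ∀ p, ContDiffAt ℝ 2 (L p) x) (u : V) :
    fderiv ℝ (density e L ε) x u = Complex.exp (e x) * (fderiv ℝ e x u * (frame L ε x).det +
      ∑ s, ((frame L ε x).updateCol s fun p => fderiv ℝ (fderiv ℝ (L p)) x u (ε s)).det) :=
  hasFDerivAt_cexp_mul_det he (M := frame L ε)
    (fun p s => hasFDerivAt_fderiv_apply (hL p) (ε s)) u

theorem fderiv_flux (he : DifferentiableAt ℝ e x) (hL : ∀ p, ContDiffAt ℝ 2 (L p) x) (v : V)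
    (s : Fin m) (u : V) :
    fderiv ℝ (flux e L ε v s) x u = Complex.exp (e x) *
      (fderiv ℝ e x u * ((frame L ε x).updateCol s fun p => fderiv ℝ (L p) x v).det +
      ∑ r, (((frame L ε x).updateCol s fun p => fderiv ℝ (L p) x v).updateCol r
        fun p => fderiv ℝ (fderiv ℝ (L p)) x u (if r = s then v else ε r)).det) := by
  refine hasFDerivAt_cexp_mul_det he
    (M := fun y => (frame L ε y).updateCol s fun p => fderiv ℝ (L p) y v)
    (M' := fun p r => (fderiv ℝ (fderiv ℝ (L p)) x).flip (if r = s then v else ε r))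
    (fun p r => ?_) u
  by_cases hrs : r = s
  · subst hrs
    simpa using hasFDerivAt_fderiv_apply (hL p) v
  · simpa [hrs, frame] using hasFDerivAt_fderiv_apply (hL p) (ε r)

/-- The derivative of the density in a further direction is a divergence, up to the differential of
`e^E dL_1 ∧ ... ∧ dL_m`. -/
theorem sum_fderiv_flux (he : DifferentiableAt ℝ e x) (hL : ∀ p, ContDiffAt ℝ 2 (L p) x) (v : V) :
    ∑ s, fderiv ℝ (flux e L ε v s) x (ε s) = fderiv ℝ (density e L ε) x v -
      Complex.exp (e x) * (fderiv ℝ e x v * (frame L ε x).det -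
        ∑ s, fderiv ℝ e x (ε s) *
          ((frame L ε x).updateCol s fun p => fderiv ℝ (L p) x v).det) := by
  -- Symmetry of second derivatives serves twice: it cancels the mixed cube directions, and it
  -- identifies the surviving diagonal terms with those of the derivative of the density along `v`.
  have hsymm : ∀ p u u', fderiv ℝ (fderiv ℝ (L p)) x u u' = fderiv ℝ (fderiv ℝ (L p)) x u' u :=
    fun p u u' => (hL p).isSymmSndFDerivAt (by simp) u u'
  have h := sum_det_updateCol_symm (frame L ε x) (fun p => fderiv ℝ (L p) x v)
    (fun s p => fderiv ℝ (fderiv ℝ (L p)) x (ε s) v)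
    (fun s r p => fderiv ℝ (fderiv ℝ (L p)) x (ε s) (ε r)) (fun s r => by ext p; exact hsymm p _ _)
  have h' : ∀ s r, (fun p => fderiv ℝ (fderiv ℝ (L p)) x (ε s) (if r = s then v else ε r)) =
      if r = s then (fun p => fderiv ℝ (fderiv ℝ (L p)) x (ε s) v)
      else fun p => fderiv ℝ (fderiv ℝ (L p)) x (ε s) (ε r) := by
    intro s r
    split_ifs <;> rfl
  simp only [fderiv_flux he hL, fderiv_density he hL, ← Finset.mul_sum, Finset.sum_add_distrib,
    h', h, hsymm _ v]
  ring

/-! ### Regularity and size of the density and the flux. -/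

theorem contDiffAt_det {n : WithTop ℕ∞} {M : V → Matrix (Fin m) (Fin m) ℂ}
    (h : ∀ p s, ContDiffAt ℝ n (fun y => M y p s) x) : ContDiffAt ℝ n (fun y => (M y).det) x := by
  simp only [Matrix.det_apply']
  exact ContDiffAt.sum fun τ _ => contDiffAt_const.mul (contDiffAt_prod fun i _ => h _ _)

theorem contDiffAt_fderiv_apply {f : V → ℂ} (hf : ContDiffAt ℝ 2 f x) (v : V) :
    ContDiffAt ℝ 1 (fun y => fderiv ℝ f y v) x :=
  (hf.fderiv_right (m := 1) (by norm_num)).clm_apply contDiffAt_const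

theorem contDiffAt_density (he : ContDiffAt ℝ 2 e x) (hL : ∀ p, ContDiffAt ℝ 2 (L p) x) :
    ContDiffAt ℝ 1 (density e L ε) x :=
  (he.of_le (by norm_num)).cexp.mul
    (contDiffAt_det fun p s => contDiffAt_fderiv_apply (hL p) (ε s))

theorem contDiffAt_flux (he : ContDiffAt ℝ 2 e x) (hL : ∀ p, ContDiffAt ℝ 2 (L p) x) (v : V)
    (s : Fin m) : ContDiffAt ℝ 1 (flux e L ε v s) x := by
  refine (he.of_le (by norm_num)).cexp.mul (contDiffAt_det fun p r => ?_)
  by_cases hrs : r = s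
  · subst hrs
    simpa using contDiffAt_fderiv_apply (hL p) v
  · simpa [hrs, frame] using contDiffAt_fderiv_apply (hL p) (ε r)

theorem norm_det_le {M : Matrix (Fin m) (Fin m) ℂ} {S : ℝ} (h : ∀ p s, ‖M p s‖ ≤ S) :
    ‖M.det‖ ≤ m.factorial * S ^ m := by
  have := Matrix.det_le (A := M) (abv := NormedField.toAbsoluteValue ℂ) h
  rwa [nsmul_eq_mul, Fintype.card_fin] at this

variable {S : ℝ}

theorem norm_density_le (hε : ∀ s, ‖ε s‖ ≤ 1) (h1 : ∀ p, ‖fderiv ℝ (L p) x‖ ≤ S) :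
    ‖density e L ε x‖ ≤ m.factorial * (‖Complex.exp (e x)‖ * S ^ m) := by
  rw [density, norm_mul, mul_left_comm]
  refine mul_le_mul_of_nonneg_left (norm_det_le fun p s => ?_) (norm_nonneg _)
  exact ((fderiv ℝ (L p) x).le_of_opNorm_le_of_le (h1 p) (hε s)).trans_eq (mul_one S)

theorem norm_flux_le (hε : ∀ s, ‖ε s‖ ≤ 1) (hS : 0 ≤ S) (h1 : ∀ p, ‖fderiv ℝ (L p) x‖ ≤ S) (v : V)
    (s : Fin m) :
    ‖flux e L ε v s x‖ ≤ m.factorial * (1 + ‖v‖) ^ m * (‖Complex.exp (e x)‖ * S ^ m) := by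
  have : ∀ p r, ‖((frame L ε x).updateCol s fun p => fderiv ℝ (L p) x v) p r‖ ≤
      (1 + ‖v‖) * S := by
    intro p r
    by_cases hrs : r = s
    · subst hrs
      rw [Matrix.updateCol_self]
      refine ((fderiv ℝ (L p) x).le_of_opNorm_le (h1 p) v).trans ?_
      nlinarith
    · rw [Matrix.updateCol_ne hrs]
      refine ((fderiv ℝ (L p) x).le_of_opNorm_le_of_le (h1 p) (hε r)).trans ?_
      nlinarith [norm_nonneg v]
  rw [flux, norm_mul]
  refine (mul_le_mul_of_nonneg_left (norm_det_le this) (norm_nonneg _)).trans_eq ?_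
  rw [mul_pow]
  ring

/-- Differentiating the exponential costs one more power of `S`. Differentiating a column replaces a
first derivative by a second one, still bounded by `S`. Hence the exponent `m + 1`, with `1 ≤ S`
used to compare the powers. -/
theorem norm_fderiv_density_le (he : DifferentiableAt ℝ e x)
    (hL : ∀ p, ContDiffAt ℝ 2 (L p) x) (hε : ∀ s, ‖ε s‖ ≤ 1)
    {C : ℝ} (hS : 1 ≤ S) (h0 : ‖fderiv ℝ e x‖ ≤ C * S) (h1 : ∀ p, ‖fderiv ℝ (L p) x‖ ≤ S)
    (h2 : ∀ p, ‖fderiv ℝ (fderiv ℝ (L p)) x‖ ≤ S) :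
    ‖fderiv ℝ (density e L ε) x‖ ≤
      (C + m) * m.factorial * (‖Complex.exp (e x)‖ * S ^ (m + 1)) := by
  have hS0 : 0 ≤ S := zero_le_one.trans hS
  have hC : 0 ≤ C := by
    by_contra hC
    have := (norm_nonneg _).trans h0
    nlinarith
  refine ContinuousLinearMap.opNorm_le_of_unit_norm (by positivity) fun u hu => ?_
  rw [fderiv_density he hL, norm_mul]
  have hM : ∀ p s, ‖frame L ε x p s‖ ≤ S := fun p s =>
    ((fderiv ℝ (L p) x).le_of_opNorm_le_of_le (h1 p) (hε s)).trans_eq (mul_one S)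
  have hd : ‖fderiv ℝ e x u‖ ≤ C * S :=
    ((fderiv ℝ e x).le_of_opNorm_le_of_le h0 hu.le).trans_eq (mul_one _)
  have ha : ‖fderiv ℝ e x u * (frame L ε x).det‖ ≤ (C * S) * (m.factorial * S ^ m) := by
    rw [norm_mul]
    exact mul_le_mul hd (norm_det_le hM) (norm_nonneg _) (by positivity)
  have hb : ∀ s, ‖((frame L ε x).updateCol s
      fun p => fderiv ℝ (fderiv ℝ (L p)) x u (ε s)).det‖ ≤ m.factorial * S ^ m := by
    refine fun s => norm_det_le fun p r => ?_
    by_cases hrs : r = s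
    · subst hrs
      rw [Matrix.updateCol_self]
      refine ((fderiv ℝ (fderiv ℝ (L p)) x u).le_of_opNorm_le_of_le
        ((fderiv ℝ (fderiv ℝ (L p)) x).le_of_opNorm_le_of_le (h2 p) hu.le) (hε r)).trans_eq ?_
      ring
    · rw [Matrix.updateCol_ne hrs]
      exact hM p r
  have hc : ‖∑ s, ((frame L ε x).updateCol s
      fun p => fderiv ℝ (fderiv ℝ (L p)) x u (ε s)).det‖ ≤ m * (m.factorial * S ^ m) := by
    refine (norm_sum_le_of_le _ fun s _ => hb s).trans_eq ?_
    simp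
  have hSm : S ^ m ≤ S ^ (m + 1) := pow_le_pow_right₀ hS (Nat.le_succ m)
  calc ‖Complex.exp (e x)‖ * ‖fderiv ℝ e x u * (frame L ε x).det + ∑ s, ((frame L ε x).updateCol s
        fun p => fderiv ℝ (fderiv ℝ (L p)) x u (ε s)).det‖
      ≤ ‖Complex.exp (e x)‖ * ((C * S) * (m.factorial * S ^ m) + m * (m.factorial * S ^ m)) :=
        mul_le_mul_of_nonneg_left ((norm_add_le _ _).trans (add_le_add ha hc)) (norm_nonneg _)
    _ ≤ ‖Complex.exp (e x)‖ *
          ((C * S) * (m.factorial * S ^ m) + m * (m.factorial * S ^ (m + 1))) := by gcongr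
    _ = _ := by ring

end Determinants

/-! ### Integrals over cubes -/

section Integrals

open MeasureTheory

theorem isCompact_cube (m : ℕ) : IsCompact (cube m) := isCompact_Icc

theorem measurableSet_cube (m : ℕ) : MeasurableSet (cube m) := measurableSet_Icc

theorem volume_cube (m : ℕ) : volume.real (cube m) = 1 := by
  simp [cube, Measure.real, Real.volume_Icc_pi]

/-- The relations between the logarithms and `w` hold on the closed cube only, so they can be
differentiated in all directions just at interior points. Under the integral this suffices. -/
theorem ae_cube_interior (m : ℕ) : ∀ᵐ t ∂(volume.restrict (cube m)),
    t ∈ Set.univ.pi fun _ : Fin m => Set.Ioo (0 : ℝ) 1 := by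
  have h : (Set.univ.pi fun i => Set.Ioo ((0 : Fin m → ℝ) i) ((1 : Fin m → ℝ) i)) =ᵐ[volume]
      Set.Icc (0 : Fin m → ℝ) 1 := Measure.univ_pi_Ioo_ae_eq_Icc
  rw [ae_restrict_iff' (measurableSet_cube m)]
  filter_upwards [h.mem_iff] with t ht
  exact ht.2

theorem interior_subset_cube {m : ℕ} :
    (Set.univ.pi fun _ : Fin m => Set.Ioo (0 : ℝ) 1) ⊆ cube m := by
  intro t ht
  exact ⟨fun i => (ht i trivial).1.le, fun i => (ht i trivial).2.le⟩

theorem cube_mem_nhds {m : ℕ} {t : Fin m → ℝ}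
    (ht : t ∈ Set.univ.pi fun _ : Fin m => Set.Ioo (0 : ℝ) 1) : cube m ∈ 𝓝 t :=
  Filter.mem_of_superset
    ((isOpen_set_pi Set.finite_univ fun _ _ => isOpen_Ioo).mem_nhds ht) interior_subset_cube

theorem norm_integral_cube_le {E : Type*} [NormedAddCommGroup E] [NormedSpace ℝ E] {m : ℕ}
    {g : (Fin m → ℝ) → E} {B : ℝ} (h : ∀ t ∈ cube m, ‖g t‖ ≤ B) : ‖∫ t in cube m, g t‖ ≤ B := by
  have := norm_setIntegral_le_of_norm_le_const (μ := volume)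
    (isCompact_cube m).measure_lt_top h
  rwa [volume_cube, mul_one] at this

/-- The inclusion of the `i`-th parameter direction. -/
noncomputable def paramDir {N m : ℕ} (i : Fin N) : ℂ →L[ℝ] (Fin N → ℂ) × (Fin m → ℝ) :=
  (ContinuousLinearMap.inl ℝ (Fin N → ℂ) (Fin m → ℝ)).comp
    (ContinuousLinearMap.pi (Pi.single i (ContinuousLinearMap.id ℝ ℂ)))

theorem paramDir_apply {N m : ℕ} (i : Fin N) (v : ℂ) :
    (paramDir i v : (Fin N → ℂ) × (Fin m → ℝ)) = (Pi.single i v, 0) := by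
  simp only [paramDir, ContinuousLinearMap.comp_apply, ContinuousLinearMap.inl_apply]
  congr 1
  ext j
  by_cases h : j = i
  · subst h; simp
  · simp [h]

theorem continuousOn_slice {E : Type*} [TopologicalSpace E] {N m : ℕ} {z : Fin N → ℂ}
    {f : (Fin N → ℂ) × (Fin m → ℝ) → E} (h : ∀ t ∈ cube m, ContinuousAt f (z, t)) :
    ContinuousOn (fun t => f (z, t)) (cube m) := fun t ht =>
  (ContinuousAt.comp (g := f) (f := fun t : Fin m → ℝ => (z, t)) (h t ht)
    (by fun_prop)).continuousWithinAt

/-- Differentiation of a series of integrals over cubes in a parameter. -/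
theorem hasDerivAt_tsum_integral {ι : Type*} {N m : ℕ} {U : Set (Fin N → ℂ)} (hU : IsOpen U)
    {c : ι → ℂ} {g : ι → (Fin N → ℂ) × (Fin m → ℝ) → ℂ}
    (hg : ∀ n, ∀ z ∈ U, ∀ t ∈ cube m, ContDiffAt ℝ 1 (g n) (z, t)) {z : Fin N → ℂ} (hz : z ∈ U)
    {W : Set (Fin N → ℂ)} (hW : W ∈ 𝓝 z) {B : ι → ℝ} (hB : Summable B)
    (hB0 : ∀ n, ∀ y ∈ W ∩ U, ∀ t ∈ cube m, ‖c n‖ * ‖g n (y, t)‖ ≤ B n)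
    (hB1 : ∀ n, ∀ y ∈ W ∩ U, ∀ t ∈ cube m, ‖c n‖ * ‖fderiv ℝ (g n) (y, t)‖ ≤ B n)
    (i : Fin N) {D : ℂ}
    (hD : ∀ v : ℂ, ∑' n, c n * ∫ t in cube m, fderiv ℝ (g n) (z, t) (Pi.single i v, 0) = D * v) :
    HasDerivAt (fun ζ => ∑' n, c n * ∫ t in cube m, g n (Function.update z i ζ, t)) D (z i) := by
  set J : ℂ →L[ℝ] (Fin N → ℂ) × (Fin m → ℝ) := paramDir i with hJ
  have hcont : Continuous fun ζ : ℂ => Function.update z i ζ := by fun_prop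
  have hnear : ∀ᶠ ζ in 𝓝 (z i), Function.update z i ζ ∈ W ∩ U := by
    refine hcont.continuousAt.eventually_mem ?_
    rw [Function.update_eq_self]
    exact Filter.inter_mem hW (hU.mem_nhds hz)
  obtain ⟨r, hr, hball⟩ := Metric.eventually_nhds_iff_ball.1 hnear
  have hcurve : ∀ (ζ : ℂ) (t : Fin m → ℝ),
      HasFDerivAt (fun ζ : ℂ => (Function.update z i ζ, t)) J ζ := by
    intro ζ t
    exact (hasFDerivAt_prodMk_left (𝕜 := ℝ) _ t).comp ζ (hasFDerivAt_update (𝕜 := ℝ) z ζ)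
  have hterm : ∀ n, ∀ ζ ∈ Metric.ball (z i) r,
      HasFDerivAt (fun ζ => ∫ t in cube m, c n * g n (Function.update z i ζ, t))
        (∫ t in cube m, c n • (fderiv ℝ (g n) (Function.update z i ζ, t)).comp J) ζ := by
    intro n ζ hζ
    have hs : Metric.ball (z i) r ∈ 𝓝 ζ := Metric.isOpen_ball.mem_nhds hζ
    have hc : ∀ ξ ∈ Metric.ball (z i) r,
        ContinuousOn (fun t => c n * g n (Function.update z i ξ, t)) (cube m) := fun ξ hξ =>
      continuousOn_const.mul
        (continuousOn_slice fun t ht => (hg n _ (hball ξ hξ).2 t ht).continuousAt)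
    have hc' : ContinuousOn
        (fun t => c n • (fderiv ℝ (g n) (Function.update z i ζ, t)).comp J) (cube m) :=
      ((continuousOn_slice fun t ht => ((hg n _ (hball ζ hζ).2 t ht).fderiv_right (m := 0)
        (by norm_num)).continuousAt).clm_comp continuousOn_const).const_smul (c n)
    refine hasFDerivAt_integral_of_dominated_of_fderiv_le (𝕜 := ℝ) (bound := fun _ => B n * ‖J‖)
      (F' := fun ζ t => c n • (fderiv ℝ (g n) (Function.update z i ζ, t)).comp J) hs ?_ ?_ ?_ ?_
      ?_ ?_
    · filter_upwards [hs] with ξ hξ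
      exact (hc ξ hξ).aestronglyMeasurable (measurableSet_cube m)
    · exact (hc ζ hζ).integrableOn_compact (isCompact_cube m)
    · exact hc'.aestronglyMeasurable (measurableSet_cube m)
    · rw [ae_restrict_iff' (measurableSet_cube m)]
      refine Filter.Eventually.of_forall fun t ht ξ hξ => ?_
      rw [norm_smul]
      refine (mul_le_mul_of_nonneg_left (ContinuousLinearMap.opNorm_comp_le _ _)
        (norm_nonneg _)).trans ?_
      rw [← mul_assoc]
      exact mul_le_mul_of_nonneg_right (hB1 n _ (hball ξ hξ) t ht) (norm_nonneg _)
    · exact integrableOn_const (isCompact_cube m).measure_lt_top.ne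
    · rw [ae_restrict_iff' (measurableSet_cube m)]
      refine Filter.Eventually.of_forall fun t ht ξ hξ => ?_
      have h1 := ((hg n _ (hball ξ hξ).2 t ht).differentiableAt (by norm_num)).hasFDerivAt
      exact (h1.comp ξ (hcurve ξ t)).const_mul (c n)
  have hbound : ∀ n, ∀ ζ ∈ Metric.ball (z i) r,
      ‖∫ t in cube m, c n • (fderiv ℝ (g n) (Function.update z i ζ, t)).comp J‖ ≤ B n * ‖J‖ := by
    intro n ζ hζ
    refine norm_integral_cube_le fun t ht => ?_
    rw [norm_smul]
    refine (mul_le_mul_of_nonneg_left (ContinuousLinearMap.opNorm_comp_le _ _)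
      (norm_nonneg _)).trans ?_
    rw [← mul_assoc]
    exact mul_le_mul_of_nonneg_right (hB1 n _ (hball ζ hζ) t ht) (norm_nonneg _)
  have hzi : z i ∈ Metric.ball (z i) r := Metric.mem_ball_self hr
  have hself : Function.update z i (z i) = z := Function.update_eq_self i z
  -- Termwise differentiation on a ball: the derivatives are dominated by a summable series, and the
  -- series itself converges at the centre.
  have hsum := hasFDerivAt_tsum_of_isPreconnected (hB.mul_right ‖J‖) Metric.isOpen_ball
    (convex_ball (z i) r).isPreconnected hterm hbound hzi
    (Summable.of_norm_bounded hB fun n => norm_integral_cube_le fun t ht => by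
      rw [norm_mul]; exact hB0 n _ (hball _ hzi) t ht) hzi
  simp only [integral_const_mul] at hsum
  -- By `hD` the real derivative is multiplication by `D`. Being complex linear, it is a complex
  -- derivative.
  have hlin : (ContinuousLinearMap.toSpanSingleton ℂ D).restrictScalars ℝ =
      ∑' n, ∫ t in cube m, c n • (fderiv ℝ (g n) (Function.update z i (z i), t)).comp J := by
    refine ContinuousLinearMap.ext fun v => ?_
    have hs : Summable fun n =>
        ∫ t in cube m, c n • (fderiv ℝ (g n) (Function.update z i (z i), t)).comp J :=
      Summable.of_norm_bounded (hB.mul_right ‖J‖) fun n => hbound n _ hzi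
    have h1 := (ContinuousLinearMap.apply ℝ ℂ v).map_tsum hs
    simp only [ContinuousLinearMap.apply_apply] at h1
    rw [h1, ContinuousLinearMap.coe_restrictScalars', ContinuousLinearMap.toSpanSingleton_apply,
      smul_eq_mul, mul_comm, ← hD v]
    refine tsum_congr fun n => ?_
    rw [ContinuousLinearMap.integral_apply, ← integral_const_mul, hself]
    · simp only [smul_apply, ContinuousLinearMap.comp_apply, smul_eq_mul, hJ, paramDir_apply]
    · refine ContinuousOn.integrableOn_compact (isCompact_cube m) ?_
      rw [hself]
      exact ((continuousOn_slice fun t ht => ((hg n _ hz t ht).fderiv_right (m := 0)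
        (by norm_num)).continuousAt).clm_comp continuousOn_const).const_smul (c n)
  rw [hasDerivAt_iff_hasFDerivAt]
  exact hasFDerivAt_of_restrictScalars ℝ hsum hlin

theorem fderiv_slice {N m : ℕ} {f : (Fin N → ℂ) × (Fin m → ℝ) → ℂ} {z : Fin N → ℂ}
    {t : Fin m → ℝ} (h : DifferentiableAt ℝ f (z, t)) :
    HasFDerivAt (fun t => f (z, t))
      ((fderiv ℝ f (z, t)).comp (ContinuousLinearMap.inr ℝ (Fin N → ℂ) (Fin m → ℝ))) t :=
  h.hasFDerivAt.comp t (hasFDerivAt_prodMk_right z t)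

/-- The divergence theorem on the unit cube. -/
theorem integral_cube_divergence {N m : ℕ} {z : Fin N → ℂ}
    {f : Fin (m + 1) → (Fin N → ℂ) × (Fin (m + 1) → ℝ) → ℂ}
    (hf : ∀ s, ∀ t ∈ cube (m + 1), ContDiffAt ℝ 1 (f s) (z, t)) :
    ∫ t in cube (m + 1), ∑ s, fderiv ℝ (f s) (z, t) (0, Pi.single s 1) =
      ∑ s, ((∫ u in cube m, f s (z, facePoint s true u)) -
        ∫ u in cube m, f s (z, facePoint s false u)) := by
  have key := integral_divergence_of_hasFDerivAt_off_countable (E := ℂ) (n := m) 0 1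
    zero_le_one (fun t s => f s (z, t))
    (fun t => ContinuousLinearMap.pi fun s => (fderiv ℝ (f s) (z, t)).comp
      (ContinuousLinearMap.inr ℝ (Fin N → ℂ) (Fin (m + 1) → ℝ))) ∅ Set.countable_empty
    (continuousOn_pi.2 fun s => continuousOn_slice fun t ht => (hf s t ht).continuousAt)
    (fun t ht => hasFDerivAt_pi.2 fun s =>
      fderiv_slice ((hf s t (interior_subset_cube ht.1)).differentiableAt (by norm_num)))
    ?_
  · simpa [facePoint, cube] using key
  · refine ContinuousOn.integrableOn_compact (isCompact_cube _)
      (continuousOn_finsetSum _ fun s _ => ?_)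
    have h := continuousOn_slice (f := fderiv ℝ (f s)) (z := z) fun t ht =>
      ((hf s t ht).fderiv_right (m := 0) (by norm_num)).continuousAt
    exact (h.clm_comp continuousOn_const).clm_apply continuousOn_const

theorem tsum_integral_eq_zero {Y : Type*} {m : ℕ} {g : Y → (Fin m → ℝ) → ℂ} {B : Y → ℝ}
    (hg : ∀ y, ContinuousOn (g y) (cube m)) (hB : Summable B)
    (hgB : ∀ y, ∀ u ∈ cube m, ‖g y u‖ ≤ B y)
    (h0 : ∀ u ∈ Set.univ.pi fun _ : Fin m => Set.Ioo (0 : ℝ) 1, HasSum (fun y => g y u) 0) :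
    ∑' y, ∫ u in cube m, g y u = 0 := by
  have hB0 : ∀ y, B y = 0 → ∀ u ∈ cube m, g y u = 0 := fun y hy u hu =>
    norm_le_zero_iff.1 (hy ▸ hgB y u hu)
  -- The index type need not be countable. A summable bound has countable support and the terms
  -- vanish off it, so sum and integral may be exchanged there.
  have hcount : Countable (Function.support B) := hB.countable_support.to_subtype
  have hint : ∀ y, IntegrableOn (g y) (cube m) := fun y =>
    (hg y).integrableOn_compact (isCompact_cube m)
  have hsub : ∀ f : Y → ℂ, (∀ y, B y = 0 → f y = 0) → ∑' y : Function.support B, f y = ∑' y, f y :=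
    fun f hf => tsum_subtype_eq_of_support_subset fun y hy hBy => hy (hf y hBy)
  rw [← hsub _ fun y hy => setIntegral_eq_zero_of_forall_eq_zero (hB0 y hy)]
  have hs := (hasSum_integral_of_summable_integral_norm
    (F := fun (y : Function.support B) u => g y u) (μ := volume.restrict (cube m))
    (fun y => hint y) (Summable.of_norm_bounded (hB.subtype _) fun y => by
      refine norm_integral_cube_le fun t ht => ?_
      rw [norm_norm]
      exact hgB y t ht)).tsum_eq
  rw [hs]
  refine integral_eq_zero_of_ae ?_
  filter_upwards [ae_cube_interior m] with u hu
  rw [hsub (fun y => g y u) fun y hy => hB0 y hy u (interior_subset_cube hu)]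
  exact (h0 u hu).tsum_eq

/-- Summability allows regrouping by classes. It is applied to all faces of all cubes, grouped by
equality as singular cubes. -/
theorem tsum_eq_zero_of_classes {Y : Type*} (r : Setoid Y) {Q : Y → ℂ} (hQ : Summable Q)
    (h : ∀ x, ∑' y : {y // r x y}, Q y = 0) : ∑' y, Q y = 0 := by
  have e := (Equiv.sigmaFiberEquiv (Quotient.mk r)).tsum_eq Q
  have hs := (Equiv.sigmaFiberEquiv (Quotient.mk r)).summable_iff.2 hQ
  rw [← e]
  refine hs.tsum_sigma.trans ?_
  refine (tsum_congr fun b => ?_).trans tsum_zero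
  induction b using Quotient.inductionOn with
  | h x =>
    rw [← h x]
    refine (Equiv.subtypeEquivRight fun y => ?_).tsum_eq
      (f := fun y : {y // r x y} => Q y)
    rw [Quotient.eq]
    exact ⟨r.symm, r.symm⟩

end Integrals

/-! ### Differential forms along branched cubes -/

section Cubes

variable {N m : ℕ}

/-- The cube directions. -/
noncomputable def cubeDir (s : Fin m) : (Fin N → ℂ) × (Fin m → ℝ) := (0, Pi.single s 1)

theorem norm_cubeDir_le (s : Fin m) : ‖(cubeDir s : (Fin N → ℂ) × (Fin m → ℝ))‖ ≤ 1 := by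
  rw [cubeDir, Prod.norm_mk, norm_zero, max_eq_right (norm_nonneg _), Pi.norm_single, norm_one]

namespace BranchedCube

/-- The exponent of `A(z,w)` along the cube. -/
noncomputable def expo (σ : BranchedCube N m) (b : ℂ) (lam : ℝ) (k : Fin N → ℤ)
    (x : (Fin N → ℂ) × (Fin m → ℝ)) : ℂ :=
  (lam : ℂ) / b ^ 2 * (∑ p, σ.w x.1 x.2 p) +
    (∑ p, ∑ q ∈ Finset.Ioi p, -(2 / b ^ 2) * σ.logW x.1 x.2 p q) +
    ∑ p, ∑ j, (k j : ℂ) / b ^ 2 * σ.logWZ x.1 x.2 p j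

/-- The branches of `log (w_p - z_{a(p)})` along the cube. -/
def poleLog (σ : BranchedCube N m) (a : Fin m → Fin N) (p : Fin m)
    (x : (Fin N → ℂ) × (Fin m → ℝ)) : ℂ :=
  σ.logWZ x.1 x.2 p (a p)

variable {σ : BranchedCube N m} {b : ℂ} {lam : ℝ} {k : Fin N → ℤ} {U : Set (Fin N → ℂ)}
  {z : Fin N → ℂ} {t : Fin m → ℝ}

theorem A_eq_exp : σ.A b lam k z t = Complex.exp (σ.expo b lam k (z, t)) := by
  simp only [A, masterA, expo, Complex.exp_add, Complex.exp_sum]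

theorem contDiffAt_expo (hσ : σ.IsOn U) (hz : z ∈ U) (ht : t ∈ cube m) :
    ContDiffAt ℝ 2 (σ.expo b lam k) (z, t) := by
  refine ((contDiffAt_const.mul (ContDiffAt.sum fun p _ => hσ.smooth_w z hz t ht p)).add
    (ContDiffAt.sum fun p _ => ContDiffAt.sum fun q hq => contDiffAt_const.mul ?_)).add
    (ContDiffAt.sum fun p _ => ContDiffAt.sum fun j _ => contDiffAt_const.mul ?_)
  · exact hσ.smooth_logW z hz t ht p q (Finset.mem_Ioi.1 hq)
  · exact hσ.smooth_logWZ z hz t ht p j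

theorem contDiffAt_poleLog (hσ : σ.IsOn U) (hz : z ∈ U) (ht : t ∈ cube m) (a : Fin m → Fin N)
    (p : Fin m) : ContDiffAt ℝ 2 (σ.poleLog a p) (z, t) :=
  hσ.smooth_logWZ z hz t ht p (a p)

/-! ### First and second derivatives controlled by `size`. -/

theorem jetNorm_nonneg (f : (Fin N → ℂ) × (Fin m → ℝ) → ℂ) (x : (Fin N → ℂ) × (Fin m → ℝ)) :
    0 ≤ jetNorm f x := add_nonneg (norm_nonneg _) (norm_nonneg _)

theorem norm_fderiv_le_jetNorm (f : (Fin N → ℂ) × (Fin m → ℝ) → ℂ)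
    (x : (Fin N → ℂ) × (Fin m → ℝ)) : ‖fderiv ℝ f x‖ ≤ jetNorm f x := by
  rw [jetNorm, norm_iteratedFDeriv_one]
  exact le_add_of_nonneg_right (norm_nonneg _)

theorem norm_fderiv_fderiv_le_jetNorm (f : (Fin N → ℂ) × (Fin m → ℝ) → ℂ)
    (x : (Fin N → ℂ) × (Fin m → ℝ)) : ‖fderiv ℝ (fderiv ℝ f) x‖ ≤ jetNorm f x := by
  rw [jetNorm, ← norm_iteratedFDeriv_one, norm_iteratedFDeriv_fderiv]
  exact le_add_of_nonneg_left (norm_nonneg _)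

theorem one_le_size (σ : BranchedCube N m) (z : Fin N → ℂ) (t : Fin m → ℝ) : 1 ≤ σ.size z t := by
  rw [size, add_assoc, add_assoc]
  refine le_add_of_nonneg_right (add_nonneg ?_ (add_nonneg ?_ ?_)) <;>
  · repeat' refine Finset.sum_nonneg fun _ _ => ?_
    exact jetNorm_nonneg _ _

theorem jetNorm_poleLog_le (σ : BranchedCube N m) (z : Fin N → ℂ) (t : Fin m → ℝ)
    (a : Fin m → Fin N) (p : Fin m) : jetNorm (σ.poleLog a p) (z, t) ≤ σ.size z t := by
  have h1 : jetNorm (σ.poleLog a p) (z, t) ≤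
      ∑ j, jetNorm (fun x => σ.logWZ x.1 x.2 p j) (z, t) :=
    Finset.single_le_sum (f := fun j => jetNorm (fun x => σ.logWZ x.1 x.2 p j) (z, t))
      (fun _ _ => jetNorm_nonneg _ _) (Finset.mem_univ (a p))
  have h2 : ∑ j, jetNorm (fun x => σ.logWZ x.1 x.2 p j) (z, t) ≤
      ∑ p, ∑ j, jetNorm (fun x => σ.logWZ x.1 x.2 p j) (z, t) :=
    Finset.single_le_sum (f := fun p => ∑ j, jetNorm (fun x => σ.logWZ x.1 x.2 p j) (z, t))
      (fun _ _ => Finset.sum_nonneg fun _ _ => jetNorm_nonneg _ _) (Finset.mem_univ p)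
  have h3 : 0 ≤ ∑ p, jetNorm (fun x => σ.w x.1 x.2 p) (z, t) :=
    Finset.sum_nonneg fun _ _ => jetNorm_nonneg _ _
  have h4 : 0 ≤ ∑ p, ∑ q ∈ Finset.Ioi p, jetNorm (fun x => σ.logW x.1 x.2 p q) (z, t) :=
    Finset.sum_nonneg fun _ _ => Finset.sum_nonneg fun _ _ => jetNorm_nonneg _ _
  rw [size]
  linarith

theorem fderiv_expo (hσ : σ.IsOn U) (hz : z ∈ U) (ht : t ∈ cube m) :
    fderiv ℝ (σ.expo b lam k) (z, t) =
      ((lam : ℂ) / b ^ 2) • (∑ p, fderiv ℝ (fun x => σ.w x.1 x.2 p) (z, t)) +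
      (∑ p, ∑ q ∈ Finset.Ioi p,
        (-(2 / b ^ 2)) • fderiv ℝ (fun x => σ.logW x.1 x.2 p q) (z, t)) +
      ∑ p, ∑ j, ((k j : ℂ) / b ^ 2) • fderiv ℝ (fun x => σ.logWZ x.1 x.2 p j) (z, t) := by
  refine HasFDerivAt.fderiv (((HasFDerivAt.const_mul (HasFDerivAt.fun_sum fun p _ => ?_) _).add
    (HasFDerivAt.fun_sum fun p _ => HasFDerivAt.fun_sum fun q hq =>
      HasFDerivAt.const_mul ?_ _)).add
    (HasFDerivAt.fun_sum fun p _ => HasFDerivAt.fun_sum fun j _ => HasFDerivAt.const_mul ?_ _))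
  · exact ((hσ.smooth_w z hz t ht p).differentiableAt (by norm_num)).hasFDerivAt
  · exact ((hσ.smooth_logW z hz t ht p q (Finset.mem_Ioi.1 hq)).differentiableAt
      (by norm_num)).hasFDerivAt
  · exact ((hσ.smooth_logWZ z hz t ht p j).differentiableAt (by norm_num)).hasFDerivAt

theorem norm_fderiv_expo_le (hσ : σ.IsOn U) (hz : z ∈ U) (ht : t ∈ cube m) :
    ‖fderiv ℝ (σ.expo b lam k) (z, t)‖ ≤
      (‖(lam : ℂ) / b ^ 2‖ + ‖2 / b ^ 2‖ + ∑ j, ‖(k j : ℂ) / b ^ 2‖) * σ.size z t := by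
  -- The exponent is a linear combination of the functions entering `size`, so any number dominating
  -- each coefficient will do.
  set C := ‖(lam : ℂ) / b ^ 2‖ + ‖2 / b ^ 2‖ + ∑ j, ‖(k j : ℂ) / b ^ 2‖ with hC
  have hk0 : 0 ≤ ∑ j, ‖(k j : ℂ) / b ^ 2‖ := Finset.sum_nonneg fun _ _ => norm_nonneg _
  have hl : ‖(lam : ℂ) / b ^ 2‖ ≤ C := by rw [hC]; linarith [norm_nonneg (2 / b ^ 2)]
  have h2 : ‖-(2 / b ^ 2)‖ ≤ C := by
    rw [norm_neg, hC]; linarith [norm_nonneg ((lam : ℂ) / b ^ 2)]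
  have hk : ∀ j, ‖(k j : ℂ) / b ^ 2‖ ≤ C := by
    intro j
    have := Finset.single_le_sum (f := fun j => ‖(k j : ℂ) / b ^ 2‖) (fun _ _ => norm_nonneg _)
      (Finset.mem_univ j)
    rw [hC]
    linarith [norm_nonneg (2 / b ^ 2), norm_nonneg ((lam : ℂ) / b ^ 2)]
  have hC0 : 0 ≤ C := (norm_nonneg _).trans hl
  have hs : ∀ (e : ℂ) (f : (Fin N → ℂ) × (Fin m → ℝ) → ℂ), ‖e‖ ≤ C →
      ‖e • fderiv ℝ f (z, t)‖ ≤ C * jetNorm f (z, t) := fun e f he => by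
    rw [norm_smul]
    exact mul_le_mul he (norm_fderiv_le_jetNorm _ _) (norm_nonneg _) hC0
  have e1 : ‖((lam : ℂ) / b ^ 2) • (∑ p, fderiv ℝ (fun x => σ.w x.1 x.2 p) (z, t))‖ ≤
      C * ∑ p, jetNorm (fun x => σ.w x.1 x.2 p) (z, t) := by
    rw [Finset.smul_sum, Finset.mul_sum]
    exact norm_sum_le_of_le _ fun p _ => hs _ _ hl
  have e2 : ‖∑ p, ∑ q ∈ Finset.Ioi p,
      (-(2 / b ^ 2)) • fderiv ℝ (fun x => σ.logW x.1 x.2 p q) (z, t)‖ ≤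
      C * ∑ p, ∑ q ∈ Finset.Ioi p, jetNorm (fun x => σ.logW x.1 x.2 p q) (z, t) := by
    simp only [Finset.mul_sum]
    exact norm_sum_le_of_le _ fun p _ => norm_sum_le_of_le _ fun q _ => hs _ _ h2
  have e3 : ‖∑ p, ∑ j, ((k j : ℂ) / b ^ 2) • fderiv ℝ (fun x => σ.logWZ x.1 x.2 p j) (z, t)‖ ≤
      C * ∑ p, ∑ j, jetNorm (fun x => σ.logWZ x.1 x.2 p j) (z, t) := by
    simp only [Finset.mul_sum]
    exact norm_sum_le_of_le _ fun p _ => norm_sum_le_of_le _ fun j _ => hs _ _ (hk j)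
  rw [fderiv_expo hσ hz ht, size]
  refine (norm_add₃_le).trans ?_
  rw [mul_add, mul_add, mul_add]
  linarith

/-! The derivatives of the logarithms, over interior points of the cube. -/

theorem fderiv_eq_of_cexp_eventuallyEq {E : Type*} [NormedAddCommGroup E] [NormedSpace ℝ E]
    {f g : E → ℂ} {f' g' : E →L[ℝ] ℂ} {x : E} (hf : HasFDerivAt f f' x) (hg : HasFDerivAt g g' x)
    (h : (fun y => Complex.exp (f y)) =ᶠ[𝓝 x] g) (u : E) : g x * f' u = g' u := by
  have h1 := (hf.cexp.congr_of_eventuallyEq h.symm).unique hg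
  rw [← h1, smul_apply, smul_eq_mul, h.eq_of_nhds]

theorem hasFDerivAt_coord (j : Fin N) (x : (Fin N → ℂ) × (Fin m → ℝ)) :
    HasFDerivAt (fun x : (Fin N → ℂ) × (Fin m → ℝ) => x.1 j)
      ((ContinuousLinearMap.proj (R := ℝ) j).comp
        (ContinuousLinearMap.fst ℝ (Fin N → ℂ) (Fin m → ℝ))) x :=
  ((ContinuousLinearMap.proj (R := ℝ) (φ := fun _ : Fin N => ℂ) j).comp
    (ContinuousLinearMap.fst ℝ (Fin N → ℂ) (Fin m → ℝ))).hasFDerivAt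

theorem eventually_mem_of_interior {m : ℕ} {t : Fin m → ℝ} (hU : IsOpen U) (hz : z ∈ U)
    (ht : t ∈ Set.univ.pi fun _ : Fin m => Set.Ioo (0 : ℝ) 1) :
    ∀ᶠ x in 𝓝 ((z, t) : (Fin N → ℂ) × (Fin m → ℝ)), x.1 ∈ U ∧ x.2 ∈ cube m := by
  rw [nhds_prod_eq]
  exact Filter.prod_mem_prod (hU.mem_nhds hz) (cube_mem_nhds ht)

theorem fderiv_logWZ (hU : IsOpen U) (hσ : σ.IsOn U) (hz : z ∈ U)
    (ht : t ∈ Set.univ.pi fun _ : Fin m => Set.Ioo (0 : ℝ) 1) (p : Fin m) (j : Fin N)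
    (u : (Fin N → ℂ) × (Fin m → ℝ)) :
    (σ.w z t p - z j) * fderiv ℝ (fun x => σ.logWZ x.1 x.2 p j) (z, t) u =
      fderiv ℝ (fun x => σ.w x.1 x.2 p) (z, t) u - u.1 j := by
  have ht' := interior_subset_cube ht
  exact fderiv_eq_of_cexp_eventuallyEq
    ((hσ.smooth_logWZ z hz t ht' p j).differentiableAt (by norm_num)).hasFDerivAt
    (((hσ.smooth_w z hz t ht' p).differentiableAt (by norm_num)).hasFDerivAt.sub
      (hasFDerivAt_coord j _))
    ((eventually_mem_of_interior hU hz ht).mono fun x hx => hσ.exp_logWZ x.1 hx.1 x.2 hx.2 p j) u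

theorem fderiv_logW (hU : IsOpen U) (hσ : σ.IsOn U) (hz : z ∈ U)
    (ht : t ∈ Set.univ.pi fun _ : Fin m => Set.Ioo (0 : ℝ) 1) {p q : Fin m} (hpq : p < q)
    (u : (Fin N → ℂ) × (Fin m → ℝ)) :
    (σ.w z t p - σ.w z t q) * fderiv ℝ (fun x => σ.logW x.1 x.2 p q) (z, t) u =
      fderiv ℝ (fun x => σ.w x.1 x.2 p) (z, t) u -
        fderiv ℝ (fun x => σ.w x.1 x.2 q) (z, t) u := by
  have ht' := interior_subset_cube ht
  exact fderiv_eq_of_cexp_eventuallyEq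
    ((hσ.smooth_logW z hz t ht' p q hpq).differentiableAt (by norm_num)).hasFDerivAt
    (((hσ.smooth_w z hz t ht' p).differentiableAt (by norm_num)).hasFDerivAt.sub
      ((hσ.smooth_w z hz t ht' q).differentiableAt (by norm_num)).hasFDerivAt)
    ((eventually_mem_of_interior hU hz ht).mono
      fun x hx => hσ.exp_logW x.1 hx.1 x.2 hx.2 p q hpq) u

theorem w_ne_z (hσ : σ.IsOn U) (hz : z ∈ U) (ht : t ∈ cube m) (p : Fin m) (j : Fin N) :
    σ.w z t p ≠ z j := by
  rw [← sub_ne_zero, ← hσ.exp_logWZ z hz t ht p j]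
  exact Complex.exp_ne_zero _

theorem w_ne_w (hσ : σ.IsOn U) (hz : z ∈ U) (ht : t ∈ cube m) (p q : Fin m) (hpq : p ≠ q) :
    σ.w z t p ≠ σ.w z t q := by
  rw [← sub_ne_zero]
  rcases lt_or_gt_of_ne hpq with h | h
  · rw [← hσ.exp_logW z hz t ht p q h]
    exact Complex.exp_ne_zero _
  · rw [← neg_sub, ← hσ.exp_logW z hz t ht q p h]
    exact neg_ne_zero.2 (Complex.exp_ne_zero _)

/-- Each pair `p < q` splits into an `x p` part and an `x q` part of the same shape, by symmetry of
`κ`, and the term `q = p` is `0⁻¹ = 0`. This is the gradient of a sum of logarithms over pairs,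
needed both for `A` and for `φ_0`. -/
theorem sum_Ioi_sub_mul_inv {κ : Fin m → Fin m → ℂ} (hκ : ∀ p q, κ p q = κ q p)
    (w x : Fin m → ℂ) :
    ∑ p, ∑ q ∈ Finset.Ioi p, κ p q * ((x p - x q) * (w p - w q)⁻¹) =
      ∑ p, x p * ∑ q, κ p q * (w p - w q)⁻¹ := by
  have h1 : ∀ p, ∑ q ∈ Finset.Ioi p, κ p q * ((x p - x q) * (w p - w q)⁻¹) =
      ∑ q, if p < q then κ p q * ((x p - x q) * (w p - w q)⁻¹) else 0 := by
    intro p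
    rw [← Finset.sum_filter]
    congr 1
    ext q
    simp
  have h2 : ∀ p q, (if p < q then κ p q * ((x p - x q) * (w p - w q)⁻¹) else 0) =
      (if p < q then x p * (κ p q * (w p - w q)⁻¹) else 0) +
        (if p < q then x q * (κ q p * (w q - w p)⁻¹) else 0) := by
    intro p q
    split_ifs
    · rw [← neg_sub (w p) (w q), inv_neg, hκ q p]; ring
    · simp
  simp only [h1, h2, Finset.sum_add_distrib]
  rw [Finset.sum_comm (f := fun p q => if p < q then x q * (κ q p * (w q - w p)⁻¹) else 0),
    ← Finset.sum_add_distrib]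
  refine Finset.sum_congr rfl fun p _ => ?_
  rw [← Finset.sum_add_distrib, Finset.mul_sum]
  refine Finset.sum_congr rfl fun q _ => ?_
  rcases lt_trichotomy p q with h | h | h
  · simp [h, h.not_gt]
  · simp [h]
  · simp [h, h.not_gt]

theorem fderiv_expo_apply (hU : IsOpen U) (hσ : σ.IsOn U) (hz : z ∈ U)
    (ht : t ∈ Set.univ.pi fun _ : Fin m => Set.Ioo (0 : ℝ) 1) (u : (Fin N → ℂ) × (Fin m → ℝ)) :
    fderiv ℝ (σ.expo b lam k) (z, t) u =
      (∑ p, dlogW b lam k z (σ.w z t) p * fderiv ℝ (fun x => σ.w x.1 x.2 p) (z, t) u) -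
        ∑ j, u.1 j * ∑ p, (k j : ℂ) / b ^ 2 * (σ.w z t p - z j)⁻¹ := by
  have ht' := interior_subset_cube ht
  have h1 : ∀ p j, fderiv ℝ (fun x => σ.logWZ x.1 x.2 p j) (z, t) u =
      (fderiv ℝ (fun x => σ.w x.1 x.2 p) (z, t) u - u.1 j) * (σ.w z t p - z j)⁻¹ := by
    intro p j
    rw [← fderiv_logWZ hU hσ hz ht p j u, mul_right_comm,
      mul_inv_cancel₀ (sub_ne_zero.2 (w_ne_z hσ hz ht' p j)), one_mul]
  have h2 : ∀ p, ∑ q ∈ Finset.Ioi p,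
      -(2 / b ^ 2) * fderiv ℝ (fun x => σ.logW x.1 x.2 p q) (z, t) u =
      ∑ q ∈ Finset.Ioi p, -(2 / b ^ 2) * ((fderiv ℝ (fun x => σ.w x.1 x.2 p) (z, t) u -
        fderiv ℝ (fun x => σ.w x.1 x.2 q) (z, t) u) * (σ.w z t p - σ.w z t q)⁻¹) := by
    intro p
    refine Finset.sum_congr rfl fun q hq => ?_
    have hpq := Finset.mem_Ioi.1 hq
    rw [← fderiv_logW hU hσ hz ht hpq u, mul_right_comm (_ - _),
      mul_inv_cancel₀ (sub_ne_zero.2 (w_ne_w hσ hz ht' p q hpq.ne)), one_mul]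
  rw [fderiv_expo hσ hz ht']
  simp only [add_apply, smul_apply, sum_apply, smul_eq_mul, h1, h2]
  rw [sum_Ioi_sub_mul_inv (κ := fun _ _ => -(2 / b ^ 2)) fun _ _ => rfl]
  have h3 : ∑ p, ∑ j, (k j : ℂ) / b ^ 2 *
      ((fderiv ℝ (fun x => σ.w x.1 x.2 p) (z, t) u - u.1 j) * (σ.w z t p - z j)⁻¹) =
      (∑ p, (∑ j, (k j : ℂ) / b ^ 2 * (σ.w z t p - z j)⁻¹) *
        fderiv ℝ (fun x => σ.w x.1 x.2 p) (z, t) u) -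
        ∑ j, u.1 j * ∑ p, (k j : ℂ) / b ^ 2 * (σ.w z t p - z j)⁻¹ := by
    simp only [Finset.sum_mul, Finset.mul_sum]
    rw [Finset.sum_comm (s := (Finset.univ : Finset (Fin N)))]
    simp only [← Finset.sum_sub_distrib]
    exact Finset.sum_congr rfl fun p _ => Finset.sum_congr rfl fun j _ => by ring
  rw [h3]
  simp only [dlogW, add_mul, sub_mul, Finset.sum_add_distrib, Finset.sum_sub_distrib]
  have h4 : ∑ p, fderiv ℝ (fun x => σ.w x.1 x.2 p) (z, t) u *
      ∑ q, -(2 / b ^ 2) * (σ.w z t p - σ.w z t q)⁻¹ =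
      -∑ p, 2 / b ^ 2 * (∑ q, (σ.w z t p - σ.w z t q)⁻¹) *
        fderiv ℝ (fun x => σ.w x.1 x.2 p) (z, t) u := by
    rw [← Finset.sum_neg_distrib]
    exact Finset.sum_congr rfl fun p _ => by rw [← Finset.mul_sum]; ring
  rw [h4, ← Finset.mul_sum]
  ring

/-- The equation of `e^E dL_1 ∧ ... ∧ dL_m` over interior points. -/
theorem fderiv_density_apply (hU : IsOpen U) (hσ : σ.IsOn U) (hz : z ∈ U)
    (ht : t ∈ Set.univ.pi fun _ : Fin m => Set.Ioo (0 : ℝ) 1) (a : Fin m → Fin N) (i : Fin N)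
    (v : ℂ) :
    fderiv ℝ (density (σ.expo b lam k) (σ.poleLog a) cubeDir) (z, t) (Pi.single i v, 0) =
      (∑ s, fderiv ℝ (flux (σ.expo b lam k) (σ.poleLog a) cubeDir (Pi.single i v, 0) s) (z, t)
        (0, Pi.single s 1)) +
      v * dlogZ b lam k z (σ.w z t) i a *
        density (σ.expo b lam k) (σ.poleLog a) cubeDir (z, t) := by
  have ht' := interior_subset_cube ht
  have hD := sum_fderiv_flux (ε := cubeDir)
    ((contDiffAt_expo (b := b) (lam := lam) (k := k) hσ hz ht').differentiableAt (by norm_num))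
    (contDiffAt_poleLog hσ hz ht' a) (Pi.single i v, 0)
  have hw : ∀ p (u : (Fin N → ℂ) × (Fin m → ℝ)), fderiv ℝ (fun x => σ.w x.1 x.2 p) (z, t) u =
      (σ.w z t p - z (a p)) * fderiv ℝ (σ.poleLog a p) (z, t) u + u.1 (a p) := by
    intro p u
    have : (σ.w z t p - z (a p)) * fderiv ℝ (σ.poleLog a p) (z, t) u = _ :=
      fderiv_logWZ hU hσ hz ht p (a p) u
    rw [this, sub_add_cancel]
  -- Substituting `dw_p = (w_p - z_{a(p)}) dL_p + dz_{a(p)}` in `dE` gives the coefficients of the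
  -- `dL_p`. The cube directions have no `dz` part, and the direction of `z_i` leaves the remainder
  -- `v * dlogZ`.
  have hC := cramer_bordered (frame (σ.poleLog a) cubeDir (z, t))
    (fun p => fderiv ℝ (σ.poleLog a p) (z, t) (Pi.single i v, 0))
    (fun p => dlogW b lam k z (σ.w z t) p * (σ.w z t p - z (a p)))
    (fun s => fderiv ℝ (σ.expo b lam k) (z, t) (cubeDir s))
    (fderiv ℝ (σ.expo b lam k) (z, t) (Pi.single i v, 0))
    (v * dlogZ b lam k z (σ.w z t) i a) ?_ ?_
  · rw [hC] at hD
    simp only [cubeDir] at hD ⊢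
    rw [hD, density]
    ring
  · intro s
    rw [fderiv_expo_apply hU hσ hz ht]
    simp only [hw, cubeDir, Pi.zero_apply, zero_mul, Finset.sum_const_zero, sub_zero, add_zero,
      frame, Matrix.of_apply, mul_assoc]
  · rw [fderiv_expo_apply hU hσ hz ht]
    have h1 : ∑ j, (Pi.single i v : Fin N → ℂ) j *
        ∑ p, (k j : ℂ) / b ^ 2 * (σ.w z t p - z j)⁻¹ =
        v * ∑ p, (k i : ℂ) / b ^ 2 * (σ.w z t p - z i)⁻¹ := by
      rw [Finset.sum_eq_single i]
      · simp
      · intro j _ hj; simp [hj]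
      · simp
    have h2 : ∑ p, dlogW b lam k z (σ.w z t) p * (Pi.single i v : Fin N → ℂ) (a p) =
        v * ∑ p, if a p = i then dlogW b lam k z (σ.w z t) p else 0 := by
      rw [Finset.mul_sum]
      refine Finset.sum_congr rfl fun p _ => ?_
      by_cases h : a p = i
      · simp [h, mul_comm]
      · simp [h]
    rw [dlogZ, mul_sub, ← add_sub_assoc]
    simp only [hw, mul_add, Finset.sum_add_distrib, h1, h2, mul_assoc]

theorem jacobian_eq (hσ : σ.IsOn U) (hz : z ∈ U) (ht : t ∈ cube m) :
    σ.jacobian z t = (Matrix.of fun p s : Fin m =>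
      fderiv ℝ (fun x => σ.w x.1 x.2 p) (z, t) (0, Pi.single s 1)).det := by
  rw [jacobian]
  congr 2
  ext p s
  rw [(fderiv_slice ((hσ.smooth_w z hz t ht p).differentiableAt (by norm_num))).fderiv]
  simp

/-- On a fibre `dL_p = dw_p / (w_p - z_{a(p)})`, and the inverse factors come out of the rows of the
determinant. -/
theorem density_eq (hU : IsOpen U) (hσ : σ.IsOn U) (hz : z ∈ U)
    (ht : t ∈ Set.univ.pi fun _ : Fin m => Set.Ioo (0 : ℝ) 1) (a : Fin m → Fin N) :
    density (σ.expo b lam k) (σ.poleLog a) cubeDir (z, t) =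
      σ.A b lam k z t * pole z (σ.w z t) a * σ.jacobian z t := by
  have ht' := interior_subset_cube ht
  rw [density, A_eq_exp, jacobian_eq hσ hz ht', pole, mul_assoc, ← Matrix.det_mul_column]
  congr 2
  ext p s
  simp only [frame, Matrix.of_apply, cubeDir]
  have := fderiv_logWZ hU hσ hz ht p (a p) (0, Pi.single s 1)
  simp only [Pi.zero_apply, sub_zero] at this
  rw [← this, ← mul_assoc, inv_mul_cancel₀ (sub_ne_zero.2 (w_ne_z hσ hz ht' p (a p))), one_mul]
  rfl

end BranchedCube

end Cubes

/-! ### Faces -/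

section FaceForms

variable {N m : ℕ}

/-- The linear part of the inclusion of a face. -/
noncomputable def faceLin (s : Fin (m + 1)) : (Fin m → ℝ) →L[ℝ] (Fin (m + 1) → ℝ) :=
  ContinuousLinearMap.pi
    (s.insertNth (α := fun _ => (Fin m → ℝ) →L[ℝ] ℝ) 0 fun r => ContinuousLinearMap.proj r)

theorem faceLin_single (s : Fin (m + 1)) (r : Fin m) :
    faceLin s (Pi.single r 1) = Pi.single (s.succAbove r) 1 := by
  ext j
  refine Fin.succAboveCases s ?_ (fun q => ?_) j
  · simp [faceLin]
  · simp only [faceLin, ContinuousLinearMap.pi_apply, Fin.insertNth_apply_succAbove,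
      ContinuousLinearMap.proj_apply]
    by_cases h : q = r
    · subst h; simp
    · rw [Pi.single_eq_of_ne h, Pi.single_eq_of_ne]
      exact fun h' => h (Fin.succAbove_right_injective h')

theorem hasFDerivAt_facePoint (s : Fin (m + 1)) (e : Bool) (u : Fin m → ℝ) :
    HasFDerivAt (facePoint s e) (faceLin s) u := by
  refine hasFDerivAt_pi'.2 fun j => ?_
  refine Fin.succAboveCases s ?_ (fun q => ?_) j
  · have : (ContinuousLinearMap.proj s).comp (faceLin s) = (0 : (Fin m → ℝ) →L[ℝ] ℝ) := by
      ext r; simp [faceLin]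
    rw [this]
    simpa [facePoint] using hasFDerivAt_const (𝕜 := ℝ) (if e then (1 : ℝ) else 0) u
  · have : (ContinuousLinearMap.proj (s.succAbove q)).comp (faceLin s) =
        (ContinuousLinearMap.proj q : (Fin m → ℝ) →L[ℝ] ℝ) := by
      ext r; simp [faceLin]
    rw [this]
    simp only [facePoint, Fin.insertNth_apply_succAbove]
    exact hasFDerivAt_apply q u

theorem hasFDerivAt_faceMap (s : Fin (m + 1)) (e : Bool) (z : Fin N → ℂ) (u : Fin m → ℝ) :
    HasFDerivAt (fun x : (Fin N → ℂ) × (Fin m → ℝ) => (x.1, facePoint s e x.2))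
      ((ContinuousLinearMap.fst ℝ (Fin N → ℂ) (Fin m → ℝ)).prod
        ((faceLin s).comp (ContinuousLinearMap.snd ℝ (Fin N → ℂ) (Fin m → ℝ)))) (z, u) :=
  hasFDerivAt_fst.prodMk ((hasFDerivAt_facePoint s e u).comp (z, u) hasFDerivAt_snd)

theorem facePoint_mem_cube (s : Fin (m + 1)) (e : Bool) {u : Fin m → ℝ} (hu : u ∈ cube m) :
    facePoint s e u ∈ cube (m + 1) := by
  have h : ∀ j, 0 ≤ facePoint s e u j ∧ facePoint s e u j ≤ 1 := by
    intro j
    refine Fin.succAboveCases s ?_ (fun q => ?_) j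
    · cases e <;> simp [facePoint]
    · simpa [facePoint] using ⟨hu.1 q, hu.2 q⟩
  exact ⟨fun j => (h j).1, fun j => (h j).2⟩

/-- The form `dL_1 ∧ ... ∧ dL_{m+1}` on a face, with `L_p = log (f_p - z_{a(p)})` and the direction
`v` inserted in the first place. -/
noncomputable def faceForm (f : (Fin N → ℂ) × (Fin m → ℝ) → Fin (m + 1) → ℂ)
    (a : Fin (m + 1) → Fin N) (v : Fin N → ℂ) (x : (Fin N → ℂ) × (Fin m → ℝ)) : ℂ :=
  ∑ p : Fin (m + 1), (-1) ^ (p : ℕ) *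
    ((fderiv ℝ (fun y => f y p) x (v, 0) - v (a p)) * (f x p - x.1 (a p))⁻¹) *
    (Matrix.of fun q r : Fin m => fderiv ℝ (fun y => f y (p.succAbove q)) x (0, Pi.single r 1) *
      (f x (p.succAbove q) - x.1 (a (p.succAbove q)))⁻¹).det

theorem faceForm_congr {f g : (Fin N → ℂ) × (Fin m → ℝ) → Fin (m + 1) → ℂ}
    {x : (Fin N → ℂ) × (Fin m → ℝ)} (h : f =ᶠ[𝓝 x] g) (a : Fin (m + 1) → Fin N)
    (v : Fin N → ℂ) : faceForm f a v x = faceForm g a v x := by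
  have h1 : ∀ p, fderiv ℝ (fun y => f y p) x = fderiv ℝ (fun y => g y p) x := fun p =>
    Filter.EventuallyEq.fderiv_eq (h.mono fun y hy => by simp only [hy])
  simp only [faceForm, h1, h.eq_of_nhds]

theorem faceForm_eq_zero {f : (Fin N → ℂ) × (Fin m → ℝ) → Fin (m + 1) → ℂ}
    {x : (Fin N → ℂ) × (Fin m → ℝ)} (r : Fin m)
    (h : ∀ p, fderiv ℝ (fun y => f y p) x (0, Pi.single r 1) = 0) (a : Fin (m + 1) → Fin N)
    (v : Fin N → ℂ) : faceForm f a v x = 0 := by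
  refine Finset.sum_eq_zero fun p _ => ?_
  rw [Matrix.det_eq_zero_of_column_eq_zero r, mul_zero]
  intro q
  simp only [Matrix.of_apply, h, zero_mul]

theorem fderiv_apply_eq_zero_of_line {E : Type*} [NormedAddCommGroup E] [NormedSpace ℝ E]
    {f : E → ℂ} {x d : E} (hf : DifferentiableAt ℝ f x)
    (h : ∀ᶠ c : ℝ in 𝓝 0, f (x + c • d) = f x) : fderiv ℝ f x d = 0 := by
  have h1 : HasDerivAt (fun c : ℝ => f (x + c • d)) (fderiv ℝ f x d) 0 := by
    have hf' : HasFDerivAt f (fderiv ℝ f x) (x + (0 : ℝ) • d) := by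
      simpa using hf.hasFDerivAt
    have hl : HasDerivAt (fun c : ℝ => x + c • d) d 0 := by
      simpa using ((hasDerivAt_id (0 : ℝ)).smul_const d).const_add x
    exact hf'.comp_hasDerivAt (0 : ℝ) hl
  exact h1.unique ((hasDerivAt_const (0 : ℝ) (f x)).congr_of_eventuallyEq h)

namespace BranchedCube

variable {σ : BranchedCube N (m + 1)} {b : ℂ} {lam : ℝ} {k : Fin N → ℤ} {U : Set (Fin N → ℂ)}
  {z : Fin N → ℂ} {u : Fin m → ℝ}

theorem differentiableAt_face (hσ : σ.IsOn U) (hz : z ∈ U) (hu : u ∈ cube m) (s : Fin (m + 1))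
    (e : Bool) (p : Fin (m + 1)) : DifferentiableAt ℝ
      (fun x : (Fin N → ℂ) × (Fin m → ℝ) => σ.w x.1 (facePoint s e x.2) p) (z, u) :=
  DifferentiableAt.comp (g := fun x : (Fin N → ℂ) × (Fin (m + 1) → ℝ) => σ.w x.1 x.2 p)
    (f := fun x : (Fin N → ℂ) × (Fin m → ℝ) => (x.1, facePoint s e x.2)) (z, u)
    ((hσ.smooth_w z hz _ (facePoint_mem_cube s e hu) p).differentiableAt (by norm_num))
    (hasFDerivAt_faceMap s e z u).differentiableAt

/-- A face point is not interior to the cube, so `exp L = w - z` is differentiated along the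
inclusion of the face, at an interior point of the face. Only directions in `z` and tangent to the
face are reached. -/
theorem fderiv_poleLog_face (hU : IsOpen U) (hσ : σ.IsOn U) (hz : z ∈ U)
    (hu : u ∈ Set.univ.pi fun _ : Fin m => Set.Ioo (0 : ℝ) 1) (a : Fin (m + 1) → Fin N)
    (s : Fin (m + 1)) (e : Bool) (p : Fin (m + 1)) (d : (Fin N → ℂ) × (Fin m → ℝ)) :
    fderiv ℝ (σ.poleLog a p) (z, facePoint s e u) (d.1, faceLin s d.2) =
      (fderiv ℝ (fun x : (Fin N → ℂ) × (Fin m → ℝ) => σ.w x.1 (facePoint s e x.2) p) (z, u) d -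
        d.1 (a p)) * (σ.w z (facePoint s e u) p - z (a p))⁻¹ := by
  have hu' := interior_subset_cube hu
  have hf := facePoint_mem_cube s e hu'
  have h1 := ((contDiffAt_poleLog hσ hz hf a p).differentiableAt (by norm_num)).hasFDerivAt.comp
    (z, u) (hasFDerivAt_faceMap s e z u)
  have h2 := fderiv_eq_of_cexp_eventuallyEq h1
    ((differentiableAt_face hσ hz hu' s e p).hasFDerivAt.sub (hasFDerivAt_coord (a p) _))
    ((eventually_mem_of_interior hU hz hu).mono fun x hx =>
      hσ.exp_logWZ x.1 hx.1 _ (facePoint_mem_cube s e hx.2) p (a p)) d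
  have h3 : (σ.w z (facePoint s e u) p - z (a p)) *
      fderiv ℝ (σ.poleLog a p) (z, facePoint s e u) (d.1, faceLin s d.2) =
      fderiv ℝ (fun x : (Fin N → ℂ) × (Fin m → ℝ) => σ.w x.1 (facePoint s e x.2) p) (z, u) d -
        d.1 (a p) := h2
  rw [← h3, mul_right_comm, mul_inv_cancel₀ (sub_ne_zero.2 (w_ne_z hσ hz hf p (a p))), one_mul]

/-- Expanding along column `s`, which holds `v`, leaves only derivatives tangent to the face. Thus
the flux is determined by the face as a map and the branch of `A`, the data compared in the cycle
condition. The sign `(-1)^s` of the expansion is the incidence sign. -/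
theorem flux_face (hU : IsOpen U) (hσ : σ.IsOn U) (hz : z ∈ U)
    (hu : u ∈ Set.univ.pi fun _ : Fin m => Set.Ioo (0 : ℝ) 1) (a : Fin (m + 1) → Fin N)
    (v : Fin N → ℂ) (s : Fin (m + 1)) (e : Bool) :
    flux (σ.expo b lam k) (σ.poleLog a) cubeDir (v, 0) s (z, facePoint s e u) =
      (-1) ^ (s : ℕ) * σ.A b lam k z (facePoint s e u) *
        faceForm (fun x => σ.w x.1 (facePoint s e x.2)) a v (z, u) := by
  have hv : ∀ p, fderiv ℝ (σ.poleLog a p) (z, facePoint s e u) (v, 0) =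
      (fderiv ℝ (fun x : (Fin N → ℂ) × (Fin m → ℝ) => σ.w x.1 (facePoint s e x.2) p) (z, u)
        (v, 0) - v (a p)) * (σ.w z (facePoint s e u) p - z (a p))⁻¹ := fun p => by
    simpa using fderiv_poleLog_face hU hσ hz hu a s e p (v, 0)
  have hr : ∀ p r, fderiv ℝ (σ.poleLog a p) (z, facePoint s e u) (cubeDir (s.succAbove r)) =
      fderiv ℝ (fun x : (Fin N → ℂ) × (Fin m → ℝ) => σ.w x.1 (facePoint s e x.2) p) (z, u)
        (0, Pi.single r 1) * (σ.w z (facePoint s e u) p - z (a p))⁻¹ := fun p r => by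
    simpa [faceLin_single, cubeDir] using
      fderiv_poleLog_face hU hσ hz hu a s e p (0, Pi.single r 1)
  rw [flux, ← A_eq_exp, Matrix.det_succ_column _ s, mul_comm ((-1) ^ (s : ℕ)), mul_assoc, faceForm,
    Finset.mul_sum, Finset.mul_sum, Finset.mul_sum]
  refine Finset.sum_congr rfl fun p _ => ?_
  rw [Matrix.updateCol_self, hv, pow_add]
  have hm : ((frame (σ.poleLog a) cubeDir (z, facePoint s e u)).updateCol s fun p =>
      fderiv ℝ (σ.poleLog a p) (z, facePoint s e u) (v, 0)).submatrix p.succAbove s.succAbove =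
      Matrix.of fun q r : Fin m => fderiv ℝ (fun x : (Fin N → ℂ) × (Fin m → ℝ) =>
        σ.w x.1 (facePoint s e x.2) (p.succAbove q)) (z, u) (0, Pi.single r 1) *
      (σ.w z (facePoint s e u) (p.succAbove q) - z (a (p.succAbove q)))⁻¹ := by
    ext q r
    rw [Matrix.submatrix_apply, Matrix.updateCol_ne (Fin.succAbove_ne s r)]
    exact hr _ _
  rw [hm]
  ring

end BranchedCube

end FaceForms

/-! ### Stokes' theorem for twisted cycles of rapid decay -/

section Stokes

open MeasureTheory

variable {N m : ℕ} {ι : Type*} {b : ℂ} {lam : ℝ} {k : Fin N → ℤ} {U : Set (Fin N → ℂ)} {c : ι → ℂ}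

theorem sameFace_equivalence (σ : ι → BranchedCube N (m + 1)) (U : Set (Fin N → ℂ)) :
    Equivalence (SameFace σ U) :=
  ⟨fun _ _ _ _ _ => rfl, fun h z hz u hu => (h z hz u hu).symm,
    fun h h' z hz u hu => (h' z hz u hu).trans (h z hz u hu)⟩

theorem faceForm_sameFace {σ : ι → BranchedCube N (m + 1)} (hU : IsOpen U)
    {x y : ι × Fin (m + 1) × Bool} (h : SameFace σ U x y) {z : Fin N → ℂ} (hz : z ∈ U)
    {u : Fin m → ℝ} (hu : u ∈ Set.univ.pi fun _ : Fin m => Set.Ioo (0 : ℝ) 1)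
    (a : Fin (m + 1) → Fin N) (v : Fin N → ℂ) :
    faceForm (fun p => face σ y p.1 p.2) a v (z, u) =
      faceForm (fun p => face σ x p.1 p.2) a v (z, u) :=
  faceForm_congr ((BranchedCube.eventually_mem_of_interior hU hz hu).mono
    fun p hp => h p.1 hp.1 p.2 hp.2) a v

theorem faceForm_degenerate {σ : ι → BranchedCube N (m + 1)} (hU : IsOpen U)
    (hσ : ∀ n, (σ n).IsOn U) {x : ι × Fin (m + 1) × Bool} (h : DegenerateFace σ U x)
    {z : Fin N → ℂ} (hz : z ∈ U)
    {u : Fin m → ℝ} (hu : u ∈ Set.univ.pi fun _ : Fin m => Set.Ioo (0 : ℝ) 1)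
    (a : Fin (m + 1) → Fin N) (v : Fin N → ℂ) :
    faceForm (fun p => face σ x p.1 p.2) a v (z, u) = 0 := by
  obtain ⟨r, hr⟩ := h
  have hu' := interior_subset_cube hu
  refine faceForm_eq_zero r (fun p => ?_) a v
  -- Degeneracy makes the face constant along the `r`-th coordinate, so column `r` of every minor in
  -- `faceForm` vanishes.
  refine fderiv_apply_eq_zero_of_line
    (BranchedCube.differentiableAt_face (hσ x.1) hz hu' x.2.1 x.2.2 p) ?_
  have hcont : ContinuousAt (fun e : ℝ =>
      ((z, u) : (Fin N → ℂ) × (Fin m → ℝ)) + e • (0, Pi.single r 1)) 0 := by fun_prop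
  have hmem := hcont.eventually (p := fun q => q.1 ∈ U ∧ q.2 ∈ cube m) (by
    simpa using BranchedCube.eventually_mem_of_interior hU hz hu)
  refine hmem.mono fun e he => ?_
  have hz' : (((z, u) : (Fin N → ℂ) × (Fin m → ℝ)) + e • (0, Pi.single r 1)).1 = z := by simp
  have := hr z hz _ he.2 u hu' fun s hs => by simp [hs]
  rw [hz']
  exact congrFun this p

theorem summable_fst {Y : Type*} [Finite Y] {B : ι → ℝ} (hB : Summable B) :
    Summable fun y : ι × Y => B y.1 := by
  cases nonempty_fintype Y
  have h : Summable fun y : ι × Y => |B y.1| :=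
    (summable_prod_of_nonneg fun y => abs_nonneg _).2
      ⟨fun n => (hasSum_fintype _).summable, by simpa using hB.abs.mul_left _⟩
  exact summable_abs_iff.1 h

/-- The bound on the flux through the boundary. -/
theorem IsRapidDecayCycle.norm_flux_le {σ : ι → BranchedCube N m}
    {z : Fin N → ℂ} {B : ι → ℝ} (v : (Fin N → ℂ) × (Fin m → ℝ))
    (hB : ∀ n, ∀ t ∈ cube m, ‖c n * (σ n).A b lam k z t‖ * (σ n).size z t ^ m ≤ B n)
    (a : Fin m → Fin N) (n : ι) (s : Fin m) (t : Fin m → ℝ) (ht : t ∈ cube m) :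
    ‖c n‖ * ‖flux ((σ n).expo b lam k) ((σ n).poleLog a) cubeDir v s (z, t)‖ ≤
      m.factorial * (1 + ‖v‖) ^ m * B n := by
  have h := IrregularKZ.norm_flux_le (e := (σ n).expo b lam k) (L := (σ n).poleLog a)
    (ε := cubeDir) (x := (z, t)) norm_cubeDir_le
    (zero_le_one.trans ((σ n).one_le_size z t)) (fun p =>
      (BranchedCube.norm_fderiv_le_jetNorm _ _).trans ((σ n).jetNorm_poleLog_le z t a p)) v s
  have hn := hB n t ht
  rw [norm_mul, BranchedCube.A_eq_exp] at hn
  calc _ ≤ ‖c n‖ * (m.factorial * (1 + ‖v‖) ^ m *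
        (‖Complex.exp ((σ n).expo b lam k (z, t))‖ * (σ n).size z t ^ m)) :=
        mul_le_mul_of_nonneg_left h (norm_nonneg _)
    _ = m.factorial * (1 + ‖v‖) ^ m *
        (‖c n‖ * ‖Complex.exp ((σ n).expo b lam k (z, t))‖ * (σ n).size z t ^ m) := by ring
    _ ≤ _ := by gcongr

/-- Stokes' theorem: the divergence theorem on each cube leaves a family of face integrals, summable
by decay. Within a class of equal faces `faceForm` is a common factor; it vanishes for a degenerate
class, and otherwise the signed branches of `A` sum to zero. -/
theorem IsRapidDecayCycle.hasSum_divergence (hU : IsOpen U) {z : Fin N → ℂ} (hz : z ∈ U)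
    (v : Fin N → ℂ) : ∀ {m : ℕ} {σ : ι → BranchedCube N m},
    IsRapidDecayCycle b lam k U c σ → ∀ a : Fin m → Fin N,
    HasSum (fun n => c n * ∫ t in cube m, ∑ s, fderiv ℝ
      (flux ((σ n).expo b lam k) ((σ n).poleLog a) cubeDir (v, 0) s) (z, t) (0, Pi.single s 1)) 0
  | 0, σ, _, a => by simp
  | m + 1, σ, hΓ, a => by
    obtain ⟨W, hW, B, hBs, hB⟩ := hΓ.decay (m + 1) z hz
    have hzW : z ∈ W ∩ U := ⟨mem_of_mem_nhds hW, hz⟩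
    set C : ℝ := (m + 1).factorial *
      (1 + ‖((v, 0) : (Fin N → ℂ) × (Fin (m + 1) → ℝ))‖) ^ (m + 1) with hC
    set sgn : Bool → ℂ := fun e => if e then 1 else -1
    have hsgn : ∀ e, ‖sgn e‖ = 1 := fun e => by cases e <;> simp [sgn]
    set q : ι × Fin (m + 1) × Bool → (Fin m → ℝ) → ℂ := fun y u => sgn y.2.2 * (c y.1 *
      flux ((σ y.1).expo b lam k) ((σ y.1).poleLog a) cubeDir (v, 0) y.2.1
        (z, facePoint y.2.1 y.2.2 u)) with hq
    have hqB : ∀ y, ∀ u ∈ cube m, ‖q y u‖ ≤ C * B y.1 := by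
      intro y u hu
      rw [hq, norm_mul, hsgn, one_mul, norm_mul]
      exact IsRapidDecayCycle.norm_flux_le _ (fun n t ht => hB n z hzW t ht) a y.1 y.2.1 _
        (facePoint_mem_cube _ _ hu)
    have hflux : ∀ n s, ∀ t ∈ cube (m + 1), ContDiffAt ℝ 1
        (flux ((σ n).expo b lam k) ((σ n).poleLog a) cubeDir (v, 0) s) (z, t) := fun n s t ht =>
      contDiffAt_flux (BranchedCube.contDiffAt_expo (hΓ.isOn n) hz ht)
        (BranchedCube.contDiffAt_poleLog (hΓ.isOn n) hz ht a) _ s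
    have hqc : ∀ y, ContinuousOn (q y) (cube m) := fun y =>
      continuousOn_const.mul (continuousOn_const.mul
        ((continuousOn_slice fun t ht => (hflux y.1 y.2.1 t ht).continuousAt).comp
          (fun u _ => (hasFDerivAt_facePoint y.2.1 y.2.2 u).continuousAt.continuousWithinAt)
          fun u hu => facePoint_mem_cube _ _ hu))
    -- The divergence theorem counts the face `t_s = 1` positively, while the incidence sign there
    -- is `(-1)^(s+1)`. The discrepancy is a global minus sign.
    have hqi : ∀ y, ∀ u ∈ Set.univ.pi fun _ : Fin m => Set.Ioo (0 : ℝ) 1,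
        q y u = ((-1 : ℂ) ^ ((y.2.1 : ℕ) + (if y.2.2 then 1 else 0)) * c y.1 *
            (σ y.1).A b lam k z (facePoint y.2.1 y.2.2 u)) *
          -faceForm (fun p => face σ y p.1 p.2) a v (z, u) := by
      intro y u hu
      have := BranchedCube.flux_face (b := b) (lam := lam) (k := k) hU (hΓ.isOn y.1) hz hu a v
        y.2.1 y.2.2
      simp only [hq, sgn, this]
      have hf : faceForm (fun x : (Fin N → ℂ) × (Fin m → ℝ) =>
          (σ y.1).w x.1 (facePoint y.2.1 y.2.2 x.2)) a v (z, u) =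
          faceForm (fun p => face σ y p.1 p.2) a v (z, u) := rfl
      rw [hf, pow_add]
      cases y.2.2 <;> simp <;> ring
    have hBy : Summable fun y : ι × Fin (m + 1) × Bool => C * B y.1 := (summable_fst hBs).mul_left C
    have hQs : Summable fun y => ∫ u in cube m, q y u :=
      Summable.of_norm_bounded hBy fun y => norm_integral_cube_le (hqB y)
    have hQ0 : ∑' y, ∫ u in cube m, q y u = 0 := by
      refine tsum_eq_zero_of_classes ⟨SameFace σ U, sameFace_equivalence σ U⟩ hQs fun x => ?_
      refine tsum_integral_eq_zero (B := fun y => C * B y.1.1) (fun y => hqc y.1)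
        (hBy.subtype _) (fun y => hqB y.1) fun u hu => ?_
      change HasSum (fun y : {y // SameFace σ U x y} => q y.1 u) 0
      by_cases hx : DegenerateFace σ U x
      · have e : (fun y : {y // SameFace σ U x y} => q y.1 u) = fun _ => 0 := funext fun y => by
          rw [hqi _ u hu, faceForm_sameFace hU y.2 hz hu,
            faceForm_degenerate hU hΓ.isOn hx hz hu, neg_zero, mul_zero]
        rw [e]
        exact hasSum_zero
      · have := (hΓ.boundary x hx z hz u (interior_subset_cube hu)).mul_right
          (-faceForm (fun p => face σ x p.1 p.2) a v (z, u))
        rw [zero_mul] at this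
        refine Eq.mpr (congrArg (fun f : {y // SameFace σ U x y} → ℂ => HasSum f 0)
          (funext fun y => ?_)) this
        rw [hqi _ u hu, faceForm_sameFace hU y.2 hz hu]
    have hQ : HasSum (fun y => ∫ u in cube m, q y u) 0 := hQ0 ▸ hQs.hasSum
    convert hQ.prod_fiberwise fun n => hasSum_fintype _ using 1
    funext n
    rw [integral_cube_divergence (hflux n), Fintype.sum_prod_type, Finset.mul_sum]
    refine Finset.sum_congr rfl fun s _ => ?_
    simp only [hq, sgn, Fintype.sum_bool, integral_const_mul]
    simp
    ring

end Stokes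

/-! ### The equation for the integrals -/

section Blocks

open MeasureTheory

variable {N m : ℕ} {ι : Type*} {b : ℂ} {lam : ℝ} {k : Fin N → ℤ} {U : Set (Fin N → ℂ)} {c : ι → ℂ}
  {σ : ι → BranchedCube N m}

/-- The maps which take each value `j` exactly `μ_j` times. -/
def distributions {N : ℕ} (m : ℕ) (μ : Fin N → ℕ) : Finset (Fin m → Fin N) :=
  Finset.univ.filter fun a => count a = μ

/-- The pulled back integrand of `φ^{(μ)}`, written in terms of the logarithms. -/
noncomputable def blockDensity (b : ℂ) (lam : ℝ) (k : Fin N → ℤ) (σ : BranchedCube N m)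
    (μ : Fin N → ℕ) (x : (Fin N → ℂ) × (Fin m → ℝ)) : ℂ :=
  ∑ a ∈ distributions m μ, density (σ.expo b lam k) (σ.poleLog a) cubeDir x

theorem blockDensity_eq (hU : IsOpen U) (hσ : ∀ n, (σ n).IsOn U) {z : Fin N → ℂ} (hz : z ∈ U)
    {t : Fin m → ℝ} (ht : t ∈ Set.univ.pi fun _ : Fin m => Set.Ioo (0 : ℝ) 1) (n : ι)
    (μ : Fin N → ℕ) :
    phiIntegrand b lam k σ μ z n t * (σ n).jacobian z t = blockDensity b lam k (σ n) μ (z, t) := by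
  rw [phiIntegrand, poleSum_eq, ← Finset.sum_filter, blockDensity, Finset.mul_sum, Finset.sum_mul]
  exact Finset.sum_congr rfl fun a _ => (BranchedCube.density_eq hU (hσ n) hz ht a).symm

theorem blockDensity_ae (hU : IsOpen U) (hσ : ∀ n, (σ n).IsOn U) {z : Fin N → ℂ} (hz : z ∈ U)
    (n : ι) (μ : Fin N → ℕ) :
    (fun t => phiIntegrand b lam k σ μ z n t * (σ n).jacobian z t) =ᵐ[volume.restrict (cube m)]
      fun t => blockDensity b lam k (σ n) μ (z, t) :=
  (ae_cube_interior m).mono fun _ ht => blockDensity_eq hU hσ hz ht n μ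

theorem contDiffAt_density_cube (hσ : ∀ n, (σ n).IsOn U) {z : Fin N → ℂ} (hz : z ∈ U)
    {t : Fin m → ℝ} (ht : t ∈ cube m) (n : ι) (a : Fin m → Fin N) :
    ContDiffAt ℝ 1 (density ((σ n).expo b lam k) ((σ n).poleLog a) cubeDir) (z, t) :=
  contDiffAt_density (BranchedCube.contDiffAt_expo (hσ n) hz ht)
    (BranchedCube.contDiffAt_poleLog (hσ n) hz ht a)

theorem contDiffAt_blockDensity (hσ : ∀ n, (σ n).IsOn U) {z : Fin N → ℂ} (hz : z ∈ U)
    {t : Fin m → ℝ} (ht : t ∈ cube m) (n : ι) (μ : Fin N → ℕ) :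
    ContDiffAt ℝ 1 (blockDensity b lam k (σ n) μ) (z, t) :=
  ContDiffAt.sum fun a _ => contDiffAt_density_cube hσ hz ht n a

theorem fderiv_blockDensity (hσ : ∀ n, (σ n).IsOn U) {z : Fin N → ℂ} (hz : z ∈ U)
    {t : Fin m → ℝ} (ht : t ∈ cube m) (n : ι) (μ : Fin N → ℕ) :
    fderiv ℝ (blockDensity b lam k (σ n) μ) (z, t) = ∑ a ∈ distributions m μ,
      fderiv ℝ (density ((σ n).expo b lam k) ((σ n).poleLog a) cubeDir) (z, t) :=
  fderiv_fun_sum fun a _ => (contDiffAt_density_cube hσ hz ht n a).differentiableAt (by norm_num)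

/-- Rapid decay bounds the integrands and their first derivatives. -/
theorem IsRapidDecayCycle.exists_bound (hΓ : IsRapidDecayCycle b lam k U c σ) {z : Fin N → ℂ}
    (hz : z ∈ U) (μ : Fin N → ℕ) : ∃ W ∈ 𝓝 z, ∃ B : ι → ℝ, Summable B ∧
      ∀ n, ∀ y ∈ W ∩ U, ∀ t ∈ cube m, ‖c n‖ * ‖blockDensity b lam k (σ n) μ (y, t)‖ ≤ B n ∧
        ‖c n‖ * ‖fderiv ℝ (blockDensity b lam k (σ n) μ) (y, t)‖ ≤ B n := by
  -- The first derivative of an `m`-fold density needs `m + 1` powers of `size`.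
  obtain ⟨W, hW, B, hBs, hB⟩ := hΓ.decay (m + 1) z hz
  set C := ‖(lam : ℂ) / b ^ 2‖ + ‖2 / b ^ 2‖ + ∑ j, ‖(k j : ℂ) / b ^ 2‖ with hC
  have hC0 : 0 ≤ C := by positivity
  -- One constant serves both bounds: the summand `1` covers the density, `C + m` its derivative.
  set C' : ℝ := (1 + C + m) * m.factorial with hC'
  refine ⟨W, hW, fun n => (distributions m μ).card * (C' * B n),
    (hBs.mul_left _).mul_left _, fun n y hy t ht => ?_⟩
  have hS := (σ n).one_le_size y t
  have hn := hB n y hy t ht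
  rw [norm_mul, BranchedCube.A_eq_exp, mul_assoc] at hn
  set E := ‖Complex.exp ((σ n).expo b lam k (y, t))‖
  have hjet : ∀ (a : Fin m → Fin N) p, BranchedCube.jetNorm ((σ n).poleLog a p) (y, t) ≤
      (σ n).size y t := fun a p => (σ n).jetNorm_poleLog_le y t a p
  have h0 : ∀ a : Fin m → Fin N,
      ‖c n‖ * ‖density ((σ n).expo b lam k) ((σ n).poleLog a) cubeDir (y, t)‖ ≤ C' * B n := by
    intro a
    have h := norm_density_le (e := (σ n).expo b lam k) (L := (σ n).poleLog a) (ε := cubeDir)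
      (x := (y, t)) norm_cubeDir_le
      (fun p => (BranchedCube.norm_fderiv_le_jetNorm _ _).trans (hjet a p))
    have hSm : (σ n).size y t ^ m ≤ (σ n).size y t ^ (m + 1) :=
      pow_le_pow_right₀ hS (Nat.le_succ m)
    calc _ ≤ ‖c n‖ * (m.factorial * (E * (σ n).size y t ^ m)) := by gcongr
      _ ≤ ‖c n‖ * (m.factorial * (E * (σ n).size y t ^ (m + 1))) := by gcongr
      _ = 1 * m.factorial * (‖c n‖ * (E * (σ n).size y t ^ (m + 1))) := by ring
      _ ≤ (1 + C + m) * m.factorial * (‖c n‖ * (E * (σ n).size y t ^ (m + 1))) := by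
        gcongr
        rw [add_assoc]
        exact le_add_of_nonneg_right (by positivity)
      _ ≤ _ := by gcongr
  have h1 : ∀ a : Fin m → Fin N,
      ‖c n‖ * ‖fderiv ℝ (density ((σ n).expo b lam k) ((σ n).poleLog a) cubeDir) (y, t)‖ ≤
        C' * B n := by
    intro a
    have h := norm_fderiv_density_le (ε := cubeDir)
      ((BranchedCube.contDiffAt_expo (b := b) (lam := lam) (k := k) (hΓ.isOn n) hy.2
        ht).differentiableAt (by norm_num))
      (BranchedCube.contDiffAt_poleLog (hΓ.isOn n) hy.2 ht a) norm_cubeDir_le hS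
      (BranchedCube.norm_fderiv_expo_le (hΓ.isOn n) hy.2 ht)
      (fun p => (BranchedCube.norm_fderiv_le_jetNorm _ _).trans (hjet a p))
      (fun p => (BranchedCube.norm_fderiv_fderiv_le_jetNorm _ _).trans (hjet a p))
    calc _ ≤ ‖c n‖ * ((C + m) * m.factorial * (E * (σ n).size y t ^ (m + 1))) := by gcongr
      _ = (C + m) * m.factorial * (‖c n‖ * (E * (σ n).size y t ^ (m + 1))) := by ring
      _ ≤ (1 + C + m) * m.factorial * (‖c n‖ * (E * (σ n).size y t ^ (m + 1))) := by
        gcongr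
        linarith
      _ ≤ _ := by gcongr
  constructor
  · calc _ ≤ ‖c n‖ * ∑ a ∈ distributions m μ,
          ‖density ((σ n).expo b lam k) ((σ n).poleLog a) cubeDir (y, t)‖ :=
          mul_le_mul_of_nonneg_left (norm_sum_le _ _) (norm_nonneg _)
      _ ≤ ∑ a ∈ distributions m μ, C' * B n := by
          rw [Finset.mul_sum]
          exact Finset.sum_le_sum fun a _ => h0 a
      _ = _ := by rw [Finset.sum_const, nsmul_eq_mul]
  · rw [fderiv_blockDensity hΓ.isOn hy.2 ht]
    calc _ ≤ ‖c n‖ * ∑ a ∈ distributions m μ,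
          ‖fderiv ℝ (density ((σ n).expo b lam k) ((σ n).poleLog a) cubeDir) (y, t)‖ :=
          mul_le_mul_of_nonneg_left (norm_sum_le _ _) (norm_nonneg _)
      _ ≤ ∑ a ∈ distributions m μ, C' * B n := by
          rw [Finset.mul_sum]
          exact Finset.sum_le_sum fun a _ => h1 a
      _ = _ := by rw [Finset.sum_const, nsmul_eq_mul]

theorem continuousOn_blockDensity (hσ : ∀ n, (σ n).IsOn U) {z : Fin N → ℂ} (hz : z ∈ U) (n : ι)
    (μ : Fin N → ℕ) : ContinuousOn (fun t => blockDensity b lam k (σ n) μ (z, t)) (cube m) :=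
  continuousOn_slice fun _ ht => (contDiffAt_blockDensity hσ hz ht n μ).continuousAt

theorem IsRapidDecayCycle.cycleIntegrable (hU : IsOpen U) (hΓ : IsRapidDecayCycle b lam k U c σ)
    {z : Fin N → ℂ} (hz : z ∈ U) (μ : Fin N → ℕ) :
    CycleIntegrable c σ z (phiIntegrand b lam k σ μ z) := by
  obtain ⟨W, hW, B, hBs, hB⟩ := hΓ.exists_bound hz μ
  have hzW : z ∈ W ∩ U := ⟨mem_of_mem_nhds hW, hz⟩
  have hae : ∀ n, (fun t => c n * (phiIntegrand b lam k σ μ z n t * (σ n).jacobian z t))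
      =ᵐ[volume.restrict (cube m)] fun t => c n * blockDensity b lam k (σ n) μ (z, t) := fun n =>
    (blockDensity_ae hU hΓ.isOn hz n μ).mono fun t ht => congrArg (c n * ·) ht
  refine ⟨fun n => ?_, Summable.of_norm_bounded hBs fun n => ?_⟩
  · refine Integrable.congr ?_ (hae n).symm
    exact (continuousOn_const.mul (continuousOn_blockDensity hΓ.isOn hz n μ)).integrableOn_compact
      (isCompact_cube m)
  · have h : ∫ t in cube m, ‖c n * (phiIntegrand b lam k σ μ z n t * (σ n).jacobian z t)‖ =
        ∫ t in cube m, ‖c n * blockDensity b lam k (σ n) μ (z, t)‖ :=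
      integral_congr_ae ((hae n).mono fun t ht => congrArg norm ht)
    rw [h]
    refine norm_integral_cube_le fun t ht => ?_
    rw [norm_norm, norm_mul]
    exact (hB n z hzW t ht).1

theorem psiHat_eq (hU : IsOpen U) (hσ : ∀ n, (σ n).IsOn U) {z : Fin N → ℂ} (hz : z ∈ U)
    (μ : HeightIndex N m) : psiHat b lam k c σ z μ =
      ∑' n, c n * ∫ t in cube m, blockDensity b lam k (σ n) μ.1 (z, t) :=
  tsum_congr fun n => by rw [integral_congr_ae (blockDensity_ae hU hσ hz n μ.1)]

/-- The matrix of the equation for the vector of the `φ^{(μ)}`. -/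
noncomputable def hatMatrix (m : ℕ) (lam : ℝ) (k : Fin N → ℤ) (i : Fin N) (z : Fin N → ℂ) :
    Matrix (HeightIndex N m) (HeightIndex N m) ℂ :=
  AMatrix m lam i + ∑ j ∈ Finset.univ.erase i, (z i - z j)⁻¹ • (OmegaHat m k i j).transpose

theorem hatMatrix_mulVec (lam : ℝ) (k : Fin N → ℤ) (i : Fin N) (z : Fin N → ℂ)
    (f : HeightIndex N m → ℂ) : (hatMatrix m lam k i z).mulVec f = (AMatrix m lam i).mulVec f +
      ∑ j ∈ Finset.univ.erase i, (z i - z j)⁻¹ • (OmegaHat m k i j).transpose.mulVec f := by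
  rw [hatMatrix, Matrix.add_mulVec, Matrix.sum_mulVec]
  simp only [Matrix.smul_mulVec]

/-- The differential equation before integration: Cartan's formula for each map `a`, with the sum of
the `dlogZ` terms evaluated by partial fractions and multiplied by `A` and the Jacobian. -/
theorem fderiv_blockDensity_apply (hb : b ≠ 0) (hU : IsOpen U) (hσ : ∀ n, (σ n).IsOn U)
    {z : Fin N → ℂ} (hz : z ∈ U) (hzz : ∀ i j, i ≠ j → z i ≠ z j) {t : Fin m → ℝ}
    (ht : t ∈ Set.univ.pi fun _ : Fin m => Set.Ioo (0 : ℝ) 1) (n : ι) (ν : HeightIndex N m)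
    (i : Fin N) (v : ℂ) :
    fderiv ℝ (blockDensity b lam k (σ n) ν.1) (z, t) (Pi.single i v, 0) =
      (∑ a ∈ distributions m ν.1, ∑ s, fderiv ℝ (flux ((σ n).expo b lam k) ((σ n).poleLog a)
        cubeDir (Pi.single i v, 0) s) (z, t) (0, Pi.single s 1)) +
      ∑ μ : HeightIndex N m, (v * (-b ^ 2)⁻¹ * hatMatrix m lam k i z ν μ) *
        blockDensity b lam k (σ n) μ.1 (z, t) := by
  have ht' := interior_subset_cube ht
  have hb2 : -b ^ 2 ≠ 0 := neg_ne_zero.2 (pow_ne_zero 2 hb)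
  rw [fderiv_blockDensity hσ hz ht', sum_apply, Finset.sum_congr rfl fun a _ =>
    BranchedCube.fderiv_density_apply hU (hσ n) hz ht a i v, Finset.sum_add_distrib]
  congr 1
  have h := sum_dlogZ_mul_pole hb lam k hzz (BranchedCube.w_ne_z (hσ n) hz ht')
    (BranchedCube.w_ne_w (hσ n) hz ht') i ν
  rw [← hatMatrix_mulVec, ← Finset.sum_filter, ← eq_inv_mul_iff_mul_eq₀ hb2] at h
  simp only [← blockDensity_eq hU hσ hz ht, phiIntegrand, BranchedCube.density_eq hU (hσ n) hz ht]
  have h1 : ∑ a ∈ distributions m ν.1, v * dlogZ b lam k z ((σ n).w z t) i a *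
      ((σ n).A b lam k z t * pole z ((σ n).w z t) a * (σ n).jacobian z t) =
      v * (σ n).A b lam k z t * (σ n).jacobian z t * ∑ a ∈ distributions m ν.1,
        dlogZ b lam k z ((σ n).w z t) i a * pole z ((σ n).w z t) a := by
    rw [Finset.mul_sum]
    exact Finset.sum_congr rfl fun a _ => by ring
  rw [h1, distributions, h, Matrix.mulVec, dotProduct, Finset.mul_sum, Finset.mul_sum]
  exact Finset.sum_congr rfl fun μ _ => by ring

theorem continuousOn_sum_flux (hσ : ∀ n, (σ n).IsOn U) {z : Fin N → ℂ} (hz : z ∈ U) (n : ι)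
    (a : Fin m → Fin N) (v : Fin N → ℂ) :
    ContinuousOn (fun t => ∑ s, fderiv ℝ (flux ((σ n).expo b lam k) ((σ n).poleLog a)
        cubeDir (v, 0) s) (z, t) (0, Pi.single s 1)) (cube m) := by
  refine continuousOn_finsetSum _ fun s _ => ?_
  have h := continuousOn_slice (z := z) (f := fderiv ℝ (flux ((σ n).expo b lam k)
    ((σ n).poleLog a) cubeDir (v, 0) s)) fun t ht =>
      ((contDiffAt_flux (BranchedCube.contDiffAt_expo (hσ n) hz ht)
        (BranchedCube.contDiffAt_poleLog (hσ n) hz ht a) (v, 0) s).fderiv_right (m := 0)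
        (by norm_num)).continuousAt
  exact h.clm_apply continuousOn_const

theorem IsRapidDecayCycle.hasSum_psiHat (hU : IsOpen U) (hΓ : IsRapidDecayCycle b lam k U c σ)
    {z : Fin N → ℂ} (hz : z ∈ U) (μ : HeightIndex N m) :
    HasSum (fun n => c n * ∫ t in cube m, blockDensity b lam k (σ n) μ.1 (z, t))
      (psiHat b lam k c σ z μ) := by
  obtain ⟨W, hW, B, hBs, hB⟩ := hΓ.exists_bound hz μ.1
  rw [psiHat_eq hU hΓ.isOn hz]
  refine (Summable.of_norm_bounded hBs fun n => ?_).hasSum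
  rw [← integral_const_mul]
  refine norm_integral_cube_le fun t ht => ?_
  rw [norm_mul]
  exact (hB n z ⟨mem_of_mem_nhds hW, hz⟩ t ht).1

/-- Integrating the pointwise equation removes the divergences by Stokes' theorem. What is left is
linear in the complex increment `v`, as required for a complex derivative. -/
theorem IsRapidDecayCycle.hasDerivAt_psiHat (hb : b ≠ 0) (hU : IsOpen U)
    (hΓ : IsRapidDecayCycle b lam k U c σ) {z : Fin N → ℂ} (hz : z ∈ U)
    (hzz : ∀ i j, i ≠ j → z i ≠ z j) (i : Fin N) (ν : HeightIndex N m) :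
    HasDerivAt (fun ζ => psiHat b lam k c σ (Function.update z i ζ) ν)
      ((-b ^ 2)⁻¹ * (hatMatrix m lam k i z).mulVec (psiHat b lam k c σ z) ν) (z i) := by
  obtain ⟨W, hW, B, hBs, hB⟩ := hΓ.exists_bound hz ν.1
  have hD : ∀ v : ℂ, ∑' n, c n * ∫ t in cube m,
      fderiv ℝ (blockDensity b lam k (σ n) ν.1) (z, t) (Pi.single i v, 0) =
      ((-b ^ 2)⁻¹ * (hatMatrix m lam k i z).mulVec (psiHat b lam k c σ z) ν) * v := by
    intro v
    have hterm : ∀ n, c n * ∫ t in cube m,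
        fderiv ℝ (blockDensity b lam k (σ n) ν.1) (z, t) (Pi.single i v, 0) =
        (∑ a ∈ distributions m ν.1, c n * ∫ t in cube m, ∑ s, fderiv ℝ
          (flux ((σ n).expo b lam k) ((σ n).poleLog a) cubeDir (Pi.single i v, 0) s) (z, t)
            (0, Pi.single s 1)) +
        ∑ μ : HeightIndex N m, (v * (-b ^ 2)⁻¹ * hatMatrix m lam k i z ν μ) *
          (c n * ∫ t in cube m, blockDensity b lam k (σ n) μ.1 (z, t)) := by
      intro n
      have hi1 : ∀ a ∈ distributions m ν.1, IntegrableOn (fun t => ∑ s, fderiv ℝ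
          (flux ((σ n).expo b lam k) ((σ n).poleLog a) cubeDir (Pi.single i v, 0) s) (z, t)
            (0, Pi.single s 1)) (cube m) := fun a _ =>
        (continuousOn_sum_flux hΓ.isOn hz n a _).integrableOn_compact (isCompact_cube m)
      have hi2 : ∀ μ ∈ (Finset.univ : Finset (HeightIndex N m)), IntegrableOn (fun t =>
          (v * (-b ^ 2)⁻¹ * hatMatrix m lam k i z ν μ) *
            blockDensity b lam k (σ n) μ.1 (z, t)) (cube m) := fun μ _ =>
        (continuousOn_const.mul (continuousOn_blockDensity hΓ.isOn hz n μ.1)).integrableOn_compact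
          (isCompact_cube m)
      rw [integral_congr_ae ((ae_cube_interior m).mono fun t ht =>
        fderiv_blockDensity_apply hb hU hΓ.isOn hz hzz ht n ν i v),
        integral_add (integrable_finsetSum _ hi1) (integrable_finsetSum _ hi2),
        integral_finsetSum _ hi1, integral_finsetSum _ hi2, mul_add, Finset.mul_sum,
        Finset.mul_sum]
      congr 1
      refine Finset.sum_congr rfl fun μ _ => ?_
      rw [integral_const_mul]
      ring
    have hs1 := hasSum_sum (s := distributions m ν.1) fun a _ =>
      IsRapidDecayCycle.hasSum_divergence hU hz (Pi.single i v) hΓ a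
    have hs2 := hasSum_sum (s := (Finset.univ : Finset (HeightIndex N m))) fun μ _ =>
      (hΓ.hasSum_psiHat hU hz μ).mul_left (v * (-b ^ 2)⁻¹ * hatMatrix m lam k i z ν μ)
    rw [tsum_congr hterm, (hs1.add hs2).tsum_eq, Finset.sum_const_zero, zero_add, Matrix.mulVec,
      dotProduct, Finset.mul_sum, Finset.sum_mul]
    exact Finset.sum_congr rfl fun μ _ => by ring
  have key := hasDerivAt_tsum_integral hU
    (fun n y hy t ht => contDiffAt_blockDensity (b := b) (lam := lam) (k := k) hΓ.isOn hy ht n ν.1)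
    hz hW hBs (fun n y hy t ht => (hB n y hy t ht).1) (fun n y hy t ht => (hB n y hy t ht).2) i hD
  refine key.congr_of_eventuallyEq ?_
  have hcont : Continuous fun ζ : ℂ => Function.update z i ζ := by fun_prop
  have hnear : ∀ᶠ ζ in 𝓝 (z i), Function.update z i ζ ∈ U :=
    hcont.continuousAt.eventually_mem (by
      rw [Function.update_eq_self]
      exact hU.mem_nhds hz)
  exact hnear.mono fun ζ hζ => psiHat_eq hU hΓ.isOn hζ ν

theorem IsRapidDecayCycle.solvesHatKZ (hb : b ≠ 0) (hU : IsOpen U)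
    (hΓ : IsRapidDecayCycle b lam k U c σ) {z : Fin N → ℂ} (hz : z ∈ U)
    (hzz : ∀ i j, i ≠ j → z i ≠ z j) (i : Fin N) :
    SolvesHatKZ b lam k i (psiHat b lam k c σ) z := by
  refine ⟨fun ν => (-b ^ 2)⁻¹ * (hatMatrix m lam k i z).mulVec (psiHat b lam k c σ z) ν,
    hasDerivAt_pi.2 fun ν => hΓ.hasDerivAt_psiHat hb hU hz hzz i ν, ?_⟩
  rw [← hatMatrix_mulVec]
  ext ν
  rw [Pi.smul_apply, smul_eq_mul, mul_inv_cancel_left₀ (neg_ne_zero.2 (pow_ne_zero 2 hb))]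

end Blocks

/-! ### The prefactor -/

section Prefactor

variable {N m : ℕ} {b : ℂ} {lam : ℝ} {k : Fin N → ℤ}

/-- A continuous logarithm of a differentiable function is differentiable. -/
theorem hasDerivAt_of_cexp_eq {g h : ℂ → ℂ} {h' x : ℂ} (hg : ContinuousAt g x)
    (hh : HasDerivAt h h' x) (he : ∀ᶠ y in 𝓝 x, Complex.exp (g y) = h y) :
    HasDerivAt g (h' / h x) x := by
  have hx : Complex.exp (g x) = h x := he.self_of_nhds
  have hx0 : h x ≠ 0 := hx ▸ Complex.exp_ne_zero _
  -- Dividing by `h x` moves the values near `1`, where the principal logarithm is differentiable.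
  -- By continuity `g y - g x` has imaginary part within `π`, so it is that logarithm.
  have h1 : HasDerivAt (fun y => Complex.log (h y / h x)) (h' / h x) x := by
    have := (hh.div_const (h x)).clog (by rw [div_self hx0]; exact Complex.one_mem_slitPlane)
    rwa [div_self hx0, div_one] at this
  refine (h1.const_add (g x)).congr_of_eventuallyEq ?_
  have hnear : ∀ᶠ y in 𝓝 x, ‖g y - g x‖ < Real.pi := by
    have : ContinuousAt (fun y => ‖g y - g x‖) x := (hg.sub continuousAt_const).norm
    exact this.eventually_lt continuousAt_const (by simpa using Real.pi_pos)
  filter_upwards [he, hnear] with y hy hyn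
  have him := (Complex.abs_im_le_norm (g y - g x)).trans_lt hyn
  rw [abs_lt] at him
  rw [← hy, ← hx, ← Complex.exp_sub, Complex.log_exp him.1 him.2.le]
  ring

/-- The logarithmic derivative of `φ_0`. -/
theorem hasDerivAt_phiZero (hb : b ≠ 0) {U : Set (Fin N → ℂ)} (hU : IsOpen U)
    {lz : (Fin N → ℂ) → Fin N → Fin N → ℂ}
    (hlz_cont : ∀ i j, i < j → ContinuousOn (fun z => lz z i j) U)
    (hlz_exp : ∀ z ∈ U, ∀ i j, i < j → Complex.exp (lz z i j) = z i - z j)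
    {z : Fin N → ℂ} (hz : z ∈ U) (i : Fin N) :
    HasDerivAt (fun ζ => phiZero b lam k (Function.update z i ζ) (lz (Function.update z i ζ)))
      (phiZero b lam k z (lz z) * ((-b ^ 2)⁻¹ * ((lam : ℂ) / 2 * k i +
        ∑ j ∈ Finset.univ.erase i, (z i - z j)⁻¹ * ((k i : ℂ) * k j / 2)))) (z i) := by
  have hself : Function.update z i (z i) = z := Function.update_eq_self i z
  have hcont : Continuous fun ζ : ℂ => Function.update z i ζ := by fun_prop
  have hnear : ∀ᶠ ζ in 𝓝 (z i), Function.update z i ζ ∈ U :=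
    hcont.continuousAt.eventually_mem (by rw [hself]; exact hU.mem_nhds hz)
  have hcoord : ∀ j, HasDerivAt (fun ζ : ℂ => Function.update z i ζ j)
      ((Pi.single i 1 : Fin N → ℂ) j) (z i) := fun j =>
    hasDerivAt_pi.1 (hasDerivAt_update z i (z i)) j
  have hlog : ∀ p q, p < q → HasDerivAt (fun ζ => lz (Function.update z i ζ) p q)
      (((Pi.single i 1 : Fin N → ℂ) p - (Pi.single i 1 : Fin N → ℂ) q) * (z p - z q)⁻¹) (z i) := by
    intro p q hpq
    have hc : ContinuousAt (fun ζ => lz (Function.update z i ζ) p q) (z i) :=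
      ContinuousAt.comp (g := fun y => lz y p q) (f := fun ζ => Function.update z i ζ)
        (by rw [hself]; exact (hlz_cont p q hpq).continuousAt (hU.mem_nhds hz))
        hcont.continuousAt
    have := hasDerivAt_of_cexp_eq hc ((hcoord p).sub (hcoord q))
      (hnear.mono fun ζ hζ => hlz_exp _ hζ p q hpq)
    simpa [div_eq_mul_inv, hself] using this
  have hlog' : ∀ p, ∀ q ∈ Finset.Ioi p, HasDerivAt (fun ζ =>
      -((k p : ℂ) * (k q : ℂ) / (2 * b ^ 2)) * lz (Function.update z i ζ) p q)
      (-((k p : ℂ) * (k q : ℂ) / (2 * b ^ 2)) *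
        (((Pi.single i 1 : Fin N → ℂ) p - (Pi.single i 1 : Fin N → ℂ) q) * (z p - z q)⁻¹))
      (z i) := fun p q hq => (hlog p q (Finset.mem_Ioi.1 hq)).const_mul _
  have hE := (HasDerivAt.const_mul (-((lam : ℂ) / (2 * b ^ 2)))
    (HasDerivAt.fun_sum (u := Finset.univ) fun j _ => (hcoord j).const_mul (k j : ℂ))).add
    (HasDerivAt.fun_sum (u := Finset.univ) fun p _ => HasDerivAt.fun_sum (hlog' p))
  have hexp : ∀ y, phiZero b lam k y (lz y) = Complex.exp
      (-((lam : ℂ) / (2 * b ^ 2)) * (∑ j, (k j : ℂ) * y j) + ∑ p, ∑ q ∈ Finset.Ioi p,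
        -((k p : ℂ) * (k q : ℂ) / (2 * b ^ 2)) * lz y p q) := by
    intro y
    simp only [phiZero, Complex.exp_add, Complex.exp_sum]
  have hval : -((lam : ℂ) / (2 * b ^ 2)) * (∑ j, (k j : ℂ) * (Pi.single i 1 : Fin N → ℂ) j) +
      ∑ p, ∑ q ∈ Finset.Ioi p, -((k p : ℂ) * (k q : ℂ) / (2 * b ^ 2)) *
        (((Pi.single i 1 : Fin N → ℂ) p - (Pi.single i 1 : Fin N → ℂ) q) * (z p - z q)⁻¹) =
      (-b ^ 2)⁻¹ * ((lam : ℂ) / 2 * k i +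
        ∑ j ∈ Finset.univ.erase i, (z i - z j)⁻¹ * ((k i : ℂ) * k j / 2)) := by
    -- The weights `k_p k_q` are symmetric, and the unit vector keeps only the pairs containing `i`.
    rw [BranchedCube.sum_Ioi_sub_mul_inv
      (κ := fun p q => -((k p : ℂ) * (k q : ℂ) / (2 * b ^ 2))) (fun p q => by ring),
      Finset.sum_eq_single i (fun j _ hj => by simp [hj]) (by simp),
      Finset.sum_eq_single i (fun j _ hj => by simp [hj]) (by simp),
      Finset.sum_erase _ (by simp), Pi.single_eq_same, one_mul, mul_one, mul_add, Finset.mul_sum]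
    congr 1
    · field_simp
    · refine Finset.sum_congr rfl fun j _ => ?_
      field_simp
  simp only [hexp]
  rw [← hval]
  have := hE.cexp
  simp only [Pi.add_apply, hself] at this
  exact this

/-- The logarithmic derivative of `φ_0` contributes exactly what is missing: `Λ k_i / 2` completes
`-Λ μ_i` to `(Λ/2)(k_i - 2 μ_i)`, and `k_i k_j / 2` completes `Ω̂_ij` to `Ω_ij`. -/
theorem solvesCoeffKZ_smul {U : Set (Fin N → ℂ)} (hb : b ≠ 0) (hU : IsOpen U)
    {lz : (Fin N → ℂ) → Fin N → Fin N → ℂ}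
    (hlz_cont : ∀ i j, i < j → ContinuousOn (fun z => lz z i j) U)
    (hlz_exp : ∀ z ∈ U, ∀ i j, i < j → Complex.exp (lz z i j) = z i - z j)
    {z : Fin N → ℂ} (hz : z ∈ U) {i : Fin N} {f : (Fin N → ℂ) → HeightIndex N m → ℂ}
    (hf : SolvesHatKZ b lam k i f z) :
    SolvesCoeffKZ b lam k i (fun y => phiZero b lam k y (lz y) • f y) z := by
  obtain ⟨D, hD, hE⟩ := hf
  have hself : Function.update z i (z i) = z := Function.update_eq_self i z
  have h0 := hasDerivAt_phiZero (lam := lam) (k := k) hb hU hlz_cont hlz_exp hz i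
  refine ⟨_, h0.smul hD, ?_⟩
  rw [hself, smul_add, smul_comm (-b ^ 2) (phiZero b lam k z (lz z)), hE]
  ext ν
  have hb2 : -b ^ 2 ≠ 0 := neg_ne_zero.2 (pow_ne_zero 2 hb)
  have hO : ∀ j, (OmegaMatrix m k i j).transpose.mulVec (f z) ν =
      (OmegaHat m k i j).transpose.mulVec (f z) ν + (k i : ℂ) * k j / 2 * f z ν := by
    intro j
    have : OmegaMatrix m k i j = OmegaHat m k i j + (((k i : ℂ) * (k j : ℂ)) / 2) • 1 := by
      rw [OmegaHat, sub_add_cancel]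
    rw [this, Matrix.transpose_add, Matrix.add_mulVec, Matrix.transpose_smul,
      Matrix.transpose_one, Matrix.smul_mulVec, Matrix.one_mulVec]
    rfl
  simp only [Pi.add_apply, Pi.smul_apply, Finset.sum_apply, smul_eq_mul, Matrix.mulVec_smul, hO,
    HMatrix, AMatrix, Matrix.mulVec_diagonal]
  have hsum : ∑ j ∈ Finset.univ.erase i, (z i - z j)⁻¹ * (phiZero b lam k z (lz z) *
      ((OmegaHat m k i j).transpose.mulVec (f z) ν + (k i : ℂ) * k j / 2 * f z ν)) =
      phiZero b lam k z (lz z) * (∑ j ∈ Finset.univ.erase i,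
        (z i - z j)⁻¹ * (OmegaHat m k i j).transpose.mulVec (f z) ν) +
      phiZero b lam k z (lz z) * (∑ j ∈ Finset.univ.erase i,
        (z i - z j)⁻¹ * ((k i : ℂ) * k j / 2)) * f z ν := by
    rw [Finset.mul_sum, Finset.mul_sum, Finset.sum_mul, ← Finset.sum_add_distrib]
    exact Finset.sum_congr rfl fun j _ => by ring
  rw [hsum]
  have hcancel : -b ^ 2 * (phiZero b lam k z (lz z) * ((-b ^ 2)⁻¹ * ((lam : ℂ) / 2 * k i +
        ∑ j ∈ Finset.univ.erase i, (z i - z j)⁻¹ * ((k i : ℂ) * k j / 2))) * f z ν) =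
      phiZero b lam k z (lz z) * ((lam : ℂ) / 2 * k i +
        ∑ j ∈ Finset.univ.erase i, (z i - z j)⁻¹ * ((k i : ℂ) * k j / 2)) * f z ν := by
    rw [mul_left_comm (phiZero b lam k z (lz z)), mul_assoc, mul_inv_cancel_left₀ hb2]
  rw [hcancel]
  ring

end Prefactor

theorem SolvesKZ.congr {N : ℕ} {b : ℂ} {lam : ℝ} {k : Fin N → ℤ} {i : Fin N} {z : Fin N → ℂ}
    {Φ Ψ : (Fin N → ℂ) → TensorSpace N} {U : Set (Fin N → ℂ)} (hU : IsOpen U) (hz : z ∈ U)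
    (h : ∀ y ∈ U, Ψ y = Φ y) (hΦ : SolvesKZ b lam k i Φ z) : SolvesKZ b lam k i Ψ z := by
  obtain ⟨D, hD, hE⟩ := hΦ
  refine ⟨D, fun l => (hD l).congr_of_eventuallyEq ?_, by rw [h z hz]; exact hE⟩
  have hcont : Continuous fun ζ : ℂ => Function.update z i ζ := by fun_prop
  have hnear : ∀ᶠ ζ in 𝓝 (z i), Function.update z i ζ ∈ U :=
    hcont.continuousAt.eventually_mem (by
      rw [Function.update_eq_self]
      exact hU.mem_nhds hz)
  exact hnear.mono fun ζ hζ => by simp only [h _ hζ]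

end IrregularKZ

theorem mainTheorem1 {N m : ℕ} (b : ℂ) (hb : b ≠ 0) (lam : ℝ) (k : Fin N → ℤ)
    (U : Set (Fin N → ℂ)) (hU : IsOpen U)
    (lz : (Fin N → ℂ) → Fin N → Fin N → ℂ)
    (hlz_cont : ∀ i j, i < j → ContinuousOn (fun z => lz z i j) U)
    (hlz_exp : ∀ z ∈ U, ∀ i j, i < j → Complex.exp (lz z i j) = z i - z j)
    {ι : Type*} (c : ι → ℂ) (σ : ι → BranchedCube N m)
    (hΓ : IsRapidDecayCycle b lam k U c σ) :
    -- the integrals converge absolutely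
    (∀ z ∈ U, ∀ μ : HeightIndex N m, CycleIntegrable c σ z (phiIntegrand b lam k σ μ.1 z)) ∧
    (∀ z ∈ U, ∀ ν : Fin N → ℕ, CycleIntegrable c σ z
      (fun n t => (tensorBasis N).repr (vectorIntegrand b lam k σ z n t) ν)) ∧
    -- the equation for the vector of the `φ^{(μ)}`
    (∀ z ∈ U, ∀ i, SolvesHatKZ b lam k i (psiHat b lam k c σ) z) ∧
    -- the equation for the full conformal block `φ_0 φ^{(μ)}`
    (∀ z ∈ U, ∀ i,
      SolvesCoeffKZ b lam k i (fun y => phiZero b lam k y (lz y) • psiHat b lam k c σ y) z) ∧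
    -- the operator form of the equation
    (∀ z ∈ U, ∀ i, SolvesKZ b lam k i (blockVector b lam k lz c σ) z) ∧
    -- the coefficients of `Ψ`
    (∀ z ∈ U, blockVector b lam k lz c σ z =
      ∑ μ : HeightIndex N m,
        (phiZero b lam k z (lz z) * psiHat b lam k c σ z μ) • descendant μ.1) ∧
    -- equivalence of the coefficient form and the operator form
    (∀ (f : (Fin N → ℂ) → HeightIndex N m → ℂ) (z : Fin N → ℂ) (i : Fin N),
      SolvesCoeffKZ b lam k i f z ↔
        SolvesKZ b lam k i (fun y => ∑ μ : HeightIndex N m, f y μ • descendant μ.1) z) ∧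
    -- the action of `H_i` on the basis vectors
    (∀ (μ : Fin N → ℕ) (i : Fin N),
      opH k i (descendant μ) = ((k i : ℂ) - 2 * (μ i : ℂ)) • descendant μ) := by
  -- The points are distinct because their differences have logarithms.
  have hzz : ∀ z ∈ U, ∀ i j, i ≠ j → z i ≠ z j := by
    intro z hz i j hij
    rcases lt_or_gt_of_ne hij with h | h
    · rw [← sub_ne_zero, ← hlz_exp z hz i j h]
      exact Complex.exp_ne_zero _
    · refine Ne.symm ?_
      rw [← sub_ne_zero, ← hlz_exp z hz j i h]
      exact Complex.exp_ne_zero _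
  have hcoeff : ∀ z ∈ U, ∀ i, SolvesCoeffKZ b lam k i
      (fun y => phiZero b lam k y (lz y) • psiHat b lam k c σ y) z := fun z hz i =>
    solvesCoeffKZ_smul hb hU hlz_cont hlz_exp hz (hΓ.solvesHatKZ hb hU hz (hzz z hz) i)
  refine ⟨fun z hz μ => hΓ.cycleIntegrable hU hz μ.1, fun z hz ν => ?_,
    fun z hz i => hΓ.solvesHatKZ hb hU hz (hzz z hz) i, hcoeff, fun z hz i => ?_,
    fun z _ => blockVector_eq b lam k lz c σ z,
    fun f z i => solvesCoeffKZ_iff b lam k f z i, fun μ i => ?_⟩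
  · simp only [repr_vectorIntegrand]
    exact hΓ.cycleIntegrable hU hz ν
  · exact SolvesKZ.congr hU hz (fun y _ => blockVector_eq b lam k lz c σ y)
      ((solvesCoeffKZ_iff b lam k _ z i).1 (hcoeff z hz i))
  · rw [descendant_eq, opH_tensorBasis]
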